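/- Let $K=\mathbf F_q$ be a finite field and $V\cong K^n$ a $K$-vector space of dimension $n\ge 2$. A transvection is an element $t\in\mathrm{SL}(V)$ such that $t-1$ has rank one; equivalently $t=1+v\otimes\phi$ (i.e. $t(x)=x+\phi(x)v$) with $0\ne v\in V$, $0\ne\phi\in V^*$, $\phi(v)=0$. For a set $T$ of transvections put $V(T)=\sum_{t\in T}\operatorname{im}(t-1)\le V$ and $V^*(T)=\sum_{t\in T}\ker(t-1)^{\perp}\le V^*$. Call $T$ *dense* if for all nonzero $u\in V$ and $\psi\in V^*$ there is $1+v\otimes\phi\in T$ with $\psi(v)\ne0$ and $\phi(u)\neq 0$. Call $T$ *nondegenerate* if the natural pairing $V(T)\times V^*(T)\to K$ has zero left kernel and zero right kernel, and *weakly nondegenerate* if it has zero left kernel or zero right kernel. For a group $G\le\mathrm{GL}(V)$ let $[V,G]$ be the span of all $gv-v$ with $g\in G$, $v\in V$; for a $G$-invariant subspace $W$ let $G|W$ be the induced group in $\mathrm{GL}(W)$. Let $W$ be a $K$-vector space of finite dimension $d\geq 2$ and $H\le\mathrm{GL}(W)$. We say that $H$ has *monomial type* if $q$ is even and there are a divisor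 $a>1$ of $q-1$ and a basis of $W$ such that $H$ is the group $M_d(a)\cong C_a^{d-1}\rtimes S_d$ of all elements of $\mathrm{SL}(W)$ represented in this basis by monomial matrices whose nonzero entries are $a$-th roots of unity. We say that $H$ has *odd symmetric type* if $q$ is even, $d=m-1$ with $m$ odd, and $W$ can be identified with the hyperplane $\{x\in K^m:\sum_i x_i=0\}$ in such a way that $H$ is the group of all permutations $S_m$ of the coordinates. Let $T$ be a dense set of transvections in $\mathrm{SL}(V)$ and $G=\langle T\rangle$, and suppose that $G$ preserves no symplectic form (nondegenerate alternating bilinear form) on $V$. Then the following are equivalent: 1. $G$ has monomial type; 2. for every subset $T_0\subseteq T$ with $|T_0|\le 1000$: (a) if $T_0$ is weakly nondegenerate then it is nondegenerate, and (b) if $G_0=\langle T_0\rangle$ acts irreducibly on $V_0=[V,G_0]$ and $\dim V_0\ge2$, then $G_0|V_0$ has monomial type or odd symmetric type. -/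

import Mathlib

open Module

namespace TransvectionGroups

variable {K V : Type*} [Field K] [AddCommGroup V] [Module K V]

/-- The linear map `g - 1`. -/
def subOne (g : V ≃ₗ[K] V) : V →ₗ[K] V := (g : V →ₗ[K] V) - LinearMap.id

/-- A transvection is an element `t` of `SL(V)` such that `t - 1` has rank one. -/
def IsTransvection (t : V ≃ₗ[K] V) : Prop :=
  LinearMap.det (t : V →ₗ[K] V) = 1 ∧ finrank K (LinearMap.range (subOne t)) = 1

/-- `T` is dense if for all nonzero `v` in `V` and nonzero `φ` in `V*` there is
`t = 1 + u ⊗ ψ` in `T` with `φ(u) ≠ 0` and `ψ(v) ≠ 0`. -/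
def IsDense (T : Set (V ≃ₗ[K] V)) : Prop :=
  ∀ v : V, v ≠ 0 → ∀ φ : Dual K V, φ ≠ 0 →
    ∃ t ∈ T, ∃ (u : V) (ψ : Dual K V), (∀ x, t x = x + ψ x • u) ∧ φ u ≠ 0 ∧ ψ v ≠ 0

/-- The subspace `V(T)` of `V`, the sum of the images of `t - 1` for `t` in `T`. -/
def vecSpan (T : Set (V ≃ₗ[K] V)) : Submodule K V :=
  ⨆ t ∈ T, LinearMap.range (subOne t)

/-- The subspace `V*(T)` of `V*`, the sum of the annihilators of `ker (t - 1)` for `t` in `T`. -/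
def covecSpan (T : Set (V ≃ₗ[K] V)) : Submodule K (Dual K V) :=
  ⨆ t ∈ T, (LinearMap.ker (subOne t)).dualAnnihilator

/-- The pairing `V(T) × V*(T) → K` has zero left kernel. -/
def ZeroLeftKernel (T : Set (V ≃ₗ[K] V)) : Prop :=
  ∀ v ∈ vecSpan T, (∀ φ ∈ covecSpan T, φ v = 0) → v = 0

/-- The pairing `V(T) × V*(T) → K` has zero right kernel. -/
def ZeroRightKernel (T : Set (V ≃ₗ[K] V)) : Prop :=
  ∀ φ ∈ covecSpan T, (∀ v ∈ vecSpan T, φ v = 0) → φ = 0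

def IsNondegenerate (T : Set (V ≃ₗ[K] V)) : Prop :=
  ZeroLeftKernel T ∧ ZeroRightKernel T

def IsWeaklyNondegenerate (T : Set (V ≃ₗ[K] V)) : Prop :=
  ZeroLeftKernel T ∨ ZeroRightKernel T

/-- `G` preserves a symplectic (nondegenerate alternating bilinear) form on `V`. -/
def PreservesSymplecticForm (G : Subgroup (V ≃ₗ[K] V)) : Prop :=
  ∃ B : LinearMap.BilinForm K V, B.IsAlt ∧ B.Nondegenerate ∧
    ∀ g ∈ G, ∀ x y, B (g x) (g y) = B x y

/-- The commutator space `[V, G]`, spanned by the vectors `g v - v`. -/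
def commutatorSpace (G : Subgroup (V ≃ₗ[K] V)) : Submodule K V :=
  Submodule.span K {w | ∃ g ∈ G, ∃ v : V, w = g v - v}

/-- For a `G`-invariant subspace `W`, the group `G | W` of linear automorphisms of `W`
induced by the elements of `G`. -/
def restrict (G : Subgroup (V ≃ₗ[K] V)) (W : Submodule K V) : Subgroup (W ≃ₗ[K] W) where
  carrier := {h | ∃ g ∈ G, ∀ w : W, (h w : V) = g w}
  one_mem' := ⟨1, G.one_mem, fun _ => rfl⟩
  mul_mem' := by
    rintro h h' ⟨g, hg, hgh⟩ ⟨g', hg', hgh'⟩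
    exact ⟨g * g', G.mul_mem hg hg', fun w => by
      rw [LinearEquiv.mul_apply, LinearEquiv.mul_apply, hgh, hgh']⟩
  inv_mem' := by
    rintro h ⟨g, hg, hgh⟩
    refine ⟨g⁻¹, G.inv_mem hg, fun w => ?_⟩
    have h1 := hgh (h⁻¹ w)
    have h2 : h (h⁻¹ w) = w := h.apply_symm_apply w
    rw [h2] at h1
    rw [h1]
    exact (g.symm_apply_apply _).symm

/-- `G` acts irreducibly on `V`. -/
def IsIrreducibleGroup (G : Subgroup (V ≃ₗ[K] V)) : Prop :=
  Nontrivial V ∧ ∀ W : Submodule K V, (∀ g ∈ G, ∀ w ∈ W, g w ∈ W) → W = ⊥ ∨ W = ⊤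

/-- `g` lies in `SL(V)` and is represented in the basis `b` by a monomial matrix whose nonzero
entries are `a`-th roots of unity; for the standard basis of `K ^ n` these elements form `M_n(a)`. -/
def IsMonomialElement {n : ℕ} (b : Basis (Fin n) K V) (a : ℕ) (g : V ≃ₗ[K] V) : Prop :=
  LinearMap.det (g : V →ₗ[K] V) = 1 ∧
    ∃ (σ : Equiv.Perm (Fin n)) (c : Fin n → K),
      (∀ i, c i ^ a = 1) ∧ ∀ i, g (b i) = c i • b (σ i)

/-- `G` has monomial type: `K` has characteristic `2` and, with respect to some basis of `V`, `G`
is the group `M_n(a) ≅ C_a ^ (n - 1) ⋊ S_n`, for some `n ≥ 2` and some divisor `a > 1` of `q - 1`,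
where `q = |K|`. -/
def HasMonomialType (G : Subgroup (V ≃ₗ[K] V)) : Prop :=
  CharP K 2 ∧ ∃ n : ℕ, 2 ≤ n ∧ ∃ a : ℕ, 1 < a ∧ a ∣ Nat.card K - 1 ∧
    ∃ b : Basis (Fin n) K V, ∀ g : V ≃ₗ[K] V, g ∈ G ↔ IsMonomialElement b a g

/-- The hyperplane of vectors with zero coordinate sum in the permutation module `K ^ m`. -/
def sumZero (K : Type*) [Field K] (m : ℕ) : Submodule K (Fin m → K) :=
  LinearMap.ker (∑ i : Fin m, (LinearMap.proj i : (Fin m → K) →ₗ[K] K))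

/-- `G` has odd symmetric type: `K` has characteristic `2` and `V` can be identified with the
zero-sum hyperplane of `K ^ m`, with `m ≥ 3` odd, in such a way that `G` is the image of `S_m`.
(This is the scalar extension to `K` of the same module over the field with two elements.) -/
def HasOddSymmetricType (G : Subgroup (V ≃ₗ[K] V)) : Prop :=
  CharP K 2 ∧ ∃ m : ℕ, 3 ≤ m ∧ Odd m ∧ ∃ e : V ≃ₗ[K] sumZero K m,
    ∀ g : V ≃ₗ[K] V, g ∈ G ↔ ∃ σ : Equiv.Perm (Fin m), ∀ (x : V) (i : Fin m),
      (e (g x) : Fin m → K) (σ i) = (e x : Fin m → K) i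

end TransvectionGroups

/-! Write each `t` in `T` as `1 + v t ⊗ φ t`. The argument lives on the matrix of pairings `φ t (v
s)` and on the digraph with an arrow from `s` to `t` when this entry is nonzero.

From small subsets to `T`: call a subset good if its digraph is strongly connected and its pairing
is nondegenerate. By density and condition (a), a few elements of `T` can be put into a good set of
bounded size (`IsGood.exists_union`). A good set generates a group irreducible on its commutator
space, so (b) applies to it. Odd symmetric type comes with an invariant alternating form, which
makes the pairing matrix symmetric after scaling rows ("balanced"). If all quintuples in `T` were
balanced, the scalings would glue to a symplectic form preserved by `⟨T⟩`
(`preservesSymplecticForm_of_isBalanced`). Hence some quintuple is unbalanced, and every good set of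
admissible size containing it has monomial type.

Monomial type gives a frame, that is, vectors with dual covectors, of which the transvections are
edges labelled by gains in `Kˣ`. Frames of different good sets are compared through one common
vertex. Two parallel edges `s`, `t` with different gains determine their two vertices as eigenlines
of `s * t`, and parallelism can usually be read off from pairings (`exists_vertex_mem_all_frames`).
The exception is `a = 3` in dimension at most three. There the good set spans `V`, and either it
already generates `⟨T⟩` or one further element of `T` changes `a`. Once a common vertex is fixed,
its neighbours are recognised through the edges joining them to it, and density makes them a basis
of which all of `T` are edges (`HasLocalFrames.exists_basis`). After rescaling, the gains form a
subgroup `H` of `Kˣ`, and `⟨T⟩` contains every edge with gain in `H`. Density excludes `H = 1`, so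
`⟨T⟩` is `M_n(|H|)`.

From `T` to small subsets: `T` consists of edges of a basis. The equations `p = c q` and `p⁻¹ = c⁻¹
q⁻¹` are equivalent, so inverting coordinates matches the annihilators of `V(T₀)` and `V*(T₀)`.
These spaces therefore have equal dimension, which gives (a). For (b), irreducibility makes the
edges of `T₀` a connected graph on part of the basis. Its gain group `H` yields monomial type if
nontrivial and odd symmetric type if trivial. -/

namespace TransvectionGroups

/-! ### Transvections as `1 + v ⊗ φ` -/

variable {K V : Type*} [Field K] [AddCommGroup V] [Module K V]

/-- `t` is the transvection `1 + v ⊗ φ`. -/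
structure IsTransvectionAlong (t : V ≃ₗ[K] V) (v : V) (φ : Dual K V) : Prop where
  apply_self : φ v = 0
  vec_ne : v ≠ 0
  covec_ne : φ ≠ 0
  apply : ∀ x, t x = x + φ x • v

theorem subOne_apply (t : V ≃ₗ[K] V) (x : V) : subOne t x = t x - x := by
  simp [subOne]

theorem IsTransvection.exists_along [FiniteDimensional K V] {t : V ≃ₗ[K] V}
    (ht : IsTransvection t) : ∃ v φ, IsTransvectionAlong t v φ := by
  obtain ⟨hdet, hrank⟩ := ht
  obtain ⟨⟨v, hv⟩, hv0, hspan⟩ := finrank_eq_one_iff'.1 hrank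
  have hv0' : v ≠ 0 := fun h => hv0 (Subtype.ext h)
  have key : ∀ x, ∃ c : K, c • v = subOne t x := fun x => by
    obtain ⟨c, hc⟩ := hspan ⟨subOne t x, LinearMap.mem_range_self _ x⟩
    exact ⟨c, congrArg Subtype.val hc⟩
  choose φ hφ using key
  let φ' : Dual K V :=
    { toFun := φ
      map_add' := fun x y => by
        apply smul_left_injective K hv0'
        simp only [add_smul, hφ, map_add]
      map_smul' := fun c x => by
        apply smul_left_injective K hv0'
        simp only [hφ, map_smul, smul_eq_mul, mul_smul, RingHom.id_apply] }
  have happ : ∀ x, t x = x + φ' x • v := fun x => by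
    have : φ' x • v = t x - x := by rw [← subOne_apply]; exact hφ x
    rw [this]; abel
  have hmap : (t : V →ₗ[K] V) = LinearMap.transvection φ' v := by
    ext x; simp [LinearMap.transvection.apply, happ]
  refine ⟨v, φ', ?_, hv0', ?_, happ⟩
  · rw [hmap, LinearMap.transvection.det] at hdet
    simpa using hdet
  · rintro h0
    obtain ⟨x, hx⟩ := hv
    apply hv0'
    rw [← hx, subOne_apply, happ, h0]; simp

namespace IsTransvectionAlong

variable {t : V ≃ₗ[K] V} {v v' : V} {φ φ' : Dual K V}

theorem range_subOne (h : IsTransvectionAlong t v φ) :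
    LinearMap.range (subOne t) = Submodule.span K {v} := by
  ext x
  rw [Submodule.mem_span_singleton, LinearMap.mem_range]
  constructor
  · rintro ⟨y, rfl⟩
    exact ⟨φ y, by rw [subOne_apply, h.apply]; abel⟩
  · rintro ⟨c, rfl⟩
    obtain ⟨y, hy⟩ := (LinearMap.surjective h.covec_ne) c
    exact ⟨y, by rw [subOne_apply, h.apply, hy]; abel⟩

theorem ker_subOne (h : IsTransvectionAlong t v φ) :
    LinearMap.ker (subOne t) = LinearMap.ker φ := by
  ext x
  rw [LinearMap.mem_ker, LinearMap.mem_ker, subOne_apply, h.apply, add_sub_cancel_left]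
  simp [h.vec_ne]

theorem dualAnnihilator_ker (h : IsTransvectionAlong t v φ) :
    (LinearMap.ker (subOne t)).dualAnnihilator = Submodule.span K {φ} := by
  rw [h.ker_subOne]
  ext ψ
  rw [Submodule.mem_dualAnnihilator, Submodule.mem_span_singleton]
  constructor
  · intro hψ
    obtain ⟨y, hy⟩ := (LinearMap.surjective h.covec_ne) 1
    refine ⟨ψ y, ?_⟩
    ext x
    have := hψ (x - φ x • y) (by simp [hy])
    simp only [map_sub, map_smul, smul_eq_mul] at this
    simp only [LinearMap.smul_apply, smul_eq_mul]
    linear_combination -this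
  · rintro ⟨c, rfl⟩ x hx
    simp [LinearMap.mem_ker.1 hx]

/-- A scalar moved between the two tensor factors is the only freedom in the choice of `v` and `φ`.
Later arguments use only expressions whose vanishing, or whose value, is unaffected by it. -/
theorem exists_smul (h : IsTransvectionAlong t v φ) (hap : ∀ x, t x = x + φ' x • v') :
    ∃ α : K, α ≠ 0 ∧ v' = α • v ∧ φ' = α⁻¹ • φ := by
  have h1 : ∀ x, φ x • v = φ' x • v' := fun x => by
    have := h.apply x
    rw [hap] at this
    exact (add_left_cancel this).symm
  obtain ⟨y, hy⟩ := (LinearMap.surjective h.covec_ne) 1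
  have h2 : v = φ' y • v' := by rw [← h1, hy, one_smul]
  have h3 : φ' y ≠ 0 := fun h0 => h.vec_ne (by rw [h2, h0, zero_smul])
  have hv' : v' ≠ 0 := fun h0 => h.vec_ne (by rw [h2, h0, smul_zero])
  refine ⟨(φ' y)⁻¹, inv_ne_zero h3, by rw [h2, smul_smul, inv_mul_cancel₀ h3, one_smul], ?_⟩
  ext x
  have := h1 x
  rw [h2, smul_smul] at this
  have := smul_left_injective K hv' this
  simp only [LinearMap.smul_apply, inv_inv, smul_eq_mul]
  linear_combination -this

end IsTransvectionAlong

/-- `v` and `φ` present every element `t` of `T` as the transvection `1 + v t ⊗ φ t`. -/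
def IsPresentation (T : Set (V ≃ₗ[K] V)) (v : (V ≃ₗ[K] V) → V) (φ : (V ≃ₗ[K] V) → Dual K V) :
    Prop :=
  ∀ t ∈ T, IsTransvectionAlong t (v t) (φ t)

theorem exists_isPresentation [FiniteDimensional K V] {T : Set (V ≃ₗ[K] V)}
    (hT : ∀ t ∈ T, IsTransvection t) : ∃ v φ, IsPresentation T v φ := by
  classical
  choose! v φ h using fun t ht => (hT t ht).exists_along
  exact ⟨v, φ, h⟩

section Presentation

variable {S T : Set (V ≃ₗ[K] V)} {v : (V ≃ₗ[K] V) → V} {φ : (V ≃ₗ[K] V) → Dual K V}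

theorem IsPresentation.mono (h : IsPresentation T v φ) (hS : S ⊆ T) : IsPresentation S v φ :=
  fun t ht => h t (hS ht)

theorem IsPresentation.vecSpan_eq (h : IsPresentation T v φ) :
    vecSpan T = Submodule.span K (v '' T) := by
  rw [vecSpan, Submodule.span_eq_iSup_of_singleton_spans, iSup_image]
  exact iSup_congr fun t => iSup_congr fun ht => (h t ht).range_subOne

theorem IsPresentation.covecSpan_eq (h : IsPresentation T v φ) :
    covecSpan T = Submodule.span K (φ '' T) := by
  rw [covecSpan, Submodule.span_eq_iSup_of_singleton_spans, iSup_image]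
  exact iSup_congr fun t => iSup_congr fun ht => (h t ht).dualAnnihilator_ker

theorem IsPresentation.vec_mem (h : IsPresentation T v φ) {t} (ht : t ∈ T) : v t ∈ vecSpan T := by
  rw [h.vecSpan_eq]; exact Submodule.subset_span ⟨t, ht, rfl⟩

theorem IsPresentation.covec_mem (h : IsPresentation T v φ) {t} (ht : t ∈ T) :
    φ t ∈ covecSpan T := by
  rw [h.covecSpan_eq]; exact Submodule.subset_span ⟨t, ht, rfl⟩

theorem IsPresentation.forall_covecSpan_iff (h : IsPresentation T v φ) (x : V) :
    (∀ ψ ∈ covecSpan T, ψ x = 0) ↔ ∀ t ∈ T, φ t x = 0 := by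
  refine ⟨fun hx t ht => hx _ (h.covec_mem ht), fun hx ψ hψ => ?_⟩
  rw [h.covecSpan_eq] at hψ
  induction hψ using Submodule.span_induction with
  | mem ψ hψ => obtain ⟨t, ht, rfl⟩ := hψ; exact hx t ht
  | zero => rfl
  | add a b _ _ ha hb => simp [ha, hb]
  | smul c a _ ha => simp [ha]

theorem IsPresentation.forall_vecSpan_iff (h : IsPresentation T v φ) (ψ : Dual K V) :
    (∀ x ∈ vecSpan T, ψ x = 0) ↔ ∀ t ∈ T, ψ (v t) = 0 := by
  refine ⟨fun hx t ht => hx _ (h.vec_mem ht), fun hx x hxT => ?_⟩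
  rw [h.vecSpan_eq] at hxT
  induction hxT using Submodule.span_induction with
  | mem y hy => obtain ⟨t, ht, rfl⟩ := hy; exact hx t ht
  | zero => simp
  | add a b _ _ ha hb => simp [ha, hb]
  | smul c a _ ha => simp [ha]

theorem IsPresentation.commutatorSpace_eq (h : IsPresentation T v φ) :
    commutatorSpace (Subgroup.closure T) = vecSpan T := by
  apply le_antisymm
  · rw [commutatorSpace, Submodule.span_le]
    rintro _ ⟨g, hg, x, rfl⟩
    change g x - x ∈ vecSpan T
    induction hg using Subgroup.closure_induction generalizing x with
    | mem t ht =>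
      rw [(h t ht).apply, add_sub_cancel_left]
      exact Submodule.smul_mem _ _ (h.vec_mem ht)
    | one => simp
    | mul a b _ _ ha hb =>
      rw [LinearEquiv.mul_apply, ← sub_add_sub_cancel _ (b x)]
      exact Submodule.add_mem _ (ha _) (hb _)
    | inv a _ ha =>
      have := ha (a⁻¹ x)
      have h2 : a (a⁻¹ x) = x := a.apply_symm_apply x
      rw [h2] at this
      rw [← neg_sub]; exact Submodule.neg_mem _ this
  · rw [h.vecSpan_eq, Submodule.span_le]
    rintro _ ⟨t, ht, rfl⟩
    obtain ⟨y, hy⟩ := (LinearMap.surjective (h t ht).covec_ne) 1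
    exact Submodule.subset_span ⟨t, Subgroup.subset_closure ht, y, by
      rw [(h t ht).apply, hy, one_smul, add_sub_cancel_left]⟩

theorem IsPresentation.closure_apply_of_forall (h : IsPresentation T v φ) {x : V}
    (hx : ∀ t ∈ T, φ t x = 0) {g : V ≃ₗ[K] V} (hg : g ∈ Subgroup.closure T) : g x = x := by
  induction hg using Subgroup.closure_induction with
  | mem t ht => rw [(h t ht).apply, hx t ht, zero_smul, add_zero]
  | one => rfl
  | mul a b _ _ ha hb => rw [LinearEquiv.mul_apply, hb, ha]
  | inv a _ ha =>
    conv_lhs => rw [← ha]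
    exact a.symm_apply_apply x

theorem IsPresentation.dense (h : IsPresentation T v φ) (hd : IsDense T) {x : V} (hx : x ≠ 0)
    {ψ : Dual K V} (hψ : ψ ≠ 0) : ∃ t ∈ T, φ t x ≠ 0 ∧ ψ (v t) ≠ 0 := by
  obtain ⟨t, ht, u, χ, hap, h1, h2⟩ := hd x hx ψ hψ
  obtain ⟨α, hα, rfl, rfl⟩ := (h t ht).exists_smul hap
  refine ⟨t, ht, ?_, ?_⟩
  · simp only [LinearMap.smul_apply, smul_eq_mul] at h2
    exact right_ne_zero_of_mul h2
  · simp only [map_smul, smul_eq_mul] at h1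
    exact right_ne_zero_of_mul h1

/-- Density in digraph terms: any two vertices are joined by a directed path of length two. -/
theorem IsPresentation.dense_link (h : IsPresentation T v φ) (hd : IsDense T) {s t}
    (hs : s ∈ T) (ht : t ∈ T) : ∃ r ∈ T, φ r (v s) ≠ 0 ∧ φ t (v r) ≠ 0 :=
  h.dense hd (h s hs).vec_ne (h t ht).covec_ne

end Presentation

end TransvectionGroups

/-! ### Good sets: strongly connected and nondegenerate subsets -/

namespace TransvectionGroups

variable {K V : Type*} [Field K] [AddCommGroup V] [Module K V]

/-- The digraph on `S` with an arrow from `s` to `t` when `φ t (v s) ≠ 0` is strongly connected. -/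
def IsStronglyConnected (S : Set (V ≃ₗ[K] V)) (v : (V ≃ₗ[K] V) → V)
    (φ : (V ≃ₗ[K] V) → Dual K V) : Prop :=
  ∀ R ⊆ S, R.Nonempty → (∀ s ∈ R, ∀ t ∈ S, φ t (v s) ≠ 0 → t ∈ R) → S ⊆ R

/-- The left kernel of the pairing of `V(S)` and `V*(S)`. -/
def leftKernel (S : Set (V ≃ₗ[K] V)) : Submodule K V :=
  vecSpan S ⊓ (covecSpan S).dualCoannihilator

variable {S T : Set (V ≃ₗ[K] V)} {v : (V ≃ₗ[K] V) → V} {φ : (V ≃ₗ[K] V) → Dual K V}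

theorem zeroLeftKernel_iff : ZeroLeftKernel S ↔ leftKernel S = ⊥ := by
  rw [Submodule.eq_bot_iff]
  constructor
  · rintro h x ⟨h1, h2⟩
    exact h x h1 fun ψ hψ => (Submodule.mem_dualCoannihilator x).1 h2 ψ hψ
  · intro h x h1 h2
    exact h x ⟨h1, (Submodule.mem_dualCoannihilator x).2 h2⟩

theorem IsPresentation.mem_leftKernel_iff (h : IsPresentation S v φ) {x : V} :
    x ∈ leftKernel S ↔ x ∈ vecSpan S ∧ ∀ t ∈ S, φ t x = 0 := by
  rw [leftKernel, Submodule.mem_inf, Submodule.mem_dualCoannihilator, h.forall_covecSpan_iff]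

theorem isStronglyConnected_singleton (t : V ≃ₗ[K] V) : IsStronglyConnected {t} v φ := by
  rintro S' hS' ⟨s, hs⟩ -
  obtain rfl := hS' hs
  simpa using hs

/-- Attaching an ear to a strongly connected digraph keeps it strongly connected. Here the ear has
one inner vertex; in `insert_path` it is a closed walk through `s`, `r`, `t`, `r'`. -/
theorem IsStronglyConnected.insert_vertex (h : IsStronglyConnected S v φ) {s s' t : V ≃ₗ[K] V}
    (hs : s ∈ S) (hs' : s' ∈ S) (h1 : φ t (v s) ≠ 0) (h2 : φ s' (v t) ≠ 0) :
    IsStronglyConnected (insert t S) v φ := by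
  intro S' hS' hne hcl
  have hS : (S' ∩ S).Nonempty := by
    obtain ⟨r, hr⟩ := hne
    rcases hS' hr with rfl | hr'
    · exact ⟨s', hcl _ hr _ (Or.inr hs') h2, hs'⟩
    · exact ⟨r, hr, hr'⟩
  have hsub : S ⊆ S' := fun r hr => (h (S' ∩ S) Set.inter_subset_right hS
    (fun a ha b hb hab => ⟨hcl a ha.1 b (Or.inr hb) hab, hb⟩) hr).1
  exact Set.insert_subset (hcl _ (hsub hs) _ (Or.inl rfl) h1) hsub

theorem IsStronglyConnected.insert_path (h : IsStronglyConnected S v φ) {s t r r' : V ≃ₗ[K] V}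
    (hs : s ∈ S) (h1 : φ r (v s) ≠ 0) (h2 : φ t (v r) ≠ 0) (h3 : φ r' (v t) ≠ 0)
    (h4 : φ s (v r') ≠ 0) : IsStronglyConnected (insert t (insert r (insert r' S))) v φ := by
  intro S' hS' hne hcl
  have htt : t ∈ insert t (insert r (insert r' S)) := Or.inl rfl
  have hrr : r ∈ insert t (insert r (insert r' S)) := Or.inr (Or.inl rfl)
  have hrr' : r' ∈ insert t (insert r (insert r' S)) := Or.inr (Or.inr (Or.inl rfl))
  have hSS : ∀ a ∈ S, a ∈ insert t (insert r (insert r' S)) :=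
    fun a ha => Or.inr (Or.inr (Or.inr ha))
  have hS : (S' ∩ S).Nonempty := by
    have hr'S : r' ∈ S' → (S' ∩ S).Nonempty := fun hr => ⟨s, hcl _ hr _ (hSS s hs) h4, hs⟩
    have htS : t ∈ S' → (S' ∩ S).Nonempty := fun hr => hr'S (hcl _ hr _ hrr' h3)
    obtain ⟨a, ha⟩ := hne
    rcases hS' ha with rfl | rfl | rfl | ha'
    · exact htS ha
    · exact htS (hcl _ ha _ htt h2)
    · exact hr'S ha
    · exact ⟨a, ha, ha'⟩
  have hsub : S ⊆ S' := fun r hr => (h (S' ∩ S) Set.inter_subset_right hS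
    (fun a ha b hb hab => ⟨hcl a ha.1 b (hSS b hb) hab, hb⟩) hr).1
  have m1 := hcl _ (hsub hs) _ hrr h1
  have m2 := hcl _ m1 _ htt h2
  have m3 := hcl _ m2 _ hrr' h3
  exact Set.insert_subset m2 (Set.insert_subset m1 (Set.insert_subset m3 hsub))

/-- The quotient of the larger intersection by the smaller one embeds in `(A + ⟨u⟩) / A`, which has
dimension at most one. -/
theorem finrank_sup_span_singleton_inf_le [FiniteDimensional K V] (A B : Submodule K V) (u : V) :
    finrank K ((A ⊔ Submodule.span K {u}) ⊓ B : Submodule K V) ≤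
      finrank K (A ⊓ B : Submodule K V) + 1 := by
  set C := (A ⊔ Submodule.span K {u}) ⊓ B with hC
  have h1 := Submodule.finrank_sup_add_finrank_inf_eq A C
  have h2 : A ⊓ C = A ⊓ B := by
    rw [hC, ← inf_assoc, inf_of_le_left (le_sup_left : A ≤ A ⊔ Submodule.span K {u})]
  have h3 : finrank K (A ⊔ C : Submodule K V) ≤ finrank K A + 1 := by
    calc finrank K (A ⊔ C : Submodule K V)
        ≤ finrank K (A ⊔ Submodule.span K {u} : Submodule K V) :=
          Submodule.finrank_mono (sup_le le_sup_left inf_le_left)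
      _ ≤ finrank K A + finrank K (Submodule.span K {u}) :=
          Submodule.finrank_add_le_finrank_add_finrank _ _
      _ ≤ finrank K A + 1 := by
          gcongr
          exact (finrank_span_le_card ({u} : Set V)).trans (by simp)
  rw [h2] at h1
  omega

theorem vecSpan_mono (h : S ⊆ T) : vecSpan S ≤ vecSpan T := biSup_mono h

theorem covecSpan_mono (h : S ⊆ T) : covecSpan S ≤ covecSpan T := biSup_mono h

theorem IsPresentation.vecSpan_insert {t : V ≃ₗ[K] V} (h : IsPresentation (insert t S) v φ) :
    vecSpan (insert t S) = vecSpan S ⊔ Submodule.span K {v t} := by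
  rw [h.vecSpan_eq, (h.mono (Set.subset_insert t S)).vecSpan_eq, Set.image_insert_eq,
    Submodule.span_insert, sup_comm]

theorem IsPresentation.finrank_leftKernel_insert_le [FiniteDimensional K V] {t : V ≃ₗ[K] V}
    (h : IsPresentation (insert t S) v φ) :
    finrank K (leftKernel (insert t S)) ≤ finrank K (leftKernel S) + 1 := by
  refine le_trans (Submodule.finrank_mono ?_)
    (finrank_sup_span_singleton_inf_le (vecSpan S) (covecSpan S).dualCoannihilator (v t))
  rw [leftKernel, h.vecSpan_insert]
  exact inf_le_inf_left _
    (Submodule.dualCoannihilator_anti (covecSpan_mono (Set.subset_insert t S)))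

/-- A strongly connected nondegenerate subset of `T`. -/
structure IsGood (T S : Set (V ≃ₗ[K] V)) (v : (V ≃ₗ[K] V) → V) (φ : (V ≃ₗ[K] V) → Dual K V) :
    Prop where
  subset : S ⊆ T
  nonempty : S.Nonempty
  connected : IsStronglyConnected S v φ
  nondegenerate : IsNondegenerate S

/-- If both kernels are nonzero, density supplies a `t` pairing nontrivially with an element of
each. Adding `t` preserves strong connectivity and strictly shrinks the left kernel. At the latest
when the left kernel vanishes the set is weakly nondegenerate, and condition (a) upgrades this to
nondegeneracy. -/
theorem exists_isGood_of_finrank_leftKernel [FiniteDimensional K V] (hv : IsPresentation T v φ)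
    (hd : IsDense T) {N : ℕ} (hN : ∀ S ⊆ T, S.encard ≤ N → IsWeaklyNondegenerate S →
      IsNondegenerate S) (m k : ℕ) (hS : S ⊆ T) (hne : S.Nonempty)
    (hconn : IsStronglyConnected S v φ) (hker : finrank K (leftKernel S) ≤ m)
    (hcard : S.encard ≤ k) (hk : k + m ≤ N) :
    ∃ S', S ⊆ S' ∧ IsGood T S' v φ ∧ S'.encard ≤ (k + m : ℕ) := by
  induction m generalizing S k with
  | zero =>
    have h0 : leftKernel S = ⊥ := Submodule.finrank_eq_zero.1 (Nat.le_zero.1 hker)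
    refine ⟨S, le_rfl, ⟨hS, hne, hconn, hN S hS (hcard.trans ?_) (Or.inl
      (zeroLeftKernel_iff.2 h0))⟩, hcard⟩
    exact_mod_cast hk
  | succ m ih =>
    have hkN : S.encard ≤ N := hcard.trans (by exact_mod_cast (by omega : k ≤ N))
    by_cases hw : IsWeaklyNondegenerate S
    · exact ⟨S, le_rfl, ⟨hS, hne, hconn, hN S hS hkN hw⟩,
        hcard.trans (by exact_mod_cast Nat.le_add_right k (m + 1))⟩
    rw [IsWeaklyNondegenerate, not_or] at hw
    obtain ⟨hl, hr⟩ := hw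
    simp only [ZeroLeftKernel, not_forall] at hl
    simp only [ZeroRightKernel, not_forall] at hr
    obtain ⟨x, hx, hx', hx0⟩ := hl
    obtain ⟨ψ, hψ, hψ', hψ0⟩ := hr
    have hvS := hv.mono hS
    obtain ⟨t, ht, h1, h2⟩ := hv.dense hd hx0 hψ0
    have hins : insert t S ⊆ T := Set.insert_subset ht hS
    obtain ⟨s, hs, hst⟩ : ∃ s ∈ S, φ t (v s) ≠ 0 := by
      by_contra! hc
      exact h1 ((hvS.forall_vecSpan_iff (φ t)).2 hc x hx)
    obtain ⟨s', hs', hst'⟩ : ∃ s ∈ S, φ s (v t) ≠ 0 := by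
      by_contra! hc
      exact h2 ((hvS.forall_covecSpan_iff (v t)).2 hc ψ hψ)
    have hlt : leftKernel (insert t S) < leftKernel S := by
      refine lt_of_le_of_ne ?_ ?_
      · intro y hy
        rw [(hv.mono hins).mem_leftKernel_iff, (hv.mono hins).vecSpan_insert,
          Submodule.mem_sup] at hy
        obtain ⟨⟨z, hz, w, hw, rfl⟩, hy⟩ := hy
        obtain ⟨c, rfl⟩ := Submodule.mem_span_singleton.1 hw
        -- `ψ` kills `vecSpan S` but not `v t`, so a vector in the new left kernel has no `v t`
        -- component.
        have h3 : ψ (z + c • v t) = 0 := (hvS.forall_covecSpan_iff _).2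
          (fun r hr => hy r (Or.inr hr)) ψ hψ
        rw [map_add, hψ' z hz, map_smul, zero_add, smul_eq_mul] at h3
        have hc : c = 0 := (mul_eq_zero.1 h3).resolve_right h2
        subst hc
        rw [hvS.mem_leftKernel_iff]
        simp only [zero_smul, add_zero] at hy ⊢
        exact ⟨hz, fun r hr => hy r (Or.inr hr)⟩
      · intro heq
        have hxk : x ∈ leftKernel (insert t S) := by
          rw [heq, hvS.mem_leftKernel_iff]
          exact ⟨hx, (hvS.forall_covecSpan_iff x).1 hx'⟩
        exact h1 (((hv.mono hins).mem_leftKernel_iff.1 hxk).2 t (Or.inl rfl))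
    have hfl := Submodule.finrank_lt_finrank_of_lt hlt
    obtain ⟨S', h5, h6, h7⟩ := ih (S := insert t S) (k + 1) hins ⟨t, Or.inl rfl⟩
      (hconn.insert_vertex hs hs' hst hst') (by omega)
      ((Set.encard_insert_le S t).trans (by push_cast; gcongr)) (by omega)
    exact ⟨S', (Set.subset_insert t S).trans h5, h6, h7.trans (by
      exact_mod_cast (by omega : k + 1 + m ≤ k + (m + 1)))⟩

/-- The six new elements are `t`, the two links that join it to `S` and back, and at most three more
to remove a left kernel whose dimension has grown to at most three. -/
theorem IsGood.exists_insert [FiniteDimensional K V] (hv : IsPresentation T v φ)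
    (hd : IsDense T) {N : ℕ} (hN : ∀ S ⊆ T, S.encard ≤ N → IsWeaklyNondegenerate S →
      IsNondegenerate S) (hS : IsGood T S v φ) {t : V ≃ₗ[K] V} (ht : t ∈ T) {k : ℕ}
    (hcard : S.encard ≤ k) (hk : k + 6 ≤ N) :
    ∃ S', S ⊆ S' ∧ t ∈ S' ∧ IsGood T S' v φ ∧ S'.encard ≤ (k + 6 : ℕ) := by
  obtain ⟨s, hs⟩ := hS.nonempty
  have hsT := hS.subset hs
  obtain ⟨r, hr, h1, h2⟩ := hv.dense_link hd hsT ht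
  obtain ⟨r', hr', h3, h4⟩ := hv.dense_link hd ht hsT
  have i1 : insert r' S ⊆ T := Set.insert_subset hr' hS.subset
  have i2 : insert r (insert r' S) ⊆ T := Set.insert_subset hr i1
  have i3 : insert t (insert r (insert r' S)) ⊆ T := Set.insert_subset ht i2
  have hker : finrank K (leftKernel (insert t (insert r (insert r' S)))) ≤ 3 := by
    have e1 := (hv.mono i1).finrank_leftKernel_insert_le
    have e2 := (hv.mono i2).finrank_leftKernel_insert_le
    have e3 := (hv.mono i3).finrank_leftKernel_insert_le
    have e0 : finrank K (leftKernel S) = 0 := by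
      rw [zeroLeftKernel_iff.1 hS.nondegenerate.1]; simp
    omega
  have hc : (insert t (insert r (insert r' S))).encard ≤ (k + 3 : ℕ) := by
    have c1 := Set.encard_insert_le S r'
    have c2 := Set.encard_insert_le (insert r' S) r
    have c3 := Set.encard_insert_le (insert r (insert r' S)) t
    calc _ ≤ ((S.encard + 1) + 1) + 1 := c3.trans (by gcongr; exact c2.trans (by gcongr))
      _ ≤ ((k + 1) + 1) + 1 := by gcongr
      _ = (k + 3 : ℕ) := by push_cast; ring
  obtain ⟨S', h5, h6, h7⟩ := exists_isGood_of_finrank_leftKernel hv hd hN 3 (k + 3) i3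
    ⟨t, Or.inl rfl⟩ (hS.connected.insert_path hs h1 h2 h3 h4) hker hc (by omega)
  exact ⟨S', fun a ha => h5 (Or.inr (Or.inr (Or.inr ha))), h5 (Or.inl rfl), h6, h7⟩

theorem exists_isGood_mem [FiniteDimensional K V] (hv : IsPresentation T v φ)
    (hd : IsDense T) {N : ℕ} (hN : ∀ S ⊆ T, S.encard ≤ N → IsWeaklyNondegenerate S →
      IsNondegenerate S) {t : V ≃ₗ[K] V} (ht : t ∈ T) (hk : 6 ≤ N) :
    ∃ S', t ∈ S' ∧ IsGood T S' v φ ∧ S'.encard ≤ 6 := by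
  have hS : {t} ⊆ T := Set.singleton_subset_iff.2 ht
  have hker : finrank K (leftKernel {t}) ≤ 1 := by
    refine (Submodule.finrank_mono inf_le_left).trans ?_
    rw [(hv.mono hS).vecSpan_eq, Set.image_singleton]
    exact (finrank_span_le_card ({v t} : Set V)).trans (by simp)
  obtain ⟨S', h5, h6, h7⟩ := exists_isGood_of_finrank_leftKernel hv hd hN 1 1 hS
    ⟨t, rfl⟩ (isStronglyConnected_singleton t) hker (by simp) (by omega)
  exact ⟨S', h5 rfl, h6, h7.trans (by exact_mod_cast (by omega : 1 + 1 ≤ 6))⟩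

/-- A good set can be enlarged to contain given elements, at the price of six new elements for
each of them. -/
theorem IsGood.exists_union [FiniteDimensional K V] (hv : IsPresentation T v φ)
    (hd : IsDense T) {N : ℕ} (hN : ∀ S ⊆ T, S.encard ≤ N → IsWeaklyNondegenerate S →
      IsNondegenerate S) (hS : IsGood T S v φ) (A : List (V ≃ₗ[K] V)) (hA : ∀ t ∈ A, t ∈ T) {k : ℕ}
    (hcard : S.encard ≤ k) (hk : k + 6 * A.length ≤ N) :
    ∃ S', S ⊆ S' ∧ (∀ t ∈ A, t ∈ S') ∧ IsGood T S' v φ ∧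
      S'.encard ≤ (k + 6 * A.length : ℕ) := by
  induction A with
  | nil => exact ⟨S, le_rfl, by simp, hS, by simpa using hcard⟩
  | cons t A ih =>
    simp only [List.length_cons] at hk ⊢
    obtain ⟨S', h1, h2, h3, h4⟩ := ih (fun s hs => hA s (List.mem_cons_of_mem _ hs)) (by omega)
    obtain ⟨S'', g1, g2, g3, g4⟩ := h3.exists_insert hv hd hN (hA t List.mem_cons_self) h4
      (by omega)
    refine ⟨S'', h1.trans g1, ?_, g3, g4.trans (le_of_eq (by congr 1))⟩
    intro s hs
    rcases List.mem_cons.1 hs with rfl | hs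
    · exact g2
    · exact g1 (h2 s hs)

end TransvectionGroups

/-! ### Irreducibility, and the symplectic form behind odd symmetric type -/

namespace TransvectionGroups

variable {K V : Type*} [Field K] [AddCommGroup V] [Module K V]

theorem commutatorSpace_sub_mem {G : Subgroup (V ≃ₗ[K] V)} {g : V ≃ₗ[K] V} (hg : g ∈ G) (x : V) :
    g x - x ∈ commutatorSpace G :=
  Submodule.subset_span ⟨g, hg, x, rfl⟩

theorem commutatorSpace_apply_mem {G : Subgroup (V ≃ₗ[K] V)} {g : V ≃ₗ[K] V} (hg : g ∈ G) {x : V}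
    (hx : x ∈ commutatorSpace G) : g x ∈ commutatorSpace G := by
  rw [← sub_add_cancel (g x) x]
  exact Submodule.add_mem _ (commutatorSpace_sub_mem hg x) hx

theorem exists_mem_restrict {G : Subgroup (V ≃ₗ[K] V)} {g : V ≃ₗ[K] V} (hg : g ∈ G) :
    ∃ h ∈ restrict G (commutatorSpace G), ∀ w, (h w : V) = g w := by
  let A : commutatorSpace G →ₗ[K] commutatorSpace G :=
    (g : V →ₗ[K] V).restrict fun x hx => commutatorSpace_apply_mem hg hx
  let B : commutatorSpace G →ₗ[K] commutatorSpace G :=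
    ((g⁻¹ : V ≃ₗ[K] V) : V →ₗ[K] V).restrict
      fun x hx => commutatorSpace_apply_mem (G.inv_mem hg) hx
  have hAB : A ∘ₗ B = LinearMap.id := by
    ext x; exact g.apply_symm_apply x
  have hBA : B ∘ₗ A = LinearMap.id := by
    ext x; exact g.symm_apply_apply x
  exact ⟨LinearEquiv.ofLinearMap A B hAB hBA, ⟨g, hg, fun w => rfl⟩, fun w => rfl⟩

variable {S T : Set (V ≃ₗ[K] V)} {v : (V ≃ₗ[K] V) → V} {φ : (V ≃ₗ[K] V) → Dual K V}

theorem IsGood.exists_covec_ne (hS : IsGood T S v φ) (hv : IsPresentation T v φ) {x : V}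
    (hx : x ∈ vecSpan S) (hx0 : x ≠ 0) : ∃ t ∈ S, φ t x ≠ 0 := by
  by_contra! hc
  exact hx0 (hS.nondegenerate.1 x hx (((hv.mono hS.subset).forall_covecSpan_iff x).2 hc))

theorem IsGood.exists_vec_ne (hS : IsGood T S v φ) (hv : IsPresentation T v φ) {s : V ≃ₗ[K] V}
    (hs : s ∈ S) : ∃ t ∈ S, φ s (v t) ≠ 0 := by
  by_contra! hc
  exact (hv s (hS.subset hs)).covec_ne (hS.nondegenerate.2 _ ((hv.mono hS.subset).covec_mem hs)
    (((hv.mono hS.subset).forall_vecSpan_iff _).2 hc))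

theorem IsGood.two_le_finrank [FiniteDimensional K V] (hS : IsGood T S v φ)
    (hv : IsPresentation T v φ) :
    2 ≤ finrank K (commutatorSpace (Subgroup.closure S)) := by
  obtain ⟨s, hs⟩ := hS.nonempty
  obtain ⟨t, ht, hst⟩ := hS.exists_vec_ne hv hs
  have hvS := hv.mono hS.subset
  rw [hvS.commutatorSpace_eq]
  have hli : LinearIndependent K ![(⟨v s, hvS.vec_mem hs⟩ : vecSpan S), ⟨v t, hvS.vec_mem ht⟩] := by
    rw [LinearIndependent.pair_iff]
    intro a b hab
    have hab' : a • v s + b • v t = 0 := congrArg Subtype.val hab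
    have h1 := congrArg (φ s) hab'
    simp only [map_add, map_smul, (hvS s hs).apply_self, smul_eq_mul, mul_zero, zero_add,
      map_zero, mul_eq_zero, hst, or_false] at h1
    subst h1
    simpa [(hvS s hs).vec_ne] using hab'
  simpa using hli.fintype_card_le_finrank

/-- A nonzero invariant subspace contains a vector moved by some `t`, because the left kernel is
zero, and hence contains `v t`. Arrows of the digraph then propagate membership from `v s` to `v t`,
and strong connectivity carries it to all of `S`. -/
theorem IsGood.isIrreducibleGroup (hS : IsGood T S v φ) (hv : IsPresentation T v φ) :
    IsIrreducibleGroup (restrict (Subgroup.closure S)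
      (commutatorSpace (Subgroup.closure S))) := by
  have hvS := hv.mono hS.subset
  have hmem : ∀ {x}, x ∈ commutatorSpace (Subgroup.closure S) ↔ x ∈ vecSpan S := fun {x} => by
    rw [hvS.commutatorSpace_eq]
  obtain ⟨s, hs⟩ := hS.nonempty
  refine ⟨⟨⟨⟨v s, hmem.2 (hvS.vec_mem hs)⟩, 0, fun h => (hvS s hs).vec_ne (congrArg Subtype.val h)⟩⟩, ?_⟩
  intro W hW
  have key : ∀ x ∈ W, ∀ t, ∀ ht : t ∈ S, φ t x ≠ 0 →
      (⟨v t, hmem.2 (hvS.vec_mem ht)⟩ : commutatorSpace (Subgroup.closure S)) ∈ W := by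
    intro x hx t ht hne
    obtain ⟨h, hh, hap⟩ := exists_mem_restrict (Subgroup.subset_closure ht)
    have h1 := W.smul_mem (φ t x)⁻¹ (W.sub_mem (hW h hh x hx) hx)
    convert h1 using 1
    ext
    simp only [SetLike.val_smul, AddSubgroupClass.coe_sub, hap, (hvS t ht).apply,
      add_sub_cancel_left]
    rw [smul_smul, inv_mul_cancel₀ hne, one_smul]
  rw [or_iff_not_imp_left]
  intro hne
  obtain ⟨x, hx, hx0⟩ := Submodule.exists_mem_ne_zero_of_ne_bot hne
  obtain ⟨t, ht, htx⟩ := hS.exists_covec_ne hv (hmem.1 x.2) (fun h => hx0 (Subtype.ext h))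
  let S' : Set (V ≃ₗ[K] V) := {r | ∃ hr : r ∈ S, (⟨v r, hmem.2 (hvS.vec_mem hr)⟩ :
    commutatorSpace (Subgroup.closure S)) ∈ W}
  have hSS' : S ⊆ S' := by
    refine hS.connected S' (fun r hr => hr.1) ⟨t, ht, key x hx t ht htx⟩ ?_
    rintro r ⟨hr, hrW⟩ r' hr' hne
    exact ⟨hr', key _ hrW r' hr' hne⟩
  have hle : vecSpan S ≤ W.map (commutatorSpace (Subgroup.closure S)).subtype := by
    rw [hvS.vecSpan_eq, Submodule.span_le]
    rintro _ ⟨r, hr, rfl⟩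
    obtain ⟨hr', hrW⟩ := hSS' hr
    exact ⟨_, hrW, rfl⟩
  rw [eq_top_iff]
  rintro y -
  obtain ⟨z, hz, hzy⟩ := hle (hmem.1 y.2)
  have : z = y := Subtype.ext hzy
  exact this ▸ hz

/-- The matrix `φ s (v t)` with `s, t` in `S` can be made symmetric by scaling its rows. -/
def IsBalanced (S : Set (V ≃ₗ[K] V)) (v : (V ≃ₗ[K] V) → V) (φ : (V ≃ₗ[K] V) → Dual K V) : Prop :=
  ∃ μ : (V ≃ₗ[K] V) → K, (∀ s ∈ S, μ s ≠ 0) ∧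
    ∀ s ∈ S, ∀ t ∈ S, μ s * φ s (v t) = μ t * φ t (v s)

theorem IsBalanced.mono (h : IsBalanced T v φ) (hS : S ⊆ T) : IsBalanced S v φ := by
  obtain ⟨μ, h1, h2⟩ := h
  exact ⟨μ, fun s hs => h1 s (hS hs), fun s hs t ht => h2 s (hS hs) t (hS ht)⟩

theorem mem_sumZero {m : ℕ} {x : Fin m → K} : x ∈ sumZero K m ↔ ∑ i, x i = 0 := by
  simp [sumZero, LinearMap.sum_apply]

/-- The dot product on the zero-sum hyperplane is invariant under permutations, alternating in
characteristic two, and nondegenerate because `m` is odd. Invariance under `1 + u ⊗ φ` forces `B u`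
to be a multiple `μ φ`, and these multiples are the row scalings. -/
theorem IsGood.isBalanced_of_hasOddSymmetricType (hS : IsGood T S v φ)
    (hv : IsPresentation T v φ) (h : HasOddSymmetricType (restrict (Subgroup.closure S)
      (commutatorSpace (Subgroup.closure S)))) : IsBalanced S v φ := by
  classical
  have hvS := hv.mono hS.subset
  set W := commutatorSpace (Subgroup.closure S) with hW
  obtain ⟨h2, m, hm3, hodd, e, he⟩ := h
  have hmem : ∀ {x}, x ∈ W ↔ x ∈ vecSpan S := fun {x} => by rw [hW, hvS.commutatorSpace_eq]
  let B : W → W → K := fun x y => ∑ i, (e x : Fin m → K) i * (e y : Fin m → K) i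
  have hBadd : ∀ x y z, B x (y + z) = B x y + B x z := fun x y z => by
    simp only [B, map_add, Submodule.coe_add, Pi.add_apply, mul_add, Finset.sum_add_distrib]
  have hBsmul : ∀ x y (c : K), B x (c • y) = c * B x y := fun x y c => by
    simp only [B, map_smul, Submodule.coe_smul, Pi.smul_apply, smul_eq_mul, Finset.mul_sum]
    exact Finset.sum_congr rfl fun i _ => by ring
  have hBcomm : ∀ x y, B x y = B y x := fun x y =>
    Finset.sum_congr rfl fun i _ => mul_comm _ _
  have hBself : ∀ x, B x x = 0 := fun x => by
    have h1 : ∑ i, (e x : Fin m → K) i = 0 := mem_sumZero.1 (e x).2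
    have h3 : B x x = (∑ i, (e x : Fin m → K) i) ^ 2 := by
      rw [CharTwo.sum_sq]
      exact Finset.sum_congr rfl fun i _ => by ring
    rw [h3, h1]; ring
  have hBinv : ∀ g ∈ restrict (Subgroup.closure S) W, ∀ x y, B (g x) (g y) = B x y := by
    intro g hg x y
    obtain ⟨σ, hσ⟩ := (he g).1 hg
    simp only [B]
    rw [← Equiv.sum_comp σ]
    exact Finset.sum_congr rfl fun i _ => by rw [hσ, hσ]
  have hBnd : ∀ x, (∀ y, B x y = 0) → x = 0 := by
    intro x hx
    -- Testing against `e_i + e_j` shows that a vector of the radical has constant coordinates; its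
    -- coordinate sum is then that constant, as `m` is odd.
    have hc : ∀ i j, (e x : Fin m → K) i = (e x : Fin m → K) j := by
      intro i j
      let w : Fin m → K := Pi.single i 1 + Pi.single j 1
      have hw : w ∈ sumZero K m := by
        rw [mem_sumZero]
        simp only [w, Pi.add_apply, Finset.sum_add_distrib, Finset.sum_pi_single',
          Finset.mem_univ, if_true]
        exact CharTwo.add_self_eq_zero 1
      have h1 := hx (e.symm ⟨w, hw⟩)
      simp only [B, LinearEquiv.apply_symm_apply, w, Pi.add_apply, mul_add,
        Finset.sum_add_distrib, Pi.single_apply, mul_ite, mul_one, mul_zero,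
        Finset.sum_ite_eq', Finset.mem_univ, if_true] at h1
      exact CharTwo.add_eq_zero.1 h1
    have h1 : ∑ i, (e x : Fin m → K) i = 0 := mem_sumZero.1 (e x).2
    have h0 : e x = 0 := by
      ext i
      rw [Finset.sum_congr rfl fun j _ => hc j i] at h1
      rw [Finset.sum_const, Finset.card_univ, Fintype.card_fin, nsmul_eq_mul] at h1
      have : (m : K) = 1 := by
        obtain ⟨k, rfl⟩ := hodd
        push_cast
        rw [CharTwo.two_eq_zero]; ring
      rw [this, one_mul] at h1
      exact h1
    exact e.map_eq_zero_iff.1 h0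
  have key : ∀ s, ∀ hs : s ∈ S, ∃ μ : K, μ ≠ 0 ∧ ∀ y : W,
      B ⟨v s, hmem.2 (hvS.vec_mem hs)⟩ y = μ * φ s y := by
    intro s hs
    obtain ⟨g, hg, hgs⟩ := exists_mem_restrict (Subgroup.subset_closure hs)
    set u : W := ⟨v s, hmem.2 (hvS.vec_mem hs)⟩ with hu
    have hgx : ∀ x : W, g x = x + φ s x • u := fun x => by
      ext; rw [hgs, (hvS s hs).apply]; rfl
    have hsymm : ∀ x y : W, φ s x * B u y = φ s y * B u x := by
      intro x y
      have h1 := hBinv g hg x y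
      rw [hgx, hgx, hBadd, hBsmul, hBcomm _ y, hBcomm _ u, hBadd, hBadd, hBsmul, hBsmul,
        hBself u, hBcomm y x, hBcomm y u] at h1
      have h3 : φ s x * B u y + φ s y * B u x = 0 := by linear_combination h1
      exact CharTwo.add_eq_zero.1 h3
    obtain ⟨t, ht, hst⟩ := hS.exists_vec_ne hv hs
    set x : W := ⟨v t, hmem.2 (hvS.vec_mem ht)⟩ with hx
    have hx0 : φ s x ≠ 0 := hst
    have hform : ∀ y : W, B u y = B u x / φ s x * φ s y := fun y => by
      field_simp
      linear_combination hsymm x y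
    refine ⟨B u x / φ s x, fun h0 => ?_, hform⟩
    refine (hvS s hs).vec_ne (congrArg Subtype.val (hBnd u fun y => ?_))
    rw [hform, h0, zero_mul]
  choose! μ hμ0 hμ using key
  refine ⟨μ, hμ0, fun s hs t ht => ?_⟩
  have h1 := hμ s hs ⟨v t, hmem.2 (hvS.vec_mem ht)⟩
  have h3 := hμ t ht ⟨v s, hmem.2 (hvS.vec_mem hs)⟩
  rw [hBcomm] at h1
  exact h1.symm.trans h3

theorem IsPresentation.span_eq_top [FiniteDimensional K V] (hv : IsPresentation T v φ)
    (hd : IsDense T) (hV : 0 < finrank K V) : vecSpan T = ⊤ := by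
  by_contra hne
  obtain ⟨ψ, hψ, hψ'⟩ := Submodule.exists_le_ker_of_lt_top _ (lt_top_iff_ne_top.2 hne)
  have : Nontrivial V := finrank_pos_iff.1 hV
  obtain ⟨x, hx⟩ := exists_ne (0 : V)
  obtain ⟨t, ht, -, h2⟩ := hv.dense hd hx hψ
  exact h2 (hψ' (hv.vec_mem ht))

/-- Fix `t₀`. The scaling of `t` relative to `t₀` is computed along the path from `t₀` through `r t`
to `t`. To compare the scalings of `s` and `t`, the elements `t₀, s, t, r s, r t` suffice, hence the
number five. The form is then defined by `B (v s) = μ s • φ s`. -/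
theorem preservesSymplecticForm_of_isBalanced [FiniteDimensional K V] [CharP K 2]
    (hv : IsPresentation T v φ) (hd : IsDense T) (hV : 0 < finrank K V)
    (hbal : ∀ t₁ ∈ T, ∀ t₂ ∈ T, ∀ t₃ ∈ T, ∀ t₄ ∈ T, ∀ t₅ ∈ T,
      IsBalanced {t₁, t₂, t₃, t₄, t₅} v φ) :
    PreservesSymplecticForm (Subgroup.closure T) := by
  classical
  have htop := hv.span_eq_top hd hV
  have : Nontrivial V := finrank_pos_iff.1 hV
  have hTne : T.Nonempty := by
    by_contra h
    rw [Set.not_nonempty_iff_eq_empty] at h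
    rw [hv.vecSpan_eq, h] at htop
    simp at htop
  obtain ⟨t₀, ht₀⟩ := hTne
  choose! r hrT hr1 hr2 using fun t (ht : t ∈ T) => hv.dense_link hd ht₀ ht
  -- Any balancing `ν` of a set containing `t₀`, `t` and `r t` turns this expression into `ν t / ν
  -- t₀`.
  let μ : (V ≃ₗ[K] V) → K := fun t =>
    φ (r t) (v t) * φ t₀ (v (r t)) / (φ t (v (r t)) * φ (r t) (v t₀))
  have hμ : ∀ s ∈ T, ∀ t ∈ T, μ s ≠ 0 ∧ μ s * φ s (v t) = μ t * φ t (v s) := by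
    intro s hs t ht
    obtain ⟨ν, hν0, hν⟩ := hbal t₀ ht₀ s hs t ht (r s) (hrT s hs) (r t) (hrT t ht)
    have n0 := hν0 t₀ (by simp)
    have hμν : ∀ u ∈ T, u ∈ ({t₀, s, t, r s, r t} : Set (V ≃ₗ[K] V)) →
        r u ∈ ({t₀, s, t, r s, r t} : Set (V ≃ₗ[K] V)) → μ u = ν u / ν t₀ := by
      intro u hu hu' hru
      have a1 := hν u hu' (r u) hru
      have a2 := hν t₀ (by simp) (r u) hru
      have b1 := hr1 u hu
      have b2 := hr2 u hu
      have n1 := hν0 _ hru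
      have e1 : φ (r u) (v u) = ν u * φ u (v (r u)) / ν (r u) := by
        rw [a1]; field_simp
      have e2 : φ t₀ (v (r u)) = ν (r u) * φ (r u) (v t₀) / ν t₀ := by
        rw [← a2]; field_simp
      simp only [μ]
      rw [e1, e2]
      field_simp
    rw [hμν s hs (by simp) (by simp), hμν t ht (by simp) (by simp)]
    refine ⟨div_ne_zero (hν0 s (by simp)) n0, ?_⟩
    have := hν s (by simp) t (by simp)
    field_simp
    exact this
  have hspan : Submodule.span K (Set.range fun t : T => v t) = ⊤ := by
    rw [← htop, hv.vecSpan_eq, Set.image_eq_range]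
  let A : (T →₀ K) →ₗ[K] V := Finsupp.linearCombination K fun t : T => v t
  let A' : (T →₀ K) →ₗ[K] Dual K V := Finsupp.linearCombination K fun t : T => μ t • φ t
  have hAsurj : LinearMap.range A = ⊤ := by
    rw [Finsupp.range_linearCombination, hspan]
  have hpair : ∀ (a : T →₀ K) (s : T), A' a (v s) = μ s * φ s (A a) := by
    intro a s
    induction a using Finsupp.induction_linear with
    | zero => simp
    | add a b ha hb => simp only [map_add, LinearMap.add_apply, ha, hb, mul_add]
    | single t c =>
      simp only [A, A', Finsupp.linearCombination_single, map_smul, LinearMap.smul_apply,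
        smul_eq_mul]
      linear_combination -c * (hμ s s.2 t t.2).2
  have hext : ∀ ψ : Dual K V, (∀ s : T, ψ (v s) = 0) → ψ = 0 := by
    intro ψ hψ
    ext x
    have hx : x ∈ vecSpan T := htop ▸ Submodule.mem_top
    exact (hv.forall_vecSpan_iff ψ).2 (fun s hs => hψ ⟨s, hs⟩) x hx
  -- A linear relation among the `v t` is also one among the `μ t • φ t`, so the form is well
  -- defined on `V`.
  have hker : LinearMap.ker A ≤ LinearMap.ker A' := by
    intro a ha
    rw [LinearMap.mem_ker] at ha ⊢
    exact hext _ fun s => by rw [hpair, ha, map_zero, mul_zero]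
  obtain ⟨C, hC⟩ := LinearMap.exists_rightInverse_of_surjective A hAsurj
  have hAC : ∀ x, A (C x) = x := fun x => LinearMap.congr_fun hC x
  let B : LinearMap.BilinForm K V := A' ∘ₗ C
  have hB : ∀ s : T, ∀ x, B (v s) x = μ s * φ s x := by
    intro s x
    have h1 : A' (C (v s)) = A' (Finsupp.single s 1) := by
      rw [← sub_eq_zero, ← map_sub]
      apply LinearMap.mem_ker.1 (hker _)
      rw [LinearMap.mem_ker, map_sub, hAC]
      simp [A]
    change A' (C (v s)) x = _
    rw [h1]; simp [A']
  have hB' : ∀ s : T, ∀ x, B x (v s) = μ s * φ s x := by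
    intro s x
    change A' (C x) (v s) = _
    rw [hpair, hAC]
  have hrefl : ∀ x y, B x y = B y x := by
    intro x y
    have h1 : B x - LinearMap.flip B x = 0 := hext _ fun s => by
      simp only [LinearMap.sub_apply, LinearMap.flip_apply, hB, hB', sub_self]
    have h2 := LinearMap.congr_fun h1 y
    simpa [sub_eq_zero] using h2
  refine ⟨B, ?_, ?_, ?_⟩
  · intro x
    have hx : x ∈ vecSpan T := htop ▸ Submodule.mem_top
    rw [hv.vecSpan_eq] at hx
    induction hx using Submodule.span_induction with
    | mem y hy =>
      obtain ⟨s, hs, rfl⟩ := hy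
      rw [hB ⟨s, hs⟩, (hv s hs).apply_self, mul_zero]
    | zero => simp
    | add a b _ _ ha hb =>
      simp only [map_add, LinearMap.add_apply, ha, hb, hrefl b a, zero_add, add_zero]
      exact CharTwo.add_self_eq_zero _
    | smul c a _ ha => simp [ha]
  · have hnd : ∀ x, (∀ y, B x y = 0) → x = 0 := by
      intro x hx
      by_contra hx0
      obtain ⟨ψ, hψ⟩ := exists_ne (0 : Dual K V)
      obtain ⟨t, ht, h1, -⟩ := hv.dense hd hx0 hψ
      have h2 := hB' ⟨t, ht⟩ x
      rw [hx] at h2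
      exact mul_ne_zero (hμ t ht t ht).1 h1 h2.symm
    exact ⟨hnd, fun x hx => hnd x fun y => by rw [hrefl]; exact hx y⟩
  · intro g hg
    induction hg using Subgroup.closure_induction with
    | mem t ht =>
      intro x y
      rw [(hv t ht).apply, (hv t ht).apply]
      simp only [map_add, LinearMap.add_apply, map_smul, LinearMap.smul_apply, smul_eq_mul,
        hB ⟨t, ht⟩, hB' ⟨t, ht⟩, (hv t ht).apply_self]
      have := CharTwo.add_self_eq_zero (μ t * φ t x * φ t y)
      linear_combination this
    | one => intro x y; rfl
    | mul a b _ _ ha hb => intro x y; rw [LinearEquiv.mul_apply, LinearEquiv.mul_apply, ha, hb]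
    | inv a _ ha =>
      intro x y
      rw [← ha]
      congr 1
      · exact congrArg B (a.apply_symm_apply x)
      · exact a.apply_symm_apply y

end TransvectionGroups

/-! ### Frames and edges -/

namespace TransvectionGroups

variable {K V : Type*} [Field K] [AddCommGroup V] [Module K V] {ι κ : Type*}

/-- The families `e` of vectors and `f` of covectors are dual to each other. -/
structure IsFrame (e : ι → V) (f : ι → Dual K V) : Prop where
  self : ∀ i, f i (e i) = 1
  ne : ∀ i j, i ≠ j → f i (e j) = 0

/-- `t` is the transvection `1 + (e i + c e j) ⊗ (f i + c⁻¹ f j)`; in characteristic two it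
interchanges the lines of `e i` and `e j`. -/
structure IsEdge (e : ι → V) (f : ι → Dual K V) (i j : ι) (c : K) (t : V ≃ₗ[K] V) : Prop where
  index_ne : i ≠ j
  gain_ne : c ≠ 0
  apply : ∀ x, t x = x + (f i + c⁻¹ • f j) x • (e i + c • e j)

variable {e : ι → V} {f : ι → Dual K V} {i j k l : ι} {c c' : K} {s t : V ≃ₗ[K] V}

namespace IsFrame

theorem sub_sum [Fintype ι] (hF : IsFrame e f) (x : V) (i : ι) :
    f i (x - ∑ j, f j x • e j) = 0 := by
  classical
  rw [map_sub, map_sum, Finset.sum_eq_single i]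
  · simp [hF.self]
  · intro j _ hj
    simp [hF.ne i j hj.symm]
  · simp

theorem vec_ne (hF : IsFrame e f) (i : ι) : e i ≠ 0 := fun h => by
  have := hF.self i
  simp [h] at this

theorem linearIndependent (hF : IsFrame e f) : LinearIndependent K e := by
  classical
  rw [linearIndependent_iff']
  intro s g hg i hi
  have := congrArg (f i) hg
  rw [map_sum, Finset.sum_eq_single i] at this
  · simpa [hF.self] using this
  · intro j _ hj
    simp [hF.ne i j hj.symm]
  · exact fun h => absurd hi h

/-- A vector with nonzero components along `e i` and `e j` is not a multiple of a frame vector. -/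
theorem index_eq (hF : IsFrame e f) {x : V} {a : K} {m : ι} (hx : x = a • e m) (hi : f i x ≠ 0) :
    i = m := by
  by_contra h
  apply hi
  rw [hx, map_smul, hF.ne i m h, smul_zero]

end IsFrame

namespace IsEdge

theorem symm (h : IsEdge e f i j c t) : IsEdge e f j i c⁻¹ t := by
  refine ⟨h.index_ne.symm, inv_ne_zero h.gain_ne, fun x => ?_⟩
  have hc := h.gain_ne
  rw [h.apply]
  congr 1
  have h1 : (f j + c⁻¹⁻¹ • f i) = c • (f i + c⁻¹ • f j) := by
    rw [smul_add, smul_smul, mul_inv_cancel₀ hc, one_smul, inv_inv, add_comm]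
  have h2 : e j + c⁻¹ • e i = c⁻¹ • (e i + c • e j) := by
    rw [smul_add, smul_smul, inv_mul_cancel₀ hc, one_smul, add_comm]
  rw [h1, h2, LinearMap.smul_apply, smul_smul, smul_eq_mul]
  congr 1
  field_simp

theorem along [CharP K 2] (hF : IsFrame e f) (h : IsEdge e f i j c t) :
    IsTransvectionAlong t (e i + c • e j) (f i + c⁻¹ • f j) := by
  have hij := h.index_ne
  have hc := h.gain_ne
  refine ⟨?_, ?_, ?_, h.apply⟩
  · simp only [map_add, LinearMap.add_apply, LinearMap.smul_apply, map_smul, hF.self,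
      hF.ne i j hij, hF.ne j i hij.symm, smul_eq_mul]
    field_simp
    linear_combination CharTwo.add_self_eq_zero c
  · intro h0
    have := congrArg (f i) h0
    simp [hF.self, hF.ne i j hij] at this
  · intro h0
    have := LinearMap.congr_fun h0 (e i)
    simp [hF.self, hF.ne j i hij.symm] at this

theorem apply_left [CharP K 2] (hF : IsFrame e f) (h : IsEdge e f i j c t) : t (e i) = c • e j := by
  rw [h.apply]
  simp only [LinearMap.add_apply, LinearMap.smul_apply, hF.self, hF.ne j i h.index_ne.symm,
    smul_zero, add_zero, one_smul]
  rw [← add_assoc, ← two_smul K (e i), CharTwo.two_eq_zero, zero_smul, zero_add]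

theorem apply_right [CharP K 2] (hF : IsFrame e f) (h : IsEdge e f i j c t) : t (e j) = c⁻¹ • e i :=
  h.symm.apply_left hF

theorem apply_of_ne (hF : IsFrame e f) (h : IsEdge e f i j c t) (hi : k ≠ i) (hj : k ≠ j) :
    t (e k) = e k := by
  rw [h.apply]
  simp [hF.ne i k hi.symm, hF.ne j k hj.symm]

theorem covec_left [CharP K 2] (hF : IsFrame e f) (h : IsEdge e f i j c t) (x : V) :
    f i (t x) = c⁻¹ * f j x := by
  rw [h.apply]
  simp only [map_add, LinearMap.add_apply, LinearMap.smul_apply, map_smul, hF.self,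
    hF.ne i j h.index_ne, smul_eq_mul]
  have := CharTwo.add_self_eq_zero (f i x)
  linear_combination this

theorem covec_right [CharP K 2] (hF : IsFrame e f) (h : IsEdge e f i j c t) (x : V) :
    f j (t x) = c * f i x := by
  simpa using h.symm.covec_left hF x

theorem eq_of_gain (hs : IsEdge e f i j c s) (ht : IsEdge e f i j c t) : s = t := by
  ext x; rw [hs.apply, ht.apply]

end IsEdge

/-- A transvection that permutes the lines of a frame and fixes the common kernel of its
covectors is an edge of the frame. -/
theorem IsTransvectionAlong.exists_isEdge [CharP K 2] [Fintype ι] {v : V} {φ : Dual K V}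
    (ht : IsTransvectionAlong t v φ) (hF : IsFrame e f)
    (hmon : ∀ i, ∃ j, ∃ c : K, t (e i) = c • e j)
    (hfix : ∀ x, (∀ i, f i x = 0) → t x = x) : ∃ i j c, IsEdge e f i j c t := by
  have hφ0 : ∀ x, (∀ i, f i x = 0) → φ x = 0 := fun x hx => by
    have h1 := ht.apply x
    rw [hfix x hx] at h1
    have h2 : φ x • v = 0 := by simpa using h1.symm
    exact (smul_eq_zero.1 h2).resolve_right ht.vec_ne
  have hφ : ∀ x, φ x = ∑ j, f j x * φ (e j) := fun x => by
    have := hφ0 _ (hF.sub_sum x)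
    rw [map_sub, sub_eq_zero] at this
    rw [this, map_sum]
    exact Finset.sum_congr rfl fun j _ => by rw [map_smul, smul_eq_mul]
  -- `φ` is determined by its values on the frame, so it is nonzero on some `e i`; the edge will
  -- join `i` to the index of the line containing `t (e i)`.
  obtain ⟨i, hi⟩ : ∃ i, φ (e i) ≠ 0 := by
    by_contra! hc
    exact ht.covec_ne (by ext x; rw [hφ x]; simp [hc])
  obtain ⟨j, c, hc⟩ := hmon i
  have hc0 : c ≠ 0 := fun h0 => hF.vec_ne i (by
    rw [h0, zero_smul] at hc; exact t.map_eq_zero_iff.1 hc)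
  have hv : φ (e i) • v = c • e j - e i := by rw [← hc, ht.apply]; abel
  have hij : i ≠ j := by
    rintro rfl
    have h1 := congrArg φ hv
    simp only [map_smul, ht.apply_self, map_sub, smul_eq_mul] at h1
    have h2 : (c - 1) * φ (e i) = 0 := by linear_combination -h1
    have h3 : c - 1 = 0 := (mul_eq_zero.1 h2).resolve_right hi
    rw [sub_eq_zero.1 h3, one_smul, sub_self] at hv
    exact ht.vec_ne ((smul_eq_zero.1 hv).resolve_left hi)
  -- Otherwise `t (e k)` would have nonzero components along both `e k` and `e i`, and would not lie
  -- on a frame line.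
  have hk : ∀ k, k ≠ i → k ≠ j → φ (e k) = 0 := by
    intro k hki hkj
    by_contra hne
    obtain ⟨l, d, hd⟩ := hmon k
    have hfv : φ (e i) * f i v = -1 := by
      have := congrArg (f i) hv
      simpa [hF.self, hF.ne i j hij] using this
    have hfk : φ (e i) * f k v = 0 := by
      have := congrArg (f k) hv
      simpa [hF.ne k i hki, hF.ne k j hkj] using this
    have hfk' : f k v = 0 := (mul_eq_zero.1 hfk).resolve_left hi
    have hfi' : f i v ≠ 0 := fun h0 => by simp [h0] at hfv
    rw [ht.apply] at hd
    have a1 : i = l := hF.index_eq hd (by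
      simp only [map_add, map_smul, hF.ne i k hki.symm, zero_add, smul_eq_mul]
      exact mul_ne_zero hne hfi')
    have a2 : k = l := hF.index_eq hd (by simp [hF.self, hfk'])
    exact hki (a2.trans a1.symm)
  have hj : c * φ (e j) = φ (e i) := by
    have h1 := congrArg φ hv
    simp only [map_smul, ht.apply_self, map_sub, smul_eq_mul] at h1
    linear_combination -h1
  refine ⟨i, j, c, hij, hc0, fun x => ?_⟩
  have hφx : φ x = (f i + c⁻¹ • f j) x * φ (e i) := by
    classical
    have hsum : ∑ k, f k x * φ (e k) = ∑ k ∈ {i, j}, f k x * φ (e k) := by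
      symm
      apply Finset.sum_subset (Finset.subset_univ _)
      intro k _ hk'
      simp only [Finset.mem_insert, Finset.mem_singleton, not_or] at hk'
      rw [hk k hk'.1 hk'.2, mul_zero]
    rw [hφ x, hsum, Finset.sum_pair hij]
    simp only [LinearMap.add_apply, LinearMap.smul_apply, smul_eq_mul]
    rw [← hj]
    field_simp
  rw [ht.apply, hφx, mul_smul, hv]
  congr 2
  rw [sub_eq_add_neg, ← neg_one_smul K (e i), CharTwo.neg_eq, one_smul, add_comm]

/-! ### Recognising parallel edges and their vertices -/

section Uniqueness

theorem exists_common_of_pairing_ne (hF : IsFrame e f) (hs : IsEdge e f i j c s)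
    (ht : IsEdge e f k l c' t) (h : (f k + c'⁻¹ • f l) (e i + c • e j) ≠ 0) :
    ∃ i j k c c', IsEdge e f i j c s ∧ IsEdge e f i k c' t := by
  by_cases h1 : k = i
  · subst h1; exact ⟨_, _, _, _, _, hs, ht⟩
  by_cases h2 : k = j
  · subst h2; exact ⟨_, _, _, _, _, hs.symm, ht⟩
  by_cases h3 : l = i
  · subst h3; exact ⟨_, _, _, _, _, hs, ht.symm⟩
  by_cases h4 : l = j
  · subst h4; exact ⟨_, _, _, _, _, hs.symm, ht.symm⟩
  exact absurd (by simp [hF.ne k i h1, hF.ne k j h2, hF.ne l i h3, hF.ne l j h4]) h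

variable {v u w z : V} {φ ψ χ ω : Dual K V}

theorem exists_common_isEdge (hF : IsFrame e f) (hs : IsEdge e f i j c s)
    (ht : IsEdge e f k l c' t) (hvs : IsTransvectionAlong s v φ)
    (hvt : IsTransvectionAlong t u ψ) (h : ψ v ≠ 0) :
    ∃ i j k c c', IsEdge e f i j c s ∧ IsEdge e f i k c' t := by
  obtain ⟨α, hα, h1, h2⟩ := hvs.exists_smul hs.apply
  obtain ⟨β, hβ, h3, h4⟩ := hvt.exists_smul ht.apply
  refine exists_common_of_pairing_ne hF hs ht ?_
  rw [h1, h4, LinearMap.smul_apply, map_smul]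
  exact smul_ne_zero (inv_ne_zero hβ) (smul_ne_zero hα h)

theorem pairing_of_common (hF : IsFrame e f) (hij : i ≠ j) (hik : i ≠ k) (hjk : j ≠ k) :
    (f i + c'⁻¹ • f k) (e i + c • e j) = 1 := by
  simp [hF.self, hF.ne i j hij, hF.ne k i hik.symm, hF.ne k j hjk.symm]

/-- For edges meeting in exactly one vertex both pairings are `1` after normalisation. Rescaling
multiplies the two by inverse factors, so their product is always `1`. A nonzero pairing with
another product therefore forces two common vertices, and this criterion does not mention the frame.
-/
theorem exists_parallel_of_pairing (hF : IsFrame e f) (hs : IsEdge e f i j c s)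
    (ht : IsEdge e f k l c' t) (hvs : IsTransvectionAlong s v φ)
    (hvt : IsTransvectionAlong t u ψ) (h0 : ψ v ≠ 0) (h1 : ψ v * φ u ≠ 1) :
    ∃ i j c c', IsEdge e f i j c s ∧ IsEdge e f i j c' t := by
  obtain ⟨i, j, k, c, c', hs, ht⟩ := exists_common_isEdge hF hs ht hvs hvt h0
  by_cases hjk : j = k
  · subst hjk; exact ⟨_, _, _, _, hs, ht⟩
  exfalso
  obtain ⟨α, hα, a1, a2⟩ := hvs.exists_smul hs.apply
  obtain ⟨β, hβ, a3, a4⟩ := hvt.exists_smul ht.apply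
  have p1 := pairing_of_common (c := c) (c' := c') hF hs.index_ne ht.index_ne hjk
  have p2 := pairing_of_common (c := c') (c' := c) hF ht.index_ne hs.index_ne (Ne.symm hjk)
  rw [a1, a4, LinearMap.smul_apply, map_smul, smul_eq_mul, smul_eq_mul] at p1
  rw [a2, a3, LinearMap.smul_apply, map_smul, smul_eq_mul, smul_eq_mul] at p2
  apply h1
  field_simp at p1 p2
  apply mul_left_cancel₀ (mul_ne_zero hα hβ)
  linear_combination β * φ u * p1 + β * p2

/-- If `r` commutes with `s` and `t` but not with `p`, and the triple product of `s, t, p` is not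
symmetric, then `s` and `t` join the same pair of vertices. -/
theorem exists_parallel_of_triple [CharP K 2] {p r : V ≃ₗ[K] V} {i₁ j₁ i₂ j₂ i₃ j₃ i₄ j₄ : ι}
    {c₁ c₂ c₃ c₄ : K} (hF : IsFrame e f) (hs : IsEdge e f i₁ j₁ c₁ s)
    (ht : IsEdge e f i₂ j₂ c₂ t) (hp : IsEdge e f i₃ j₃ c₃ p) (hr : IsEdge e f i₄ j₄ c₄ r)
    (hvs : IsTransvectionAlong s v φ) (hvt : IsTransvectionAlong t u ψ)
    (hvp : IsTransvectionAlong p w χ) (hvr : IsTransvectionAlong r z ω)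
    (hst : ψ v ≠ 0) (hsp : χ v ≠ 0) (htp : χ u ≠ 0) (hrs : ω v = 0) (hrt : ω u = 0)
    (hrp : ω w ≠ 0) (hasym : φ u * ψ w * χ v ≠ ψ v * χ u * φ w) :
    ∃ i j c c', IsEdge e f i j c s ∧ IsEdge e f i j c' t := by
  by_contra hpar
  have hprop : ∀ {i j k l c c'}, IsEdge e f i j c s → IsEdge e f k l c' t →
      ({i, j} : Set ι) ≠ {k, l} := by
    intro i j k l c c' h1 h2 h3
    apply hpar
    rcases Set.pair_eq_pair_iff.1 h3 with ⟨rfl, rfl⟩ | ⟨rfl, rfl⟩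
    · exact ⟨_, _, _, _, h1, h2⟩
    · exact ⟨_, _, _, _, h1, h2.symm⟩
  -- an edge meeting `s` in exactly one vertex, or in the same pair with another gain, does not
  -- commute with `s`
  have hmeet : ∀ {q : V ≃ₗ[K] V} {y : V} {η : Dual K V} {i j k c c'},
      IsTransvectionAlong q y η → IsEdge e f i j c q → IsEdge e f i k c' r → ω y = 0 →
      j = k ∧ c = c' := by
    intro q y η i j k c c' h1 h2 h3 h4
    obtain ⟨α, hα, a1, a2⟩ := h1.exists_smul h2.apply
    obtain ⟨β, hβ, a3, a4⟩ := hvr.exists_smul h3.apply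
    have h5 : (f i + c'⁻¹ • f k) (e i + c • e j) = 0 := by
      rw [a1, a4, LinearMap.smul_apply, map_smul, h4]; simp
    by_cases hjk : j = k
    · refine ⟨hjk, ?_⟩
      subst hjk
      have hc' := h3.gain_ne
      simp only [LinearMap.add_apply, map_add, map_smul, LinearMap.smul_apply, hF.self,
        hF.ne i j h2.index_ne, hF.ne j i h2.index_ne.symm, smul_eq_mul] at h5
      have h6 : c' + c = 0 := by
        field_simp at h5
        linear_combination h5
      exact (CharTwo.add_eq_zero.1 h6).symm
    · rw [pairing_of_common hF h2.index_ne h3.index_ne hjk] at h5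
      exact absurd h5 one_ne_zero
  have hdisj : ∀ {q : V ≃ₗ[K] V} {y : V} {η : Dual K V} {i j k c c'},
      IsTransvectionAlong q y η → IsEdge e f i j c q → IsEdge e f i k c' r → ω y = 0 →
      ∀ x, ω x = 0 ↔ η x = 0 := by
    intro q y η i j k c c' h1 h2 h3 h4 x
    obtain ⟨rfl, rfl⟩ := hmeet h1 h2 h3 h4
    obtain rfl := h2.eq_of_gain h3
    obtain ⟨α, hα, a1, rfl⟩ := h1.exists_smul hvr.apply
    simp [hα]
  obtain ⟨m, a, b, d₃, d₄, hp', hr'⟩ := exists_common_isEdge hF hp hr hvp hvr hrp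
  -- If `m` were on `s`, then `r` would meet `s` and, by `hdisj`, have a covector proportional to
  -- that of `s`. But `ω u = 0`, whereas `φ u ≠ 0` since `s` and `t` meet in one vertex only.
  have hms : ∀ {k c}, ¬ IsEdge e f m k c s := fun h =>
    hst.elim (by
      have := (hdisj hvs h hr' hrs u).1 hrt
      have h2 : ψ v ≠ 0 → φ u ≠ 0 := fun _ h0 => by
        obtain ⟨i, j, k, c, c', q1, q2⟩ := exists_common_isEdge hF hs ht hvs hvt hst
        have hjk : j ≠ k := fun hjk => hprop q1 q2 (by rw [hjk])
        obtain ⟨α, hα, b1, b2⟩ := hvs.exists_smul q1.apply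
        obtain ⟨β, hβ, b3, b4⟩ := hvt.exists_smul q2.apply
        have p2 := pairing_of_common (c := c') (c' := c) hF q2.index_ne q1.index_ne (Ne.symm hjk)
        rw [b2, b3, LinearMap.smul_apply, map_smul, h0] at p2
        simp at p2
      exact absurd this (h2 hst))
  have hmt : ∀ {k c}, ¬ IsEdge e f m k c t := fun h =>
    hst ((hdisj hvt h hr' hrt v).1 hrs)
  obtain ⟨i, j, k, c, c', q1, q2⟩ := exists_common_isEdge hF hs ht hvs hvt hst
  have hjk : j ≠ k := fun hjk => hprop q1 q2 (by rw [hjk])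
  have hmi : m ≠ i := by rintro rfl; exact hms q1
  have hmj : m ≠ j := by rintro rfl; exact hms q1.symm
  have hmk : m ≠ k := by rintro rfl; exact hmt q2.symm
  obtain ⟨α, hα, b1, b2⟩ := hvs.exists_smul q1.apply
  obtain ⟨β, hβ, b3, b4⟩ := hvt.exists_smul q2.apply
  obtain ⟨γ, hγ, b5, b6⟩ := hvp.exists_smul hp'.apply
  -- The end `m` of `p` lies on neither `s` nor `t`, and `p` meets both, so its other end is their
  -- common vertex. Thus `s`, `t`, `p` form a star.
  have hai : a = i := by
    by_contra hai
    have haj : a = j := by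
      by_contra haj
      apply hsp
      have : (f m + d₃⁻¹ • f a) (e i + c • e j) = 0 := by
        simp [hF.ne m i hmi, hF.ne m j hmj, hF.ne a i hai, hF.ne a j haj]
      rw [b1, b6, LinearMap.smul_apply, map_smul] at this
      simpa [hα, hγ] using this
    have hak : a = k := by
      by_contra hak
      apply htp
      have : (f m + d₃⁻¹ • f a) (e i + c' • e k) = 0 := by
        simp [hF.ne m i hmi, hF.ne m k hmk, hF.ne a i hai, hF.ne a k hak]
      rw [b3, b6, LinearMap.smul_apply, map_smul] at this
      simpa [hβ, hγ] using this
    exact hjk (haj.symm.trans hak)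
  subst hai
  obtain ⟨γ, hγ, b5, b6⟩ := hvp.exists_smul hp'.symm.apply
  have p1 := pairing_of_common (c := c') (c' := c) hF q2.index_ne q1.index_ne hjk.symm
  have p2 := pairing_of_common (c := c) (c' := c') hF q1.index_ne q2.index_ne hjk
  have p3 := pairing_of_common (c := d₃⁻¹) (c' := c') hF hmi.symm q2.index_ne hmk
  have p4 := pairing_of_common (c := c') (c' := d₃⁻¹) hF q2.index_ne hmi.symm hmk.symm
  have p5 := pairing_of_common (c := c) (c' := d₃⁻¹) hF q1.index_ne hmi.symm hmj.symm
  have p6 := pairing_of_common (c := d₃⁻¹) (c' := c) hF hmi.symm q1.index_ne hmj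
  rw [b2, b3] at p1
  rw [b4, b1] at p2
  rw [b4, b5] at p3
  rw [b6, b3] at p4
  rw [b6, b1] at p5
  rw [b2, b5] at p6
  simp only [LinearMap.smul_apply, map_smul, smul_eq_mul] at p1 p2 p3 p4 p5 p6
  apply hasym
  -- In a star every pairing is a ratio of normalising scalars, so both triple products equal `1`.
  have e1 : φ u = α / β := by field_simp at p1 ⊢; linear_combination p1
  have e2 : ψ v = β / α := by field_simp at p2 ⊢; linear_combination p2
  have e3 : ψ w = β / γ := by field_simp at p3 ⊢; linear_combination p3
  have e4 : χ u = γ / β := by field_simp at p4 ⊢; linear_combination p4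
  have e5 : χ v = γ / α := by field_simp at p5 ⊢; linear_combination p5
  have e6 : φ w = α / γ := by field_simp at p6 ⊢; linear_combination p6
  rw [e1, e2, e3, e4, e5, e6]
  field_simp

/-- Two frames in each of which `s` and `t` join the same pair of vertices share these vertices. -/
theorem exists_common_vertex [CharP K 2] {e' : κ → V} {f' : κ → Dual K V} {i' j' : κ} {d d' : K}
    (hF : IsFrame e f) (hF' : IsFrame e' f') (hs : IsEdge e f i j c s) (ht : IsEdge e f i j c' t)
    (hcc : c ≠ c') (hs' : IsEdge e' f' i' j' d s) (ht' : IsEdge e' f' i' j' d' t) :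
    ∃ m, ∃ x : K, x ≠ 0 ∧ e' m = x • e i ∧ f' m = x⁻¹ • f i := by
  have hc := hs.gain_ne
  have hc' := ht.gain_ne
  have hd := hs'.gain_ne
  have hd' := ht'.gain_ne
  have hdd : d ≠ d' := by
    rintro rfl
    obtain rfl := hs'.eq_of_gain ht'
    have h1 := hs.covec_right hF (e i)
    rw [ht.covec_right hF (e i), hF.self] at h1
    exact hcc (by linear_combination -h1)
  have hi'j' := hs'.index_ne
  -- In both frames `s * t` scales the two vertices by mutually inverse factors and fixes the common
  -- kernel of the two covectors. The vertices are compared as eigenlines.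
  have g1 : s (t (e i)) = (c' / c) • e i := by
    rw [ht.apply_left hF, map_smul, hs.apply_right hF, smul_smul, div_eq_mul_inv]
  have g2 : ∀ x, f i (s (t x)) = (c' / c) * f i x := fun x => by
    rw [hs.covec_left hF, ht.covec_right hF]; field_simp
  have g3 : s (t (e' i')) = (d' / d) • e' i' := by
    rw [ht'.apply_left hF', map_smul, hs'.apply_right hF', smul_smul, div_eq_mul_inv]
  have g4 : s (t (e' j')) = (d / d') • e' j' := by
    rw [ht'.apply_right hF', map_smul, hs'.apply_left hF', smul_smul, div_eq_mul_inv, mul_comm]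
  have g5 : ∀ x, f' i' (s (t x)) = (d' / d) * f' i' x := fun x => by
    rw [hs'.covec_left hF', ht'.covec_right hF']; field_simp
  have g6 : ∀ x, f' j' (s (t x)) = (d / d') * f' j' x := fun x => by
    rw [hs'.covec_right hF', ht'.covec_left hF']; field_simp
  have hc1 : c' / c - 1 ≠ 0 := by
    rw [sub_ne_zero]; intro h; rw [div_eq_one_iff_eq hc] at h; exact hcc h.symm
  have hfix : ∀ x, f' i' x = 0 → f' j' x = 0 → f i x = 0 := by
    intro x h1 h2
    have h3 := g2 x
    have h4 : t x = x := by rw [ht'.apply]; simp [h1, h2]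
    have h5 : s x = x := by rw [hs'.apply]; simp [h1, h2]
    rw [h4, h5] at h3
    have h6 : (c' / c - 1) * f i x = 0 := by linear_combination -h3
    exact (mul_eq_zero.1 h6).resolve_left hc1
  have hf : ∀ x, f i x = f i (e' i') * f' i' x + f i (e' j') * f' j' x := by
    intro x
    have h1 := hfix (x - f' i' x • e' i' - f' j' x • e' j')
      (by simp [hF'.self, hF'.ne i' j' hi'j']) (by simp [hF'.self, hF'.ne j' i' hi'j'.symm])
    simp only [map_sub, map_smul, smul_eq_mul] at h1
    linear_combination h1
  have he : ∃ A B : K, e i = A • e' i' + B • e' j' := by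
    have h1 : ∃ A B : K, s (t (e i)) - e i = A • e' i' + B • e' j' := by
      rw [hs'.apply, ht'.apply]
      generalize (f' i' + d⁻¹ • f' j') _ = a
      generalize (f' i' + d'⁻¹ • f' j') _ = b
      exact ⟨b + a, b * d' + a * d, by module⟩
    obtain ⟨A, B, hAB⟩ := h1
    refine ⟨(c' / c - 1)⁻¹ * A, (c' / c - 1)⁻¹ * B, ?_⟩
    have h2 : (c' / c - 1) • e i = A • e' i' + B • e' j' := by
      rw [← hAB, g1, sub_smul, one_smul]
    rw [mul_smul, mul_smul, ← smul_add, ← h2, smul_smul, inv_mul_cancel₀ hc1, one_smul]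
  obtain ⟨A, B, hAB⟩ := he
  have hA : (c' / c - d' / d) * A = 0 := by
    have h1 := g5 (e i)
    rw [g1, hAB] at h1
    simp only [map_smul, map_add, hF'.self, hF'.ne i' j' hi'j', smul_eq_mul] at h1
    linear_combination h1
  have hB : (c' / c - d / d') * B = 0 := by
    have h1 := g6 (e i)
    rw [g1, hAB] at h1
    simp only [map_smul, map_add, hF'.self, hF'.ne j' i' hi'j'.symm, smul_eq_mul] at h1
    linear_combination h1
  have hfA : (c' / c - d' / d) * f i (e' i') = 0 := by
    have h1 := g2 (e' i')
    rw [g3, map_smul, smul_eq_mul] at h1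
    linear_combination -h1
  have hfB : (c' / c - d / d') * f i (e' j') = 0 := by
    have h1 := g2 (e' j')
    rw [g4, map_smul, smul_eq_mul] at h1
    linear_combination -h1
  have hone : A * f i (e' i') + B * f i (e' j') = 1 := by
    rw [← hF.self i]
    conv_rhs => rw [hAB]
    simp
  -- The two eigenvalues differ: in characteristic two, `x = x⁻¹` only for `x = 1`. So `e i` lies on
  -- exactly one of the lines of `e' i'` and `e' j'`.
  have hddne : d' / d ≠ d / d' := by
    intro h
    rw [div_eq_div_iff hd hd'] at h
    have h1 : (d' + d) * (d' + d) = 0 := by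
      have := CharTwo.two_eq_zero (R := K)
      linear_combination h + (d * d' + d * d) * this
    exact hdd (CharTwo.add_eq_zero.1 (mul_self_eq_zero.1 h1)).symm
  by_cases h1 : c' / c = d' / d
  · have h2 : c' / c - d / d' ≠ 0 := by rw [h1]; exact sub_ne_zero.2 hddne
    have hB0 := (mul_eq_zero.1 hB).resolve_left h2
    have hf0 := (mul_eq_zero.1 hfB).resolve_left h2
    rw [hB0, zero_mul, add_zero] at hone
    have hA0 : A ≠ 0 := left_ne_zero_of_mul_eq_one hone
    refine ⟨i', A⁻¹, inv_ne_zero hA0, ?_, ?_⟩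
    · rw [hAB, hB0, zero_smul, add_zero, smul_smul, inv_mul_cancel₀ hA0, one_smul]
    · ext x
      rw [inv_inv, LinearMap.smul_apply, hf x, hf0, smul_eq_mul]
      linear_combination -f' i' x * hone
  · have h2 : c' / c - d' / d ≠ 0 := sub_ne_zero.2 h1
    have hA0 := (mul_eq_zero.1 hA).resolve_left h2
    have hf0 := (mul_eq_zero.1 hfA).resolve_left h2
    rw [hA0, zero_mul, zero_add] at hone
    have hB0 : B ≠ 0 := left_ne_zero_of_mul_eq_one hone
    refine ⟨j', B⁻¹, inv_ne_zero hB0, ?_, ?_⟩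
    · rw [hAB, hA0, zero_smul, zero_add, smul_smul, inv_mul_cancel₀ hB0, one_smul]
    · ext x
      rw [inv_inv, LinearMap.smul_apply, hf x, hf0, smul_eq_mul]
      linear_combination -f' j' x * hone

end Uniqueness

end TransvectionGroups

/-! ### From monomial type to a frame -/

namespace TransvectionGroups

variable {K V : Type*} [Field K] [AddCommGroup V] [Module K V] {ι κ : Type*}

theorem exists_isEdge_equiv [CharP K 2] {e : ι → V} {f : ι → Dual K V} (hF : IsFrame e f)
    {i j : ι} (hij : i ≠ j) {c : K} (hc : c ≠ 0) : ∃ t : V ≃ₗ[K] V, IsEdge e f i j c t := by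
  have h0 : (f i + c⁻¹ • f j) (e i + c • e j) = 0 := by
    simp only [map_add, LinearMap.add_apply, LinearMap.smul_apply, map_smul, hF.self,
      hF.ne i j hij, hF.ne j i hij.symm, smul_eq_mul]
    field_simp
    linear_combination CharTwo.add_self_eq_zero c
  exact ⟨LinearEquiv.transvection h0, hij, hc, fun x => LinearEquiv.transvection.apply h0 x⟩

theorem IsTransvectionAlong.det_eq_one [FiniteDimensional K V] {t : V ≃ₗ[K] V} {v : V}
    {φ : Dual K V} (h : IsTransvectionAlong t v φ) : LinearMap.det (t : V →ₗ[K] V) = 1 := by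
  have hmap : (t : V →ₗ[K] V) = LinearMap.transvection φ v := by
    ext x; simp [LinearMap.transvection.apply, h.apply]
  rw [hmap, LinearMap.transvection.det, h.apply_self, add_zero]

theorem isFrame_basis (b : Basis ι K V) : IsFrame b b.coord :=
  ⟨fun i => by simp, fun i j hij => by simp [Finsupp.single_eq_of_ne hij]⟩

theorem IsEdge.isMonomialElement [FiniteDimensional K V] [CharP K 2] {d : ℕ} {b : Basis (Fin d) K V}
    {i j : Fin d} {c : K} {t : V ≃ₗ[K] V} (h : IsEdge b b.coord i j c t) {a : ℕ} (hc : c ^ a = 1) :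
    IsMonomialElement b a t := by
  classical
  have hF := isFrame_basis b
  refine ⟨(h.along hF).det_eq_one, Equiv.swap i j,
    fun k => if k = i then c else if k = j then c⁻¹ else 1, fun k => ?_, fun k => ?_⟩
  · dsimp only
    split_ifs
    · exact hc
    · rw [inv_pow, hc, inv_one]
    · exact one_pow _
  · dsimp only
    by_cases h1 : k = i
    · subst h1; simp [h.apply_left hF]
    by_cases h2 : k = j
    · subst h2; simp [h1, h.apply_right hF]
    · rw [if_neg h1, if_neg h2, Equiv.swap_apply_of_ne_of_ne h1 h2, one_smul,
        h.apply_of_ne hF h1 h2]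

variable {S T : Set (V ≃ₗ[K] V)} {v : (V ≃ₗ[K] V) → V} {φ : (V ≃ₗ[K] V) → Dual K V}

/-- The zero left kernel bounds `dim V(S)` by `dim V*(S)`, the zero right kernel gives the reverse
bound, and so the trivial intersection has complementary dimensions. -/
theorem IsGood.isCompl [FiniteDimensional K V] (hS : IsGood T S v φ) :
    IsCompl (vecSpan S) (covecSpan S).dualCoannihilator := by
  have h1 : vecSpan S ⊓ (covecSpan S).dualCoannihilator = ⊥ :=
    zeroLeftKernel_iff.1 hS.nondegenerate.1
  have h2 : covecSpan S ⊓ (vecSpan S).dualAnnihilator = ⊥ := by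
    rw [Submodule.eq_bot_iff]
    rintro ψ ⟨hψ, hψ'⟩
    exact hS.nondegenerate.2 ψ hψ fun x hx => (Submodule.mem_dualAnnihilator ψ).1 hψ' x hx
  refine IsCompl.of_eq h1 ?_
  apply Submodule.eq_top_of_finrank_eq
  have a1 := Submodule.finrank_sup_add_finrank_inf_eq (vecSpan S) (covecSpan S).dualCoannihilator
  have a2 := Submodule.finrank_sup_add_finrank_inf_eq (covecSpan S) (vecSpan S).dualAnnihilator
  rw [h1, finrank_bot] at a1
  rw [h2, finrank_bot] at a2
  have a3 := Subspace.finrank_add_finrank_dualCoannihilator_eq (covecSpan S)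
  have a4 := Subspace.finrank_add_finrank_dualAnnihilator_eq (vecSpan S)
  have a5 := Submodule.finrank_le (vecSpan S ⊔ (covecSpan S).dualCoannihilator)
  have a6 := Submodule.finrank_le (covecSpan S ⊔ (vecSpan S).dualAnnihilator)
  rw [Subspace.dual_finrank_eq] at a6
  omega

theorem exists_basis_of_restrict_top {G : Subgroup (V ≃ₗ[K] V)} {W : Submodule K V} (hW : W = ⊤)
    {d a : ℕ} {b : Basis (Fin d) K W} (hb : ∀ g, g ∈ restrict G W ↔ IsMonomialElement b a g) :
    ∃ b' : Basis (Fin d) K V, ∀ g, g ∈ G ↔ IsMonomialElement b' a g := by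
  subst hW
  let θ : (⊤ : Submodule K V) ≃ₗ[K] V := Submodule.topEquiv
  refine ⟨b.map θ, fun g => ?_⟩
  let h : (⊤ : Submodule K V) ≃ₗ[K] (⊤ : Submodule K V) := (θ.trans g).trans θ.symm
  have hθ : ∀ w, θ (h w) = g (θ w) := fun w => θ.apply_symm_apply _
  have h1 : g ∈ G ↔ h ∈ restrict G ⊤ := by
    constructor
    · exact fun hg => ⟨g, hg, hθ⟩
    · rintro ⟨g', hg', hh⟩
      have : g = g' := by
        ext x
        exact (hθ (θ.symm x)).symm.trans (hh (θ.symm x))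
      rwa [this]
  have hdet : LinearMap.det (h : (⊤ : Submodule K V) →ₗ[K] (⊤ : Submodule K V)) =
      LinearMap.det (g : V →ₗ[K] V) := LinearMap.det_conj (g : V →ₗ[K] V) θ.symm
  rw [h1, hb, IsMonomialElement, IsMonomialElement, hdet]
  refine and_congr_right fun _ => exists_congr fun σ => exists_congr fun c =>
    and_congr_right fun _ => forall_congr' fun i => ?_
  rw [Basis.map_apply, Basis.map_apply, ← hθ, ← LinearEquiv.map_smul θ, θ.injective.eq_iff]

/-- `e, f` is a frame of which all transvections in `G` are edges. -/
structure IsFrameFor (G : Subgroup (V ≃ₗ[K] V)) (e : ι → V) (f : ι → Dual K V) : Prop where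
  isFrame : IsFrame e f
  isEdge : ∀ t ∈ G, ∀ u ψ, IsTransvectionAlong t u ψ → ∃ i j c, IsEdge e f i j c t

/-- A good set of monomial type yields a frame for the group it generates. -/
theorem IsGood.exists_isFrameFor [FiniteDimensional K V] (hS : IsGood T S v φ)
    (hv : IsPresentation T v φ)
    (h : HasMonomialType (restrict (Subgroup.closure S)
      (commutatorSpace (Subgroup.closure S)))) :
    ∃ (d a : ℕ) (e : Fin d → V) (f : Fin d → Dual K V), d = finrank K (vecSpan S) ∧ 1 < a ∧
      a ∣ Nat.card K - 1 ∧ IsFrameFor (Subgroup.closure S) e f ∧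
      (∀ i j (c : K), i ≠ j → c ^ a = 1 → ∃ g ∈ Subgroup.closure S, IsEdge e f i j c g) ∧
      (vecSpan S = ⊤ → ∃ b : Basis (Fin d) K V,
        ∀ g, g ∈ Subgroup.closure S ↔ IsMonomialElement b a g) := by
  have hvS := hv.mono hS.subset
  set W := commutatorSpace (Subgroup.closure S) with hW
  obtain ⟨h2, d, hd, a, ha, hadvd, b, hb⟩ := h
  have hWS : W = vecSpan S := hvS.commutatorSpace_eq
  have hcompl : IsCompl W (covecSpan S).dualCoannihilator := hWS ▸ hS.isCompl
  let P : V →ₗ[K] W := W.projectionOnto _ hcompl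
  have hPW : ∀ w : W, P w = w := fun w => Submodule.projectionOnto_apply_left hcompl w
  have hP0 : ∀ x, P x = 0 ↔ ∀ t ∈ S, φ t x = 0 := fun x => by
    rw [Submodule.projectionOnto_apply_eq_zero_iff, Submodule.mem_dualCoannihilator]
    exact hvS.forall_covecSpan_iff x
  let e : Fin d → V := fun i => b i
  let f : Fin d → Dual K V := fun i => b.coord i ∘ₗ P
  have hbF := isFrame_basis b
  have hF : IsFrame e f :=
    ⟨fun i => by simp [e, f, hPW], fun i j hij => by
      -- The frame covectors extend the coordinates on `W` by zero on the common kernel of `V*(S)`,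
      -- which the group fixes pointwise.
      change b.coord i (P (b j)) = 0
      rw [hPW]; exact hbF.ne i j hij⟩
  have hf0 : ∀ x, (∀ i, f i x = 0) → ∀ g ∈ Subgroup.closure S, g x = x := by
    intro x hx g hg
    refine hvS.closure_apply_of_forall ((hP0 x).1 ?_) hg
    exact b.ext_elem fun i => by rw [map_zero]; exact hx i
  refine ⟨d, a, e, f, ?_, ha, hadvd, ⟨hF, ?_⟩, ?_,
    fun htop => exists_basis_of_restrict_top (hWS.trans htop) hb⟩
  · rw [← hWS, finrank_eq_card_basis b, Fintype.card_fin]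
  · intro t ht u ψ htu
    refine htu.exists_isEdge hF (fun i => ?_) fun x hx => hf0 x hx t ht
    obtain ⟨g, hg, hgt⟩ := exists_mem_restrict ht
    obtain ⟨-, σ, c, -, hc⟩ := (hb g).1 hg
    exact ⟨σ i, c i, by rw [← hgt (b i), hc]; rfl⟩
  · intro i j c hij hca
    have hc0 : c ≠ 0 := by
      rintro rfl
      rw [zero_pow (by omega)] at hca
      exact zero_ne_one hca
    obtain ⟨t, ht⟩ := exists_isEdge_equiv hbF hij hc0
    obtain ⟨g, hg, hgt⟩ := (hb t).2 (ht.isMonomialElement hca)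
    refine ⟨g, hg, hij, hc0, fun x => ?_⟩
    have hx : g (x - P x) = x - P x := by
      refine hvS.closure_apply_of_forall ((hP0 _).1 ?_) hg
      rw [map_sub, hPW, sub_self]
    have h1 : g x = (x - P x) + (t (P x) : V) := by
      rw [hgt, ← hx, ← map_add, sub_add_cancel]
    rw [h1, ht.apply]
    simp only [Submodule.coe_add, Submodule.coe_smul]
    change _ = x + (b.coord i + c⁻¹ • b.coord j) (P x) • ((b i : V) + c • (b j : V))
    abel

end TransvectionGroups

/-! ### A vertex common to all frames -/

namespace TransvectionGroups

variable {K V : Type*} [Field K] [AddCommGroup V] [Module K V] {ι κ : Type*}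

theorem exists_orderOf_eq [Finite K] {a : ℕ} (ha : a ∣ Nat.card K - 1) :
    ∃ c : K, orderOf c = a := by
  obtain ⟨g, hg⟩ := IsCyclic.exists_ofOrder_eq_natCard (α := Kˣ)
  have hcard : Nat.card Kˣ = Nat.card K - 1 := Nat.card_units K
  obtain ⟨m, hm⟩ := ha
  have hpos : 0 < Nat.card Kˣ := Nat.card_pos
  have hm0 : m ≠ 0 := by rintro rfl; omega
  refine ⟨((g ^ m : Kˣ) : K), ?_⟩
  rw [orderOf_units, orderOf_pow_of_dvd hm0 (by rw [hg, hcard, hm]; exact Dvd.intro_left a rfl),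
    hg, hcard, hm, Nat.mul_div_cancel _ (Nat.pos_of_ne_zero hm0)]

/-- A vertex that belongs to every frame for `G`. -/
theorem exists_vertex_mem_all_frames [CharP K 2] [Finite K] {G : Subgroup (V ≃ₗ[K] V)} {d a : ℕ}
    {e : Fin d → V} {f : Fin d → Dual K V} (hd : 2 ≤ d) (ha : 1 < a) (hadvd : a ∣ Nat.card K - 1)
    (hF : IsFrame e f)
    (hG : ∀ i j (c : K), i ≠ j → c ^ a = 1 → ∃ g ∈ G, IsEdge e f i j c g) (h : a ≠ 3 ∨ 4 ≤ d) :
    ∃ (e₀ : V) (f₀ : Dual K V), f₀ e₀ = 1 ∧ ∀ (d' : ℕ) (e' : Fin d' → V) (f' : Fin d' → Dual K V),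
      IsFrameFor G e' f' → ∃ m, ∃ x : K, x ≠ 0 ∧ e' m = x • e₀ ∧ f' m = x⁻¹ • f₀ := by
  obtain ⟨c, hc⟩ := exists_orderOf_eq hadvd
  have hca : c ^ a = 1 := hc ▸ pow_orderOf_eq_one c
  have hc1 : c ≠ 1 := by rintro rfl; rw [orderOf_one] at hc; omega
  have hc0 : c ≠ 0 := by
    rintro rfl
    rw [zero_pow (by omega)] at hca
    exact zero_ne_one hca
  have htwo := CharTwo.two_eq_zero (R := K)
  have hc2 : 1 + c ≠ 0 := fun h => hc1 (CharTwo.add_eq_zero.1 h).symm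
  have hci : 1 + c⁻¹ ≠ 0 := fun h => hc2 (by field_simp at h; linear_combination h)
  let i₀ : Fin d := ⟨0, by omega⟩
  let i₁ : Fin d := ⟨1, by omega⟩
  have h01 : i₀ ≠ i₁ := by simp [i₀, i₁]
  obtain ⟨s, hsG, hs⟩ := hG i₀ i₁ 1 h01 (one_pow a)
  obtain ⟨t, htG, ht⟩ := hG i₀ i₁ c h01 hca
  have hvs := hs.along hF
  have hvt := ht.along hF
  -- The common vertex is `i₀`: `s` and `t` are parallel with gains `1` and `c`, so it is enough
  -- that they stay parallel in every other frame.
  suffices hpar : ∀ (d' : ℕ) (e' : Fin d' → V) (f' : Fin d' → Dual K V), IsFrameFor G e' f' →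
      ∃ i j c c', IsEdge e' f' i j c s ∧ IsEdge e' f' i j c' t by
    refine ⟨e i₀, f i₀, hF.self _, fun d' e' f' hF' => ?_⟩
    obtain ⟨i, j, x, y, h1, h2⟩ := hpar d' e' f' hF'
    exact exists_common_vertex hF hF'.isFrame hs ht (Ne.symm hc1) h1 h2
  intro d' e' f' hF'
  obtain ⟨_, _, _, hs'⟩ := hF'.isEdge s hsG _ _ hvs
  obtain ⟨_, _, _, ht'⟩ := hF'.isEdge t htG _ _ hvt
  have q1 : (f i₀ + c⁻¹ • f i₁) (e i₀ + (1 : K) • e i₁) = 1 + c⁻¹ := by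
    simp [hF.self, hF.ne _ _ h01, hF.ne _ _ h01.symm]
  have q2 : (f i₀ + (1 : K)⁻¹ • f i₁) (e i₀ + c • e i₁) = 1 + c := by
    simp [hF.self, hF.ne _ _ h01, hF.ne _ _ h01.symm]
  -- The product of the pairings of `s` and `t` is `c + c⁻¹`, which is `1` exactly when `c` has
  -- order three. In that case the triple criterion is used, with `p` joining `1, 2` and `r` joining
  -- `2, 3`; this needs four vertices.
  by_cases ha3 : a = 3
  · have hd4 : 4 ≤ d := h.resolve_left (not_not.2 ha3)
    let i₂ : Fin d := ⟨2, by omega⟩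
    let i₃ : Fin d := ⟨3, by omega⟩
    have h02 : i₀ ≠ i₂ := by simp [i₀, i₂]
    have h03 : i₀ ≠ i₃ := by simp [i₀, i₃]
    have h12 : i₁ ≠ i₂ := by simp [i₁, i₂]
    have h13 : i₁ ≠ i₃ := by simp [i₁, i₃]
    have h23 : i₂ ≠ i₃ := by simp [i₂, i₃]
    obtain ⟨p, hpG, hp⟩ := hG i₁ i₂ 1 h12 (one_pow a)
    obtain ⟨r, hrG, hr⟩ := hG i₂ i₃ 1 h23 (one_pow a)
    obtain ⟨_, _, _, hp'⟩ := hF'.isEdge p hpG _ _ (hp.along hF)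
    obtain ⟨_, _, _, hr'⟩ := hF'.isEdge r hrG _ _ (hr.along hF)
    refine exists_parallel_of_triple hF'.isFrame hs' ht' hp' hr' hvs hvt (hp.along hF)
      (hr.along hF) ?_ ?_ ?_ ?_ ?_ ?_ ?_
    · rw [q1]; exact hci
    · simp [hF.self, hF.ne _ _ h01.symm, hF.ne _ _ h02.symm, hF.ne _ _ h12.symm]
    · simp [hF.self, hF.ne _ _ h01.symm, hF.ne _ _ h02.symm, hF.ne _ _ h12.symm, hc0]
    · simp [hF.ne _ _ h02.symm, hF.ne _ _ h12.symm, hF.ne _ _ h03.symm, hF.ne _ _ h13.symm]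
    · simp [hF.ne _ _ h02.symm, hF.ne _ _ h12.symm, hF.ne _ _ h03.symm, hF.ne _ _ h13.symm]
    · simp [hF.self, hF.ne _ _ h12.symm, hF.ne _ _ h13.symm, hF.ne _ _ h23.symm]
    · rw [q1, q2]
      simp only [map_add, LinearMap.add_apply, LinearMap.smul_apply, map_smul, hF.self,
        hF.ne _ _ h01, hF.ne _ _ h01.symm, hF.ne _ _ h02, hF.ne _ _ h02.symm, hF.ne _ _ h12,
        hF.ne _ _ h12.symm, smul_eq_mul, inv_one, one_smul]
      intro h0
      have h1 : (1 + c) * (1 + c) = 0 := by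
        field_simp at h0
        linear_combination h0 + (c ^ 2 + c) * htwo
      exact hc2 (mul_self_eq_zero.1 h1)
  · refine exists_parallel_of_pairing hF'.isFrame hs' ht' hvs hvt ?_ ?_
    · rw [q1]; exact hci
    · rw [q1, q2]
      intro h0
      have h1 : c ^ 2 + c + 1 = 0 := by
        field_simp at h0
        linear_combination h0
      have h2 : c ^ 3 = 1 := by linear_combination (c - 1) * h1
      have h3 := orderOf_dvd_of_pow_eq_one h2
      rw [hc] at h3
      rcases (Nat.dvd_prime Nat.prime_three).1 h3 with h4 | h4 <;> omega

/-! ### Gluing local frames along a common vertex -/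

section Gluing

variable {T : Set (V ≃ₗ[K] V)} {v : (V ≃ₗ[K] V) → V} {φ : (V ≃ₗ[K] V) → Dual K V}

/-- The edge `t` at the vertex `(e₀, f₀)` has the other vertex `(y, z)`, normalized so that
`t = 1 + (e₀ + y) ⊗ (f₀ + z)`. -/
structure IsSpoke (e₀ : V) (f₀ : Dual K V) (t : V ≃ₗ[K] V) (y : V) (z : Dual K V) : Prop where
  covec_left : z e₀ = 0
  vec_left : f₀ y = 0
  apply : ∀ x, t x = x + (f₀ + z) x • (e₀ + y)

/-- Since `f₀ e₀ = 1`, requiring the components at the base vertex to be exactly `e₀` and `f₀`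
removes the scalar ambiguity. The outer end thus depends on `t` and the base vertex but not on a
frame. -/
theorem IsSpoke.unique {e₀ : V} {f₀ : Dual K V} {t : V ≃ₗ[K] V} {y y' : V} {z z' : Dual K V}
    (h₀ : f₀ e₀ = 1) (h : IsSpoke e₀ f₀ t y z) (h' : IsSpoke e₀ f₀ t y' z') : y = y' ∧ z = z' := by
  have h1 : ∀ x, (f₀ + z) x • (e₀ + y) = (f₀ + z') x • (e₀ + y') := fun x =>
    add_left_cancel ((h.apply x).symm.trans (h'.apply x))
  have h2 : y = y' := by
    have := h1 e₀
    simpa [h₀, h.covec_left, h'.covec_left] using this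
  refine ⟨h2, ?_⟩
  subst h2
  ext x
  have := congrArg f₀ (h1 x)
  simpa [h₀, h.vec_left] using this

theorem IsEdge.isSpoke {e : ι → V} {f : ι → Dual K V} {i j : ι} {c : K} {t : V ≃ₗ[K] V}
    (hF : IsFrame e f) (h : IsEdge e f i j c t) {e₀ : V} {f₀ : Dual K V} {x : K} (hx : x ≠ 0)
    (he : e i = x • e₀) (hf : f i = x⁻¹ • f₀) :
    IsSpoke e₀ f₀ t ((x⁻¹ * c) • e j) ((x * c⁻¹) • f j) := by
  have he' : e₀ = x⁻¹ • e i := by rw [he, smul_smul, inv_mul_cancel₀ hx, one_smul]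
  have hf' : f₀ = x • f i := by rw [hf, smul_smul, mul_inv_cancel₀ hx, one_smul]
  refine ⟨?_, ?_, fun w => ?_⟩
  · rw [he']; simp [hF.ne j i h.index_ne.symm]
  · rw [hf']; simp [hF.ne i j h.index_ne]
  · rw [h.apply, he', hf', ← smul_smul x⁻¹, ← smul_smul x, ← smul_add, ← smul_add,
      LinearMap.smul_apply, smul_smul, smul_eq_mul]
    congr 2
    field_simp

/-- Every three elements of `T` are edges of some frame through the vertex `(e₀, f₀)`. -/
def HasLocalFrames (T : Set (V ≃ₗ[K] V)) (e₀ : V) (f₀ : Dual K V) : Prop :=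
  ∀ t₁ ∈ T, ∀ t₂ ∈ T, ∀ t₃ ∈ T, ∃ (d : ℕ) (e : Fin d → V) (f : Fin d → Dual K V) (m : Fin d),
    IsFrame e f ∧ (∃ x : K, x ≠ 0 ∧ e m = x • e₀ ∧ f m = x⁻¹ • f₀) ∧
    ∀ t, t = t₁ ∨ t = t₂ ∨ t = t₃ → ∃ i j c, IsEdge e f i j c t

theorem IsEdge.exists_left {e : ι → V} {f : ι → Dual K V} {i j m : ι} {c : K} {t : V ≃ₗ[K] V}
    (h : IsEdge e f i j c t) (hm : i = m ∨ j = m) : ∃ k c', IsEdge e f m k c' t := by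
  rcases hm with rfl | rfl
  · exact ⟨_, _, h⟩
  · exact ⟨_, _, h.symm⟩

/-- An edge moved by a frame covector is incident with its vertex. -/
theorem IsEdge.exists_left_of_covec {e : ι → V} {f : ι → Dual K V} {i j m : ι} {c : K}
    {t : V ≃ₗ[K] V} (hF : IsFrame e f) (h : IsEdge e f i j c t) {u : V} {ψ : Dual K V}
    (ht : IsTransvectionAlong t u ψ) (hm : f m u ≠ 0) : ∃ k c', IsEdge e f m k c' t := by
  refine h.exists_left ?_
  by_contra! hne
  obtain ⟨α, hα, h1, h2⟩ := ht.exists_smul h.apply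
  have h3 : f m (e i + c • e j) = 0 := by simp [hF.ne m i hne.1.symm, hF.ne m j hne.2.symm]
  rw [h1, map_smul] at h3
  exact hm ((smul_eq_zero.1 h3).resolve_left hα)

theorem IsEdge.exists_left_of_vec {e : ι → V} {f : ι → Dual K V} {i j m : ι} {c : K}
    {t : V ≃ₗ[K] V} (hF : IsFrame e f) (h : IsEdge e f i j c t) {u : V} {ψ : Dual K V}
    (ht : IsTransvectionAlong t u ψ) (hm : ψ (e m) ≠ 0) : ∃ k c', IsEdge e f m k c' t := by
  refine h.exists_left ?_
  by_contra! hne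
  obtain ⟨α, hα, h1, h2⟩ := ht.exists_smul h.apply
  have h3 : (f i + c⁻¹ • f j) (e m) = 0 := by simp [hF.ne i m hne.1, hF.ne j m hne.2]
  rw [h2, LinearMap.smul_apply] at h3
  exact hm ((smul_eq_zero.1 h3).resolve_left (inv_ne_zero hα))

theorem IsEdge.of_smul {e : ι → V} {f : ι → Dual K V} {e' : κ → V} {f' : κ → Dual K V} {i j : ι}
    {i' j' : κ} {c a b : K} {t : V ≃ₗ[K] V} (h : IsEdge e f i j c t) (hij : i' ≠ j') (ha : a ≠ 0)
    (hb : b ≠ 0) (h1 : e i = a • e' i') (h2 : f i = a⁻¹ • f' i') (h3 : e j = b • e' j')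
    (h4 : f j = b⁻¹ • f' j') : IsEdge e' f' i' j' (a⁻¹ * b * c) t := by
  have hc := h.gain_ne
  refine ⟨hij, mul_ne_zero (mul_ne_zero (inv_ne_zero ha) hb) hc, fun x => ?_⟩
  rw [h.apply, h1, h2, h3, h4]
  have e1 : a • e' i' + c • b • e' j' = a • (e' i' + (a⁻¹ * b * c) • e' j') := by
    rw [smul_add, smul_smul, smul_smul]; congr 2; field_simp
  have e2 : a⁻¹ • f' i' + c⁻¹ • b⁻¹ • f' j' = a⁻¹ • (f' i' + (a⁻¹ * b * c)⁻¹ • f' j') := by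
    rw [smul_add, smul_smul, smul_smul]; congr 2; field_simp
  rw [e1, e2, LinearMap.smul_apply, smul_smul, smul_eq_mul]
  congr 2
  field_simp

end Gluing

end TransvectionGroups

/-! ### The global basis built from outer ends of spokes -/

namespace TransvectionGroups

variable {K V : Type*} [Field K] [AddCommGroup V] [Module K V] {ι κ : Type*}

section Gluing

variable {T : Set (V ≃ₗ[K] V)} {v : (V ≃ₗ[K] V) → V} {φ : (V ≃ₗ[K] V) → Dual K V}
  {e₀ : V} {f₀ : Dual K V}

/-- In any frame through the base vertex of which `t` is an edge, the component of `t` at that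
vertex is nonzero, so `t` is incident with it. Uniqueness then identifies the outer end of the spoke
with a frame vertex. -/
theorem IsSpoke.exists_index {e : ι → V} {f : ι → Dual K V} {i j m : ι} {c x : K}
    {t : V ≃ₗ[K] V} {y : V} {z : Dual K V} (h₀ : f₀ e₀ = 1) (h : IsSpoke e₀ f₀ t y z)
    (hF : IsFrame e f) (hx : x ≠ 0) (he : e m = x • e₀) (hf : f m = x⁻¹ • f₀)
    (ht : IsEdge e f i j c t) {u : V} {ψ : Dual K V} (htu : IsTransvectionAlong t u ψ) :
    ∃ k, k ≠ m ∧ ∃ a : K, a ≠ 0 ∧ y = a • e k ∧ z = a⁻¹ • f k := by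
  obtain ⟨α, hα, h1, h2⟩ := htu.exists_smul h.apply
  have h3 : f m u ≠ 0 := by
    intro h0
    have h4 : f₀ (e₀ + y) = 1 := by rw [map_add, h₀, h.vec_left, add_zero]
    rw [hf, LinearMap.smul_apply, smul_eq_zero] at h0
    rw [h1, map_smul, h0.resolve_left (inv_ne_zero hx), smul_zero] at h4
    exact zero_ne_one h4
  obtain ⟨k, c', hk⟩ := ht.exists_left_of_covec hF htu h3
  obtain ⟨h5, h6⟩ := h.unique h₀ (hk.isSpoke hF hx he hf)
  refine ⟨k, hk.index_ne.symm, x⁻¹ * c', mul_ne_zero (inv_ne_zero hx) hk.gain_ne, h5, ?_⟩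
  rw [h6]; congr 1; rw [mul_inv, inv_inv]

theorem HasLocalFrames.exists_isSpoke (hloc : HasLocalFrames T e₀ f₀)
    (hv : IsPresentation T v φ) {t : V ≃ₗ[K] V} (ht : t ∈ T) (h : φ t e₀ ≠ 0) :
    ∃ y z, IsSpoke e₀ f₀ t y z := by
  obtain ⟨d, e, f, m, hF, ⟨x, hx, he, hf⟩, hT⟩ := hloc t ht t ht t ht
  obtain ⟨i, j, c, hij⟩ := hT t (Or.inl rfl)
  obtain ⟨k, c', hk⟩ := hij.exists_left_of_vec (m := m) hF (hv t ht) (by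
    rw [he, map_smul]; exact smul_ne_zero hx h)
  exact ⟨_, _, hk.isSpoke hF hx he hf⟩

theorem exists_basis_of_isFrame [FiniteDimensional K V] {e : ι → V} {f : ι → Dual K V}
    (hF : IsFrame e f) (hspan : ⊤ ≤ Submodule.span K (Set.range e)) :
    ∃ (n : ℕ) (b : Basis (Fin n) K V) (σ : ι ≃ Fin n), ∀ i, b (σ i) = e i ∧ b.coord (σ i) = f i := by
  have hli := hF.linearIndependent
  have hfin : Finite ι := hli.finite
  let b₀ : Basis ι K V := Basis.mk hli hspan
  let σ := Finite.equivFin ι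
  refine ⟨_, b₀.reindex σ, σ, fun i => ⟨by simp [b₀], ?_⟩⟩
  refine b₀.ext fun j => ?_
  by_cases hij : i = j
  · subst hij
    have : f i (b₀ i) = 1 := by simp [b₀, hF.self]
    rw [this]; simp
  · have : f i (b₀ j) = 0 := by simp [b₀, hF.ne i j hij]
    rw [this]; simp [Ne.symm hij]

/-- If the elements of a dense set `T` are, three at a time, edges of a frame through a given
vertex, then `T` consists of edges of a single frame. -/
theorem HasLocalFrames.exists_basis [FiniteDimensional K V] (hloc : HasLocalFrames T e₀ f₀)
    (hv : IsPresentation T v φ) (hd : IsDense T) (hV : 0 < finrank K V) (h₀ : f₀ e₀ = 1) :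
    ∃ (n : ℕ) (b : Basis (Fin n) K V), ∀ t ∈ T, ∃ i j c, IsEdge b b.coord i j c t := by
  classical
  let A : Type _ := {t : V ≃ₗ[K] V // t ∈ T ∧ ∃ y z, IsSpoke e₀ f₀ t y z}
  choose Y Z hYZ using fun t : A => t.2.2
  -- Viewed in one frame containing both spokes, their outer ends are either the same vertex up to
  -- scaling or distinct vertices of that frame.
  have hpair : ∀ r s : A, (∃ a : K, a ≠ 0 ∧ Y s = a • Y r ∧ Z s = a⁻¹ • Z r) ∨ Z r (Y s) = 0 := by
    intro r s
    obtain ⟨d, e, f, m, hF, ⟨x, hx, he, hf⟩, hT⟩ := hloc r r.2.1 r r.2.1 s s.2.1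
    obtain ⟨_, _, _, hr⟩ := hT r (Or.inl rfl)
    obtain ⟨_, _, _, hs⟩ := hT s (Or.inr (Or.inr rfl))
    obtain ⟨k, hk, a, ha, h1, h2⟩ := (hYZ r).exists_index h₀ hF hx he hf hr (hv r r.2.1)
    obtain ⟨l, hl, b, hb, h3, h4⟩ := (hYZ s).exists_index h₀ hF hx he hf hs (hv s s.2.1)
    by_cases hkl : k = l
    · subst hkl
      refine Or.inl ⟨b * a⁻¹, mul_ne_zero hb (inv_ne_zero ha), ?_, ?_⟩
      · rw [h1, h3, smul_smul, inv_mul_cancel_right₀ ha]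
      · rw [h2, h4, smul_smul, mul_inv, inv_inv, mul_assoc, mul_inv_cancel₀ ha, mul_one]
    · refine Or.inr ?_
      rw [h2, h3]; simp [hF.ne k l hkl]
  have hself : ∀ r : A, Z r (Y r) = 1 := by
    intro r
    obtain ⟨d, e, f, m, hF, ⟨x, hx, he, hf⟩, hT⟩ := hloc r r.2.1 r r.2.1 r r.2.1
    obtain ⟨_, _, _, hr⟩ := hT r (Or.inl rfl)
    obtain ⟨k, hk, a, ha, h1, h2⟩ := (hYZ r).exists_index h₀ hF hx he hf hr (hv r r.2.1)
    rw [h1, h2]; simp [hF.self, ha]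
  let R : Setoid A :=
    { r := fun r s => ∃ a : K, a ≠ 0 ∧ Y s = a • Y r ∧ Z s = a⁻¹ • Z r
      iseqv :=
        { refl := fun r => ⟨1, one_ne_zero, by simp, by simp⟩
          symm := by
            rintro r s ⟨a, ha, h1, h2⟩
            exact ⟨a⁻¹, inv_ne_zero ha, by rw [h1, smul_smul, inv_mul_cancel₀ ha, one_smul],
              by rw [h2, smul_smul, inv_inv, mul_inv_cancel₀ ha, one_smul]⟩
          trans := by
            rintro r s t ⟨a, ha, h1, h2⟩ ⟨b, hb, h3, h4⟩
            exact ⟨b * a, mul_ne_zero hb ha, by rw [h3, h1, smul_smul],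
              by rw [h4, h2, smul_smul, mul_inv]⟩ } }
  -- The global frame consists of the base vertex, as `none`, and one outer end for each
  -- proportionality class.
  let E : Option (Quotient R) → V := fun o => o.elim e₀ fun q => Y q.out
  let F : Option (Quotient R) → Dual K V := fun o => o.elim f₀ fun q => Z q.out
  have hEF : IsFrame E F := by
    constructor
    · rintro (_ | q)
      · exact h₀
      · exact hself _
    · rintro (_ | q) (_ | q') hne
      · exact absurd rfl hne
      · exact (hYZ q'.out).vec_left
      · exact (hYZ q.out).covec_left
      · refine (hpair q.out q'.out).resolve_left fun h => hne ?_
        rw [← Quotient.out_eq q, ← Quotient.out_eq q', Quotient.sound (s := R) h]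
  have hrep : ∀ r : A, ∃ a : K, a ≠ 0 ∧ Y r = a • E (some ⟦r⟧) ∧ Z r = a⁻¹ • F (some ⟦r⟧) :=
    fun r => Quotient.mk_out (s := R) r
  have hedge : ∀ t ∈ T, ∃ i j c, IsEdge E F i j c t := by
    intro t ht
    by_cases htA : ∃ y z, IsSpoke e₀ f₀ t y z
    · let r : A := ⟨t, ht, htA⟩
      obtain ⟨a, ha, h1, h2⟩ := hrep r
      refine ⟨none, some ⟦r⟧, a, by simp, ha, fun x => ?_⟩
      have := (hYZ r).apply x
      rw [h1, h2] at this
      exact this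
    have hinc : ∀ {d : ℕ} {e : Fin d → V} {f : Fin d → Dual K V} {m k : Fin d} {x c : K},
        IsFrame e f → x ≠ 0 → e m = x • e₀ → f m = x⁻¹ • f₀ → ¬ IsEdge e f m k c t :=
      fun hF hx he hf hk => htA ⟨_, _, hk.isSpoke hF hx he hf⟩
    have he₀ : e₀ ≠ 0 := by rintro rfl; simp at h₀
    -- For an edge `t` away from the base vertex, density gives a spoke `r` whose vector is not
    -- killed by `φ t`. As `t` misses the base vertex, it passes through the outer end of `r`.
    obtain ⟨r', hr', h1, h2⟩ := hv.dense hd he₀ (hv t ht).covec_ne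
    let r : A := ⟨r', hr', hloc.exists_isSpoke hv hr' h1⟩
    have hframe : ∀ {d : ℕ} {e : Fin d → V} {f : Fin d → Dual K V} {m : Fin d} {x : K},
        IsFrame e f → x ≠ 0 → e m = x • e₀ → f m = x⁻¹ • f₀ →
        (∃ i j c, IsEdge e f i j c t) → (∃ i j c, IsEdge e f i j c r.1) →
        ∃ (k l : Fin d) (a c : K), k ≠ m ∧ l ≠ m ∧ a ≠ 0 ∧ Y r = a • e k ∧ Z r = a⁻¹ • f k ∧
          IsEdge e f k l c t := by
      rintro d e f m x hF hx he hf ⟨i, j, c, hij⟩ ⟨i', j', c', hij'⟩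
      obtain ⟨k, hk, a, ha, q1, q2⟩ := (hYZ r).exists_index h₀ hF hx he hf hij' (hv r r.2.1)
      have htm : φ t (e m) = 0 := by
        by_contra hne
        obtain ⟨_, _, h⟩ := hij.exists_left_of_vec hF (hv t ht) hne
        exact hinc hF hx he hf h
      obtain ⟨α, hα, b1, b2⟩ := (hv r' hr').exists_smul (hYZ r).apply
      have htk : φ t (e k) ≠ 0 := by
        intro h0
        have h3 : φ t (e₀ + Y r) = 0 := by
          have h4 : x • φ t e₀ = 0 := by rw [← map_smul, ← he, htm]
          rw [map_add, q1, map_smul, h0, smul_zero, add_zero]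
          exact (smul_eq_zero.1 h4).resolve_left hx
        rw [b1, map_smul] at h3
        exact h2 ((smul_eq_zero.1 h3).resolve_left hα)
      obtain ⟨l, c'', hl⟩ := hij.exists_left_of_vec hF (hv t ht) htk
      refine ⟨k, l, a, c'', hk, ?_, ha, q1, q2, hl⟩
      rintro rfl
      exact hinc hF hx he hf hl.symm
    obtain ⟨d, e, f, m, hF, ⟨x, hx, he, hf⟩, hT⟩ := hloc t ht r r.2.1 r r.2.1
    obtain ⟨k, l, a, c, hk, hl, ha, q1, q2, hkl⟩ := hframe hF hx he hf (hT t (Or.inl rfl))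
      (hT r (Or.inr (Or.inl rfl)))
    have hfl : f l ≠ 0 := fun h0 => by
      have := hF.self l
      simp [h0] at this
    -- A second spoke `w` is chosen to end at the other vertex `l` of `t`. A frame containing `t`,
    -- `r` and `w` together confirms this, which is why triples are needed.
    obtain ⟨w', hw', h3, h4⟩ := hv.dense hd he₀ hfl
    let w : A := ⟨w', hw', hloc.exists_isSpoke hv hw' h3⟩
    obtain ⟨d', e', f', m', hF', ⟨x', hx', he', hf'⟩, hT'⟩ := hloc t ht r r.2.1 w w.2.1
    obtain ⟨k', l', a', c', hk', hl', ha', q1', q2', hkl'⟩ := hframe hF' hx' he' hf'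
      (hT' t (Or.inl rfl)) (hT' r (Or.inr (Or.inl rfl)))
    obtain ⟨_, _, _, hw⟩ := hT' w (Or.inr (Or.inr rfl))
    obtain ⟨p, hp, b, hb, s1, s2⟩ := (hYZ w).exists_index h₀ hF' hx' he' hf' hw (hv w w.2.1)
    have ek : e k = a⁻¹ • Y r := by rw [q1, smul_smul, inv_mul_cancel₀ ha, one_smul]
    have fk : f k = (a⁻¹)⁻¹ • Z r := by
      rw [q2, smul_smul, inv_inv, mul_inv_cancel₀ ha, one_smul]
    have ek' : e' k' = a'⁻¹ • Y r := by rw [q1', smul_smul, inv_mul_cancel₀ ha', one_smul]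
    have fk' : f' k' = (a'⁻¹)⁻¹ • Z r := by
      rw [q2', smul_smul, inv_inv, mul_inv_cancel₀ ha', one_smul]
    -- Relative to the outer end of `r`, the edge `t` is itself a spoke, so its far ends in the two
    -- frames agree up to scaling.
    have hsp := (hkl.isSpoke hF (inv_ne_zero ha) ek fk).unique (hself r)
      (hkl'.isSpoke hF' (inv_ne_zero ha') ek' fk')
    have hfl' : f' l' (v w') ≠ 0 := by
      intro h0
      have h5 := LinearMap.congr_fun hsp.2 (v w')
      simp only [LinearMap.smul_apply, h0, smul_zero, smul_eq_zero] at h5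
      exact h5.elim (mul_ne_zero (inv_ne_zero ha) (inv_ne_zero hkl.gain_ne)) h4
    have hpl : l' = p := by
      by_contra hne
      obtain ⟨α, hα, b1, b2⟩ := (hv w' hw').exists_smul (hYZ w).apply
      have h5 : f' l' (e₀ + Y w) = 0 := by
        have h6 : x' • f' l' e₀ = 0 := by rw [← map_smul, ← he', hF'.ne _ _ hl']
        rw [map_add, s1, map_smul, hF'.ne _ _ hne, smul_zero, add_zero]
        exact (smul_eq_zero.1 h6).resolve_left hx'
      rw [b1, map_smul] at h5
      exact hfl' ((smul_eq_zero.1 h5).resolve_left hα)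
    subst hpl
    obtain ⟨α, hα, u1, u2⟩ := hrep r
    obtain ⟨β, hβ, u3, u4⟩ := hrep w
    have hne : (some ⟦r⟧ : Option (Quotient R)) ≠ some ⟦w⟧ := by
      intro h
      rw [h] at u1 u2
      have h5 : Z r (Y w) ≠ 0 := by
        rw [u2, u3]; simp [hEF.self, hα, hβ]
      apply h5
      rw [q2', s1]
      simp [hF'.ne _ _ hkl'.index_ne]
    refine ⟨some ⟦r⟧, some ⟦w⟧, _, hkl'.of_smul (a := a'⁻¹ * α) (b := b⁻¹ * β) hne
      (mul_ne_zero (inv_ne_zero ha') hα) (mul_ne_zero (inv_ne_zero hb) hβ) ?_ ?_ ?_ ?_⟩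
    · rw [ek', u1, smul_smul]
    · rw [fk', u2, smul_smul, mul_inv]
    · rw [mul_smul, ← u3, s1, smul_smul, inv_mul_cancel₀ hb, one_smul]
    · rw [mul_inv, mul_smul, ← u4, s2, smul_smul, inv_inv, mul_inv_cancel₀ hb, one_smul]
  have hspan : ⊤ ≤ Submodule.span K (Set.range E) := by
    rw [← hv.span_eq_top hd hV, hv.vecSpan_eq, Submodule.span_le]
    rintro _ ⟨t, ht, rfl⟩
    obtain ⟨i, j, c, h⟩ := hedge t ht
    obtain ⟨α, hα, h1, h2⟩ := (hv t ht).exists_smul h.apply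
    have h3 : v t = α⁻¹ • (E i + c • E j) := by
      rw [h1, smul_smul, inv_mul_cancel₀ hα, one_smul]
    rw [h3]
    exact Submodule.smul_mem _ _ (Submodule.add_mem _ (Submodule.subset_span ⟨i, rfl⟩)
      (Submodule.smul_mem _ _ (Submodule.subset_span ⟨j, rfl⟩)))
  obtain ⟨n, b, σ, hb⟩ := exists_basis_of_isFrame hEF hspan
  refine ⟨n, b, fun t ht => ?_⟩
  obtain ⟨i, j, c, h⟩ := hedge t ht
  exact ⟨σ i, σ j, _, h.of_smul (a := 1) (b := 1) (fun h' => h.index_ne (σ.injective h'))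
    one_ne_zero one_ne_zero (by simp [(hb i).1]) (by simp [(hb i).2]) (by simp [(hb j).1])
    (by simp [(hb j).2])⟩

end Gluing

end TransvectionGroups

/-! ### Products of edges and the gain group -/

namespace TransvectionGroups

variable {K V : Type*} [Field K] [AddCommGroup V] [Module K V] {ι κ : Type*}
  {e : ι → V} {f : ι → Dual K V} {i j k l : ι} {c c' : K} {s t : V ≃ₗ[K] V}

theorem IsEdge.of_apply [CharP K 2] (hF : IsFrame e f) (hij : i ≠ j) (hc : c ≠ 0)
    (h1 : t (e i) = c • e j) (h2 : t (e j) = c⁻¹ • e i)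
    (h3 : ∀ x, f i x = 0 → f j x = 0 → t x = x) : IsEdge e f i j c t := by
  refine ⟨hij, hc, fun x => ?_⟩
  have h4 := h3 (x - f i x • e i - f j x • e j)
    (by simp [hF.self, hF.ne i j hij]) (by simp [hF.self, hF.ne j i hij.symm])
  simp only [map_sub, map_smul, h1, h2] at h4
  have h5 : t x = x - f i x • e i - f j x • e j + f i x • c • e j + f j x • c⁻¹ • e i := by
    rw [← h4]; abel
  have hneg : ∀ y : V, -y = y := fun y => by
    rw [← neg_one_smul K y, CharTwo.neg_eq, one_smul]
  rw [h5, sub_eq_add_neg, sub_eq_add_neg, hneg, hneg]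
  simp only [LinearMap.add_apply, LinearMap.smul_apply, smul_eq_mul, smul_add, add_smul,
    smul_smul]
  rw [add_mul, mul_right_comm, inv_mul_cancel₀ hc, one_mul, mul_comm (f j x), add_smul]
  abel

namespace IsEdge

theorem apply_of_covec_eq_zero (h : IsEdge e f i j c t) {x : V} (hi : f i x = 0)
    (hj : f j x = 0) : t x = x := by
  rw [h.apply]; simp [hi, hj]

theorem covec_of_ne (hF : IsFrame e f) (h : IsEdge e f i j c t) (hi : k ≠ i) (hj : k ≠ j) (x : V) :
    f k (t x) = f k x := by
  rw [h.apply]; simp [hF.ne k i hi, hF.ne k j hj]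

theorem mul_self [CharP K 2] (hF : IsFrame e f) (h : IsEdge e f i j c t) : t * t = 1 := by
  have ha := h.along hF
  ext x
  rw [LinearEquiv.mul_apply, LinearEquiv.coe_one, id_eq, ha.apply (t x)]
  rw [ha.apply x, map_add, map_smul, ha.apply_self, smul_zero, add_zero, add_assoc, ← add_smul,
    CharTwo.add_self_eq_zero, zero_smul, add_zero]

/-- Conjugation composes adjacent edges and multiplies gains, provided the endpoints differ. Closed
walks have to be handled by the product of three parallel edges in `mul_mul`. -/
theorem conj [CharP K 2] (hF : IsFrame e f) (hs : IsEdge e f i j c s) (ht : IsEdge e f j k c' t)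
    (hik : i ≠ k) : IsEdge e f i k (c * c') (t * s * t) := by
  have hij := hs.index_ne
  have hjk := ht.index_ne
  refine IsEdge.of_apply hF hik (mul_ne_zero hs.gain_ne ht.gain_ne) ?_ ?_ ?_
  · rw [LinearEquiv.mul_apply, LinearEquiv.mul_apply, ht.apply_of_ne hF hij hik,
      hs.apply_left hF, map_smul, ht.apply_left hF, smul_smul]
  · rw [LinearEquiv.mul_apply, LinearEquiv.mul_apply, ht.apply_right hF, map_smul,
      hs.apply_right hF, map_smul, map_smul, ht.apply_of_ne hF hij hik, smul_smul, mul_inv,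
      mul_comm]
  · intro x hi hk
    have h1 : s (t x) = t x := hs.apply_of_covec_eq_zero
      (by rw [ht.covec_of_ne hF hij hik, hi]) (by rw [ht.covec_left hF, hk, mul_zero])
    rw [LinearEquiv.mul_apply, LinearEquiv.mul_apply, h1, ← LinearEquiv.mul_apply,
      ht.mul_self hF]
    rfl

theorem mul_mul [CharP K 2] {r : V ≃ₗ[K] V} {c'' : K} (hF : IsFrame e f) (hr : IsEdge e f i j c r)
    (hs : IsEdge e f i j c' s) (ht : IsEdge e f i j c'' t) :
    IsEdge e f i j (c * c'⁻¹ * c'') (r * s * t) := by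
  refine IsEdge.of_apply hF hr.index_ne
    (mul_ne_zero (mul_ne_zero hr.gain_ne (inv_ne_zero hs.gain_ne)) ht.gain_ne) ?_ ?_ ?_
  · rw [LinearEquiv.mul_apply, LinearEquiv.mul_apply, ht.apply_left hF, map_smul,
      hs.apply_right hF, map_smul, map_smul, hr.apply_left hF, smul_smul, smul_smul]
    congr 1; ring
  · rw [LinearEquiv.mul_apply, LinearEquiv.mul_apply, ht.apply_right hF, map_smul,
      hs.apply_left hF, map_smul, map_smul, hr.apply_right hF, smul_smul, smul_smul]
    congr 1; simp only [mul_inv, inv_inv]; ring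
  · intro x hi hj
    rw [LinearEquiv.mul_apply, LinearEquiv.mul_apply, ht.apply_of_covec_eq_zero hi hj,
      hs.apply_of_covec_eq_zero hi hj, hr.apply_of_covec_eq_zero hi hj]

end IsEdge

/-- `G` contains the edge from `i` to `j` with gain `c`. -/
def ContainsEdge (G : Subgroup (V ≃ₗ[K] V)) (e : ι → V) (f : ι → Dual K V) (i j : ι) (c : K) :
    Prop :=
  ∃ g ∈ G, IsEdge e f i j c g

section Gain

variable {G : Subgroup (V ≃ₗ[K] V)} {T : Set (V ≃ₗ[K] V)}

theorem ContainsEdge.symm (h : ContainsEdge G e f i j c) : ContainsEdge G e f j i c⁻¹ := by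
  obtain ⟨g, hg, h⟩ := h
  exact ⟨g, hg, h.symm⟩

theorem ContainsEdge.trans [CharP K 2] (hF : IsFrame e f) (h : ContainsEdge G e f i j c)
    (h' : ContainsEdge G e f j k c') (hik : i ≠ k) : ContainsEdge G e f i k (c * c') := by
  obtain ⟨g, hg, h⟩ := h
  obtain ⟨g', hg', h'⟩ := h'
  exact ⟨g' * g * g', G.mul_mem (G.mul_mem hg' hg) hg', h.conj hF h' hik⟩

/-- Edges are involutions, so no step for inverses is needed. -/
theorem closure_induction_of_edges [CharP K 2] (hF : IsFrame e f)
    (hT : ∀ t ∈ T, ∃ i j c, IsEdge e f i j c t) {P : (V ≃ₗ[K] V) → Prop} (h1 : P 1)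
    (hmul : ∀ t ∈ T, ∀ g ∈ Subgroup.closure T, P g → P (t * g)) {g : V ≃ₗ[K] V}
    (hg : g ∈ Subgroup.closure T) : P g := by
  induction hg using Subgroup.closure_induction_left with
  | one => exact h1
  | mul_left x hx y hy ih => exact hmul x hx y hy ih
  | inv_mul_cancel x hx y hy ih =>
    obtain ⟨i, j, c, h⟩ := hT x hx
    rw [inv_eq_of_mul_eq_one_left (h.mul_self hF)]
    exact hmul x hx y hy ih

theorem IsEdge.exists_apply_eq [CharP K 2] (hF : IsFrame e f) (h : IsEdge e f i j c t) (k : ι) :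
    t (e k) = e k ∨ ∃ l c', IsEdge e f k l c' t ∧ t (e k) = c' • e l := by
  by_cases hi : k = i
  · subst hi; exact Or.inr ⟨_, _, h, h.apply_left hF⟩
  by_cases hj : k = j
  · subst hj; exact Or.inr ⟨_, _, h.symm, h.apply_right hF⟩
  · exact Or.inl (h.apply_of_ne hF hi hj)

theorem exists_apply_eq_of_edges [CharP K 2] (hF : IsFrame e f)
    (hT : ∀ t ∈ T, ∃ i j c, IsEdge e f i j c t) {g : V ≃ₗ[K] V} (hg : g ∈ Subgroup.closure T)
    (k : ι) : ∃ l, ∃ c : K, c ≠ 0 ∧ g (e k) = c • e l := by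
  refine closure_induction_of_edges hF hT
    (P := fun g => ∃ l, ∃ c : K, c ≠ 0 ∧ g (e k) = c • e l) ?_ ?_ hg
  · exact ⟨k, 1, one_ne_zero, by simp⟩
  · intro t ht g hg ih
    obtain ⟨l, c, hc, h⟩ := ih
    obtain ⟨_, _, _, hij⟩ := hT t ht
    rcases hij.exists_apply_eq hF l with h1 | ⟨m, c', h1, h2⟩
    · exact ⟨l, c, hc, by rw [LinearEquiv.mul_apply, h, map_smul, h1]⟩
    · exact ⟨m, c * c', mul_ne_zero hc h1.gain_ne, by
        rw [LinearEquiv.mul_apply, h, map_smul, h2, smul_smul]⟩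

/-- The gain of a walk from `o` given by an element of the group is the gain of an edge in the
group, or, for a closed walk, may be multiplied to the gain of any edge at `o`. -/
theorem exists_gain_of_mem_closure [CharP K 2] (hF : IsFrame e f)
    (hT : ∀ t ∈ T, ∃ i j c, IsEdge e f i j c t) (o : ι) {g : V ≃ₗ[K] V}
    (hg : g ∈ Subgroup.closure T) : ∃ (j : ι) (c : K), g (e o) = c • e j ∧
      (j ≠ o → ContainsEdge (Subgroup.closure T) e f o j c) ∧
      (j = o → ∀ k, k ≠ o → ∀ c', ContainsEdge (Subgroup.closure T) e f o k c' →
        ContainsEdge (Subgroup.closure T) e f o k (c * c')) := by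
  refine closure_induction_of_edges hF hT (P := fun g => ∃ (j : ι) (c : K), g (e o) = c • e j ∧
    (j ≠ o → ContainsEdge (Subgroup.closure T) e f o j c) ∧
    (j = o → ∀ k, k ≠ o → ∀ c', ContainsEdge (Subgroup.closure T) e f o k c' →
      ContainsEdge (Subgroup.closure T) e f o k (c * c'))) ?_ ?_ hg
  · exact ⟨o, 1, by simp, fun h => absurd rfl h, fun _ k _ c' h => by rwa [one_mul]⟩
  · intro t ht g hg ih
    obtain ⟨j, c, h, hne, heq⟩ := ih
    obtain ⟨_, _, _, hij⟩ := hT t ht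
    rcases hij.exists_apply_eq hF j with h1 | ⟨l, x, h1, h2⟩
    · exact ⟨j, c, by rw [LinearEquiv.mul_apply, h, map_smul, h1], hne, heq⟩
    have hjl := h1.index_ne
    have htG : ContainsEdge (Subgroup.closure T) e f j l x :=
      ⟨t, Subgroup.subset_closure ht, h1⟩
    refine ⟨l, c * x, by rw [LinearEquiv.mul_apply, h, map_smul, h2, smul_smul], ?_, ?_⟩
    · intro hlo
      by_cases hjo : j = o
      · subst hjo
        exact heq rfl l hlo x htG
      · exact (hne hjo).trans hF htG (Ne.symm hlo)
    · rintro rfl k hk c' hkc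
      have hoj := hne hjl
      -- The walk has returned to its base point, where conjugation gives no edge. Its gain is
      -- transferred to the edge towards `k`: by three parallel edges if `k = j`, and otherwise by
      -- composing from `k` through the base point and `j` back to it.
      by_cases hkj : k = j
      · subst hkj
        obtain ⟨g₁, hg₁, e₁⟩ := hoj
        obtain ⟨g₂, hg₂, e₂⟩ := htG.symm
        obtain ⟨g₃, hg₃, e₃⟩ := hkc
        refine ⟨g₁ * g₂ * g₃, mul_mem (mul_mem hg₁ hg₂) hg₃, ?_⟩
        have := e₁.mul_mul hF e₂ e₃
        rwa [inv_inv] at this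
      · have h3 := (hkc.symm.trans hF htG.symm hkj).trans hF hoj.symm hk
        have h4 := h3.symm
        convert h4 using 1
        simp only [mul_inv, inv_inv]
        ring

/-- A group generated by edges that is transitive on the lines of the frame: after rescaling the
frame, the gains form a subgroup `H` of `Kˣ`, and the group contains all edges with gain in `H`. -/
theorem exists_gain_subgroup [CharP K 2] (hF : IsFrame e f)
    (hT : ∀ t ∈ T, ∃ i j c, IsEdge e f i j c t) (o : ι)
    (htrans : ∀ i, ∃ g ∈ Subgroup.closure T, ∃ c : K, c ≠ 0 ∧ g (e o) = c • e i) :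
    ∃ (e' : ι → V) (f' : ι → Dual K V) (H : Subgroup Kˣ), IsFrame e' f' ∧
      (∀ i, ∃ x : K, x ≠ 0 ∧ e' i = x • e i ∧ f' i = x⁻¹ • f i) ∧
      (∀ g ∈ Subgroup.closure T, ∀ i, ∃ j, ∃ h ∈ H, g (e' i) = (h : K) • e' j) ∧
      (∀ i j, i ≠ j → ∀ h ∈ H, ContainsEdge (Subgroup.closure T) e' f' i j (h : K)) ∧
      ∀ t ∈ T, ∃ i j, ∃ h ∈ H, IsEdge e' f' i j (h : K) t := by
  classical
  set G := Subgroup.closure T with hG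
  have htrans' : ∀ i, ∃ g ∈ G, ∃ c : K, c ≠ 0 ∧ g (e o) = c • e i ∧ (i = o → c = 1) := by
    intro i
    by_cases hi : i = o
    · exact ⟨1, one_mem _, 1, one_ne_zero, by simp [hi], fun _ => rfl⟩
    · obtain ⟨g, hg, c, hc, h⟩ := htrans i
      exact ⟨g, hg, c, hc, h, fun h => absurd h hi⟩
  choose γ hγG x hx0 hγ hxo using htrans'
  have hxo' : x o = 1 := hxo o rfl
  let e' : ι → V := fun i => x i • e i
  let f' : ι → Dual K V := fun i => (x i)⁻¹ • f i
  have hF' : IsFrame e' f' := by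
    refine ⟨fun i => ?_, fun i j hij => ?_⟩
    · simp [e', f', hF.self, hx0]
    · simp [e', f', hF.ne i j hij]
  have heo : e' o = e o := by simp [e', hxo']
  have hinvapp : ∀ (g : V ≃ₗ[K] V) (y z : V), g y = z → g⁻¹ z = y := fun g y z h => by
    rw [← h]; exact g.symm_apply_apply y
  -- `H` collects the gains of closed walks at `o`. Scaling each `e i` by the gain `x i` of a chosen
  -- walk from `o` makes all gains lie in `H`.
  let H : Subgroup Kˣ :=
    { carrier := {h | ∃ g ∈ G, g (e o) = (h : K) • e o}
      one_mem' := ⟨1, one_mem _, by simp⟩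
      mul_mem' := by
        rintro a b ⟨g, hg, h1⟩ ⟨g', hg', h2⟩
        exact ⟨g * g', mul_mem hg hg', by
          rw [LinearEquiv.mul_apply, h2, map_smul, h1, smul_smul, Units.val_mul, mul_comm]⟩
      inv_mem' := by
        rintro a ⟨g, hg, h1⟩
        refine ⟨g⁻¹, inv_mem hg, hinvapp g _ _ ?_⟩
        rw [map_smul, h1, smul_smul, Units.inv_mul, one_smul] }
  have hmon : ∀ g ∈ G, ∀ i, ∃ j, ∃ h ∈ H, g (e' i) = (h : K) • e' j := by
    intro g hg i
    obtain ⟨j, c, hc, h⟩ := exists_apply_eq_of_edges hF hT (mul_mem hg (hγG i)) o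
    have h1 : g (e' i) = (c * (x j)⁻¹) • e' j := by
      simp only [e']
      rw [← hγ, ← LinearEquiv.mul_apply, h, smul_smul, mul_assoc, inv_mul_cancel₀ (hx0 j), mul_one]
    refine ⟨j, Units.mk0 (c * (x j)⁻¹) (mul_ne_zero hc (inv_ne_zero (hx0 j))),
      ⟨(γ j)⁻¹ * (g * γ i), mul_mem (inv_mem (hγG j)) (mul_mem hg (hγG i)), ?_⟩, h1⟩
    rw [LinearEquiv.mul_apply, h]
    apply hinvapp
    rw [map_smul, hγ, Units.val_mk0, smul_smul, mul_assoc, inv_mul_cancel₀ (hx0 j), mul_one]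
  have hedge : ∀ {i j c} {g : V ≃ₗ[K] V}, IsEdge e f i j c g →
      IsEdge e' f' i j (x i * (x j)⁻¹ * c) g := by
    intro i j c g h
    have h1 : ∀ i, e i = (x i)⁻¹ • e' i := fun i => by
      simp [e', smul_smul, inv_mul_cancel₀ (hx0 i)]
    have h2 : ∀ i, f i = ((x i)⁻¹)⁻¹ • f' i := fun i => by
      simp [f', smul_smul, mul_inv_cancel₀ (hx0 i)]
    have := h.of_smul h.index_ne (inv_ne_zero (hx0 i)) (inv_ne_zero (hx0 j)) (h1 i) (h2 i) (h1 j)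
      (h2 j)
    rwa [inv_inv] at this
  have hrescale : ∀ {i j c}, ContainsEdge G e f i j c →
      ContainsEdge G e' f' i j (x i * (x j)⁻¹ * c) := by
    rintro i j c ⟨g, hg, h⟩
    exact ⟨g, hg, hedge h⟩
  have hvec : ∀ {c c' : K} {j j' : ι}, c ≠ 0 → c • e j = c' • e j' → j = j' ∧ c = c' := by
    intro c c' j j' hc h
    have h1 : j = j' := hF.index_eq h (by simp [hF.self, hc])
    subst h1
    exact ⟨rfl, smul_left_injective K (hF.vec_ne j) h⟩
  have hbase : ∀ i, i ≠ o → ContainsEdge G e f o i (x i) := by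
    intro i hi
    obtain ⟨j, c, h1, h2, -⟩ := exists_gain_of_mem_closure hF hT o (hγG i)
    rw [hγ] at h1
    obtain ⟨rfl, rfl⟩ := hvec (hx0 i) h1
    exact h2 hi
  have hstar : ∀ i, i ≠ o → ∀ h ∈ H, ContainsEdge G e' f' o i (h : K) := by
    rintro i hi h ⟨g, hg, hgo⟩
    obtain ⟨j, c, h1, -, h2⟩ := exists_gain_of_mem_closure hF hT o hg
    rw [hgo] at h1
    obtain ⟨rfl, rfl⟩ := hvec h.ne_zero h1
    have h3 := hrescale (h2 rfl i hi _ (hbase i hi))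
    have h4 : x o * (x i)⁻¹ * ((h : K) * x i) = h := by
      rw [hxo', one_mul, mul_comm (h : K), ← mul_assoc, inv_mul_cancel₀ (hx0 i), one_mul]
    rwa [h4] at h3
  refine ⟨e', f', H, hF', fun i => ⟨x i, hx0 i, rfl, rfl⟩, hmon, fun i j hij h hh => ?_,
    fun t ht => ?_⟩
  rotate_left
  · obtain ⟨i, j, c, h⟩ := hT t ht
    have h1 := hedge h
    obtain ⟨k, y, hy, h2⟩ := hmon t (Subgroup.subset_closure ht) i
    have h3 := h1.apply_left hF'
    rw [h2] at h3
    have h4 : k = j := hF'.index_eq h3 (by simp [hF'.self])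
    subst h4
    have h5 : (y : K) = _ := smul_left_injective K (hF'.vec_ne k) h3
    exact ⟨i, k, y, hy, h5 ▸ h1⟩
  by_cases hi : i = o
  · subst hi
    exact hstar j hij.symm h hh
  by_cases hj : j = o
  · subst hj
    have := (hstar i hi h⁻¹ (inv_mem hh)).symm
    simpa using this
  -- Away from `o`, an edge of gain `h` is composed from one of gain `1` into `o` and one of gain
  -- `h` out of it.
  · have h1 := (hstar i hi 1 (one_mem _)).symm.trans hF' (hstar j hj h hh) hij
    simpa using h1

end Gain

/-! ### Groups containing all edges with gains in `H` -/

section MonomialType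

variable {n : ℕ}

/-- A group containing all edges with gains in `H` contains all monomial elements of determinant
one with coefficients in `H`. -/
theorem mem_of_containsEdge [FiniteDimensional K V] [CharP K 2] {G : Subgroup (V ≃ₗ[K] V)}
    {b : Basis (Fin n) K V} {H : Subgroup Kˣ}
    (hG : ∀ i j, i ≠ j → ∀ h ∈ H, ContainsEdge G b b.coord i j (h : K)) {g : V ≃ₗ[K] V}
    (hdet : LinearMap.det (g : V →ₗ[K] V) = 1) {σ : Equiv.Perm (Fin n)} {c : Fin n → Kˣ}
    (hc : ∀ i, c i ∈ H) (hg : ∀ i, g (b i) = (c i : K) • b (σ i)) : g ∈ G := by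
  classical
  have hF := isFrame_basis b
  have hperm : ∀ τ : Equiv.Perm (Fin n), ∃ p ∈ G, LinearMap.det (p : V →ₗ[K] V) = 1 ∧
      ∀ i, p (b i) = b (τ i) := by
    intro τ
    induction τ using Equiv.Perm.swap_induction_on with
    | one => exact ⟨1, one_mem _, by simp, fun i => rfl⟩
    | swap_mul τ i j hij ih =>
      obtain ⟨p, hp, hpd, hpb⟩ := ih
      obtain ⟨t, ht, hte⟩ := hG i j hij 1 (one_mem _)
      rw [Units.val_one] at hte
      refine ⟨t * p, mul_mem ht hp, ?_, fun k => ?_⟩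
      · have : ((t * p : V ≃ₗ[K] V) : V →ₗ[K] V) = (t : V →ₗ[K] V) * (p : V →ₗ[K] V) := rfl
        rw [this, map_mul, hpd, (hte.along hF).det_eq_one, one_mul]
      · rw [LinearEquiv.mul_apply, hpb, Equiv.Perm.mul_apply]
        by_cases h1 : τ k = i
        · rw [h1, Equiv.swap_apply_left, hte.apply_left hF, one_smul]
        by_cases h2 : τ k = j
        · rw [h2, Equiv.swap_apply_right, hte.apply_right hF, inv_one, one_smul]
        · rw [Equiv.swap_apply_of_ne_of_ne h1 h2, hte.apply_of_ne hF h1 h2]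
  -- Edges of gain `1` generate the permutation matrices, so only a diagonal element of determinant
  -- one remains.
  obtain ⟨p, hp, hpd, hpb⟩ := hperm σ⁻¹
  suffices hpg : p * g ∈ G by
    have := mul_mem (inv_mem hp) hpg
    rwa [inv_mul_cancel_left] at this
  have hpgb : ∀ i, (p * g) (b i) = (c i : K) • b i := fun i => by
    rw [LinearEquiv.mul_apply, hg, map_smul, hpb, Equiv.Perm.inv_def, Equiv.symm_apply_apply]
  have hprod : ∏ i, c i = 1 := by
    have h1 : LinearMap.det ((p * g : V ≃ₗ[K] V) : V →ₗ[K] V) = 1 := by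
      have : ((p * g : V ≃ₗ[K] V) : V →ₗ[K] V) = (p : V →ₗ[K] V) * (g : V →ₗ[K] V) := rfl
      rw [this, map_mul, hpd, hdet, one_mul]
    have h2 : LinearMap.toMatrix b b ((p * g : V ≃ₗ[K] V) : V →ₗ[K] V) =
        Matrix.diagonal fun i => (c i : K) := by
      ext i j
      rw [LinearMap.toMatrix_apply, LinearEquiv.coe_coe, hpgb, map_smul, Finsupp.smul_apply,
        Basis.repr_self, Matrix.diagonal_apply, Finsupp.single_apply]
      by_cases hij : i = j
      · subst hij; simp
      · simp [hij, Ne.symm hij]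
    rw [← LinearMap.det_toMatrix b, h2, Matrix.det_diagonal] at h1
    ext
    rw [Units.coe_prod, h1, Units.val_one]
  rcases Nat.eq_zero_or_pos n with rfl | hn
  · have : p * g = 1 := LinearEquiv.toLinearMap_injective (b.ext fun i => i.elim0)
    rw [this]; exact one_mem _
  let o : Fin n := ⟨0, hn⟩
  -- Two parallel edges at `o` and `k` with gains `c k` and `1` multiply to a diagonal element with
  -- entry `c k` at `k` and its inverse at `o`. The inverses accumulate at `o`, where determinant
  -- one makes the entry correct.
  have hdiag : ∀ s : Finset (Fin n), o ∉ s → ∃ q ∈ G, (∀ i ∈ s, q (b i) = (c i : K) • b i) ∧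
      (∀ i, i ∉ s → i ≠ o → q (b i) = b i) ∧
      q (b o) = (((∏ i ∈ s, c i)⁻¹ : Kˣ) : K) • b o := by
    intro s
    induction s using Finset.induction_on with
    | empty => exact fun _ => ⟨1, one_mem _, by simp, fun i _ _ => rfl, by simp⟩
    | insert k s hk ih =>
      intro hos
      rw [Finset.mem_insert, not_or] at hos
      obtain ⟨q, hq, h1, h2, h3⟩ := ih hos.2
      obtain ⟨t₁, ht₁, e₁⟩ := hG o k hos.1 (c k) (hc k)
      obtain ⟨t₂, ht₂, e₂⟩ := hG o k hos.1 1 (one_mem _)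
      rw [Units.val_one] at e₂
      have hko := Ne.symm hos.1
      refine ⟨t₁ * t₂ * q, mul_mem (mul_mem ht₁ ht₂) hq, ?_, ?_, ?_⟩
      · intro i hi
        rw [LinearEquiv.mul_apply, LinearEquiv.mul_apply]
        rcases Finset.mem_insert.1 hi with rfl | hi
        · rw [h2 _ hk hko, e₂.apply_right hF, inv_one, one_smul, e₁.apply_left hF]
        · have hik : i ≠ k := ne_of_mem_of_not_mem hi hk
          have hio : i ≠ o := ne_of_mem_of_not_mem hi hos.2
          rw [h1 i hi, map_smul, map_smul, e₂.apply_of_ne hF hio hik, e₁.apply_of_ne hF hio hik]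
      · intro i hi hio
        rw [Finset.mem_insert, not_or] at hi
        rw [LinearEquiv.mul_apply, LinearEquiv.mul_apply, h2 i hi.2 hio,
          e₂.apply_of_ne hF hio hi.1, e₁.apply_of_ne hF hio hi.1]
      · rw [LinearEquiv.mul_apply, LinearEquiv.mul_apply, h3, map_smul, map_smul,
          e₂.apply_left hF, one_smul, e₁.apply_right hF, smul_smul, Finset.prod_insert hk,
          mul_inv_rev, Units.val_mul, Units.val_inv_eq_inv_val (c k)]
  obtain ⟨q, hq, h1, -, h3⟩ := hdiag (Finset.univ.erase o) (Finset.notMem_erase _ _)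
  have : p * g = q := by
    apply LinearEquiv.toLinearMap_injective
    refine b.ext fun i => ?_
    rw [LinearEquiv.coe_coe, LinearEquiv.coe_coe, hpgb]
    by_cases hi : i = o
    · subst hi
      rw [h3]
      congr 2
      rw [eq_inv_iff_mul_eq_one, Finset.mul_prod_erase _ _ (Finset.mem_univ _), hprod]
    · rw [h1 i (Finset.mem_erase.2 ⟨hi, Finset.mem_univ _⟩)]
  rw [this]; exact hq

/-- Since `Kˣ` is cyclic, `H` is exactly the group of `|H|`-th roots of unity, so `a = |H|` serves.
-/
theorem hasMonomialType_of_containsEdge [FiniteDimensional K V] [Finite K] [CharP K 2]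
    {G : Subgroup (V ≃ₗ[K] V)} {b : Basis (Fin n) K V} {H : Subgroup Kˣ} (hn : 2 ≤ n) (hH : H ≠ ⊥)
    (hG : ∀ i j, i ≠ j → ∀ h ∈ H, ContainsEdge G b b.coord i j (h : K))
    (hdet : ∀ g ∈ G, LinearMap.det (g : V →ₗ[K] V) = 1)
    (hmon : ∀ g ∈ G, ∀ i, ∃ j, ∃ h ∈ H, g (b i) = (h : K) • b j) : HasMonomialType G := by
  classical
  have hmem : ∀ x : Kˣ, x ∈ H ↔ x ^ Nat.card H = 1 := by
    intro x
    constructor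
    · intro hx
      have := pow_card_eq_one' (x := (⟨x, hx⟩ : H))
      exact congrArg Subtype.val this
    · intro hx
      have := Fintype.ofFinite Kˣ
      have h1 : (Finset.univ.filter fun y : Kˣ => y ∈ H) ⊆
          Finset.univ.filter fun y : Kˣ => y ^ Nat.card H = 1 := by
        intro y hy
        rw [Finset.mem_filter] at hy ⊢
        have := pow_card_eq_one' (x := (⟨y, hy.2⟩ : H))
        exact ⟨Finset.mem_univ _, congrArg Subtype.val this⟩
      have h2 : (Finset.univ.filter fun y : Kˣ => y ∈ H).card = Nat.card H := by
        rw [← Fintype.card_subtype, ← Nat.card_eq_fintype_card]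
      have h3 := Finset.eq_of_subset_of_card_le h1 (by
        rw [h2]; exact IsCyclic.card_pow_eq_one_le Nat.card_pos)
      have h4 : x ∈ Finset.univ.filter fun y : Kˣ => y ^ Nat.card H = 1 :=
        Finset.mem_filter.2 ⟨Finset.mem_univ _, hx⟩
      rw [← h3] at h4
      exact (Finset.mem_filter.1 h4).2
  refine ⟨inferInstance, n, hn, Nat.card H, ?_, ?_, b, fun g => ⟨fun hg => ⟨hdet g hg, ?_⟩, ?_⟩⟩
  · exact (Subgroup.one_lt_card_iff_ne_bot H).2 hH
  · rw [← Nat.card_units]; exact Subgroup.card_subgroup_dvd_card H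
  · choose σ h hh hgb using hmon g hg
    have hinj : Function.Injective σ := by
      intro i j hij
      by_contra hne
      have h1 : g ((h j : K) • b i) = g ((h i : K) • b j) := by
        rw [map_smul, map_smul, hgb, hgb, hij, smul_smul, smul_smul, mul_comm]
      have h2 := congrArg (b.coord i) (g.injective h1)
      have hF := isFrame_basis b
      rw [map_smul, map_smul, hF.self, hF.ne i j hne] at h2
      simp at h2
    refine ⟨Equiv.ofBijective σ (Finite.injective_iff_bijective.1 hinj), fun i => (h i : K),
      fun i => ?_, fun i => hgb i⟩
    have := (hmem _).1 (hh i)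
    simpa using congrArg Units.val this
  · rintro ⟨hd, σ, c, hc, hgb⟩
    have hc0 : ∀ i, c i ≠ 0 := fun i h0 => by
      have := hc i
      rw [h0, zero_pow Nat.card_pos.ne'] at this
      exact zero_ne_one this
    refine mem_of_containsEdge hG hd (σ := σ) (c := fun i => Units.mk0 (c i) (hc0 i))
      (fun i => ?_) hgb
    rw [hmem]
    ext
    simp [hc i]

/-- A group containing all edges of a spanning frame with gains in `H`, and consisting of monomial
elements of determinant one with coefficients in `H`, has monomial type. -/
theorem hasMonomialType_of_frame [FiniteDimensional K V] [Finite K] [CharP K 2]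
    {G : Subgroup (V ≃ₗ[K] V)} {H : Subgroup Kˣ} (hF : IsFrame e f)
    (hspan : ⊤ ≤ Submodule.span K (Set.range e)) (hn : 2 ≤ finrank K V) (hH : H ≠ ⊥)
    (hG : ∀ i j, i ≠ j → ∀ h ∈ H, ContainsEdge G e f i j (h : K))
    (hdet : ∀ g ∈ G, LinearMap.det (g : V →ₗ[K] V) = 1)
    (hmon : ∀ g ∈ G, ∀ i, ∃ j, ∃ h ∈ H, g (e i) = (h : K) • e j) : HasMonomialType G := by
  obtain ⟨n, b, σ, hb⟩ := exists_basis_of_isFrame hF hspan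
  have hn' : finrank K V = n := by rw [finrank_eq_card_basis b, Fintype.card_fin]
  refine hasMonomialType_of_containsEdge (b := b) (H := H) (hn' ▸ hn) hH ?_ hdet ?_
  · intro i j hij h hh
    obtain ⟨g, hg, hge⟩ := hG (σ.symm i) (σ.symm j) (fun h => hij (σ.symm.injective h)) h hh
    refine ⟨g, hg, ?_⟩
    have h1 := hb (σ.symm i)
    have h2 := hb (σ.symm j)
    rw [Equiv.apply_symm_apply] at h1 h2
    have := hge.of_smul (e' := b) (f' := b.coord) (a := 1) (b := 1) hij one_ne_zero one_ne_zero (by rw [h1.1, one_smul])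
      (by rw [h1.2, inv_one, one_smul]) (by rw [h2.1, one_smul]) (by rw [h2.2, inv_one, one_smul])
    simpa using this
  · intro g hg i
    obtain ⟨j, h, hh, hgj⟩ := hmon g hg (σ.symm i)
    have h1 := (hb (σ.symm i)).1
    rw [Equiv.apply_symm_apply] at h1
    exact ⟨σ j, h, hh, by rw [h1, hgj, (hb j).1]⟩

end MonomialType

end TransvectionGroups

/-! ### From small subsets to the whole group -/

namespace TransvectionGroups

variable {K V : Type*} [Field K] [AddCommGroup V] [Module K V]

theorem det_eq_one_of_mem_closure {S : Set (V ≃ₗ[K] V)}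
    (hS : ∀ t ∈ S, LinearMap.det (t : V →ₗ[K] V) = 1) {g : V ≃ₗ[K] V}
    (hg : g ∈ Subgroup.closure S) : LinearMap.det (g : V →ₗ[K] V) = 1 := by
  have h1 : ∀ t ∈ S, t ∈ (LinearEquiv.det (R := K) (M := V)).ker := fun t ht => by
    rw [MonoidHom.mem_ker]; ext; rw [LinearEquiv.coe_det, hS t ht, Units.val_one]
  have h2 := (Subgroup.closure_le _).2 h1 hg
  rw [MonoidHom.mem_ker] at h2
  rw [← LinearEquiv.coe_det, h2, Units.val_one]

/-- Conjugation by the change of basis is injective. By symmetry the two groups have equal size, so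
an inclusion between them is an equality. -/
theorem ncard_isMonomialElement_le [Finite K] [FiniteDimensional K V] {d a : ℕ}
    (b b' : Basis (Fin d) K V) :
    {g | IsMonomialElement b a g}.ncard ≤ {g | IsMonomialElement b' a g}.ncard := by
  have : Finite V := Module.finite_of_finite K
  have : Finite (V ≃ₗ[K] V) := Finite.of_injective (fun g => (g : V → V)) DFunLike.coe_injective
  let E := b.equiv b' (Equiv.refl _)
  have hE : ∀ i, E (b i) = b' i := fun i => by simp [E]
  have hE' : ∀ i, E.symm (b' i) = b i := fun i => by rw [← hE, E.symm_apply_apply]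
  refine Set.ncard_le_ncard_of_injOn (fun g => (E.symm.trans g).trans E) ?_ ?_ (Set.toFinite _)
  · rintro g ⟨hdet, σ, c, hc, hg⟩
    refine ⟨?_, σ, c, hc, fun i => ?_⟩
    · rw [← hdet]; exact LinearMap.det_conj (g : V →ₗ[K] V) E
    · simp [hE', hg, hE]
  · intro g _ g' _ h
    ext x
    have := LinearEquiv.congr_fun h (E x)
    simpa using this

variable {S T : Set (V ≃ₗ[K] V)} {v : (V ≃ₗ[K] V) → V} {φ : (V ≃ₗ[K] V) → Dual K V}

/-- A dense set of edges of a basis generates a group of monomial type. -/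
theorem hasMonomialType_closure_of_edges [FiniteDimensional K V] [Finite K] [CharP K 2] {n : ℕ}
    (hv : IsPresentation T v φ) (hd : IsDense T) (hn : 2 ≤ finrank K V) (b : Basis (Fin n) K V)
    (hb : ∀ t ∈ T, ∃ i j c, IsEdge b b.coord i j c t) :
    HasMonomialType (Subgroup.closure T) := by
  have hF := isFrame_basis b
  have hn' : finrank K V = n := by rw [finrank_eq_card_basis b, Fintype.card_fin]
  let o : Fin n := ⟨0, by omega⟩
  have htrans : ∀ i, ∃ g ∈ Subgroup.closure T, ∃ c : K, c ≠ 0 ∧ g (b o) = c • b i := by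
    intro i
    by_cases hi : i = o
    · exact ⟨1, one_mem _, 1, one_ne_zero, by simp [hi]⟩
    have hi0 : b.coord i ≠ 0 := fun h0 => by
      have := hF.self i
      simp [h0] at this
    -- Density provides an edge directly from `o` to `i`.
    obtain ⟨t, ht, h1, h2⟩ := hv.dense hd (hF.vec_ne o) hi0
    obtain ⟨_, _, _, h⟩ := hb t ht
    obtain ⟨k, c, hk⟩ := h.exists_left_of_vec hF (hv t ht) h1
    have hki : k = i := by
      by_contra hne
      obtain ⟨α, hα, a1, -⟩ := (hv t ht).exists_smul hk.apply
      have h3 : b.coord i (b o + c • b k) = 0 := by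
        rw [map_add, map_smul, hF.ne i o hi, hF.ne i k (Ne.symm hne), smul_zero, add_zero]
      rw [a1, map_smul] at h3
      exact h2 ((smul_eq_zero.1 h3).resolve_left hα)
    subst hki
    exact ⟨t, Subgroup.subset_closure ht, c, hk.gain_ne, hk.apply_left hF⟩
  obtain ⟨e, f, H, hF', hres, hmon, hG, hedge⟩ := exists_gain_subgroup hF hb o htrans
  refine hasMonomialType_of_frame hF' ?_ hn ?_ hG
    (fun g hg => det_eq_one_of_mem_closure (fun t ht => (hv t ht).det_eq_one) hg) hmon
  · rw [← b.span_eq, Submodule.span_le]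
    rintro _ ⟨i, rfl⟩
    obtain ⟨x, hx, h1, -⟩ := hres i
    have : b i = x⁻¹ • e i := by rw [h1, smul_smul, inv_mul_cancel₀ hx, one_smul]
    rw [this]
    exact Submodule.smul_mem _ _ (Submodule.subset_span ⟨i, rfl⟩)
  · rintro rfl
    -- With all gains equal to `1`, the sum of the frame vectors would be killed by the covector of
    -- every edge, contrary to density.
    have hsum : ∀ i, f i (∑ j, e j) = 1 := fun i => by
      rw [map_sum, Finset.sum_eq_single i]
      · exact hF'.self i
      · exact fun j _ hj => hF'.ne i j hj.symm
      · simp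
    have hx0 : ∑ j, e j ≠ 0 := fun h0 => by
      have := hsum o
      simp [h0] at this
    obtain ⟨t, ht, h1, -⟩ := hv.dense hd hx0 (ψ := f o) (fun h0 => by
      have := hF'.self o
      simp [h0] at this)
    obtain ⟨i, j, h, hh, hij⟩ := hedge t ht
    rw [Subgroup.mem_bot] at hh
    subst hh
    obtain ⟨α, hα, -, a2⟩ := (hv t ht).exists_smul hij.apply
    have h3 : (f i + ((1 : Kˣ) : K)⁻¹ • f j) (∑ j, e j) = 0 := by
      rw [LinearMap.add_apply, LinearMap.smul_apply, hsum, hsum]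
      simpa using CharTwo.add_self_eq_zero (1 : K)
    rw [a2, LinearMap.smul_apply] at h3
    exact h1 ((smul_eq_zero.1 h3).resolve_left (inv_ne_zero hα))

/-- Sizes: an unbalanced quintuple lies in a good set of at most `6 · 5 = 30` elements, four
dimension steps raise this to `54`, one exceptional element to `60`, and three test elements to
`78`. -/
theorem hasMonomialType_of_forall_small [FiniteDimensional K V] [Finite K]
    (hn : 2 ≤ finrank K V) (hT : ∀ t ∈ T, IsTransvection t) (hd : IsDense T)
    (hsymp : ¬ PreservesSymplecticForm (Subgroup.closure T))
    (h : ∀ T₀ : Set (V ≃ₗ[K] V), T₀ ⊆ T → T₀.encard ≤ 1000 →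
        (IsWeaklyNondegenerate T₀ → IsNondegenerate T₀) ∧
        (2 ≤ finrank K (commutatorSpace (Subgroup.closure T₀)) →
          IsIrreducibleGroup
            (restrict (Subgroup.closure T₀) (commutatorSpace (Subgroup.closure T₀))) →
          HasMonomialType
              (restrict (Subgroup.closure T₀) (commutatorSpace (Subgroup.closure T₀))) ∨
            HasOddSymmetricType
              (restrict (Subgroup.closure T₀) (commutatorSpace (Subgroup.closure T₀))))) :
    HasMonomialType (Subgroup.closure T) := by
  obtain ⟨v, φ, hv⟩ := exists_isPresentation hT
  have hV : 0 < finrank K V := by omega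
  have hN : ∀ S ⊆ T, S.encard ≤ (1000 : ℕ) → IsWeaklyNondegenerate S → IsNondegenerate S :=
    fun S hS hc => (h S hS (by exact_mod_cast hc)).1
  have htype : ∀ S, IsGood T S v φ → S.encard ≤ (1000 : ℕ) →
      HasMonomialType (restrict (Subgroup.closure S) (commutatorSpace (Subgroup.closure S))) ∨
      HasOddSymmetricType (restrict (Subgroup.closure S)
        (commutatorSpace (Subgroup.closure S))) :=
    fun S hS hc => (h S hS.subset (by exact_mod_cast hc)).2 (hS.two_le_finrank hv)
      (hS.isIrreducibleGroup hv)
  have hcast : ∀ {k : ℕ} {S : Set (V ≃ₗ[K] V)}, S.encard ≤ k → k ≤ 1000 →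
      S.encard ≤ (1000 : ℕ) := fun h1 h2 => h1.trans (by exact_mod_cast h2)
  have : Nontrivial V := finrank_pos_iff.1 hV
  have : CharP K 2 := by
    obtain ⟨x, hx⟩ := exists_ne (0 : V)
    obtain ⟨ψ, hψ⟩ := exists_ne (0 : Dual K V)
    obtain ⟨t, ht, -⟩ := hv.dense hd hx hψ
    obtain ⟨S, -, hS, hSc⟩ := exists_isGood_mem hv hd hN ht (by norm_num)
    exact (htype S hS (hcast (k := 6) (by exact_mod_cast hSc) (by norm_num))).elim
      (fun h => h.1) fun h => h.1
  have hunb : ∃ t₁ ∈ T, ∃ t₂ ∈ T, ∃ t₃ ∈ T, ∃ t₄ ∈ T, ∃ t₅ ∈ T,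
      ¬ IsBalanced {t₁, t₂, t₃, t₄, t₅} v φ := by
    by_contra! hc
    exact hsymp (preservesSymplecticForm_of_isBalanced hv hd hV hc)
  obtain ⟨t₁, ht₁, t₂, ht₂, t₃, ht₃, t₄, ht₄, t₅, ht₅, hunb⟩ := hunb
  obtain ⟨S₁, hS₁sub, hS₁, hS₁c⟩ : ∃ S, {t₁, t₂, t₃, t₄, t₅} ⊆ S ∧ IsGood T S v φ ∧
      S.encard ≤ (30 : ℕ) := by
    obtain ⟨S, hm, hS, hSc⟩ := exists_isGood_mem hv hd hN ht₁ (by norm_num)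
    obtain ⟨S', g1, g2, g3, g4⟩ := hS.exists_union hv hd hN [t₂, t₃, t₄, t₅]
      (by simp [ht₂, ht₃, ht₄, ht₅]) (k := 6) (by exact_mod_cast hSc) (by simp)
    refine ⟨S', ?_, g3, by simpa using g4⟩
    simp only [Set.insert_subset_iff, Set.singleton_subset_iff]
    exact ⟨g1 hm, g2 _ (by simp), g2 _ (by simp), g2 _ (by simp), g2 _ (by simp)⟩
  have hmono : ∀ S, S₁ ⊆ S → IsGood T S v φ → S.encard ≤ (1000 : ℕ) →
      HasMonomialType (restrict (Subgroup.closure S) (commutatorSpace (Subgroup.closure S))) :=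
    fun S hsub hS hc => (htype S hS hc).resolve_right fun h0 =>
      hunb ((hS.isBalanced_of_hasOddSymmetricType hv h0).mono (hS₁sub.trans hsub))
  -- The dimension is raised to four, unless `V` is exhausted earlier, so that the triple criterion
  -- becomes available when `a = 3`.
  have hdim : ∀ m : ℕ, m ≤ 4 → ∃ S, S₁ ⊆ S ∧ IsGood T S v φ ∧ S.encard ≤ (30 + 6 * m : ℕ) ∧
      (m ≤ finrank K (vecSpan S) ∨ vecSpan S = ⊤) := by
    intro m
    induction m with
    | zero => exact fun _ => ⟨S₁, le_rfl, hS₁, by simpa using hS₁c, Or.inl (Nat.zero_le _)⟩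
    | succ m ih =>
      intro hm
      obtain ⟨S, h1, h2, h3, h4⟩ := ih (by omega)
      by_cases htop : vecSpan S = ⊤
      · exact ⟨S, h1, h2, h3.trans (by exact_mod_cast (by omega)), Or.inr htop⟩
      have h4 := h4.resolve_right htop
      obtain ⟨t, ht, htS⟩ : ∃ t ∈ T, v t ∉ vecSpan S := by
        by_contra! hc
        apply htop
        rw [eq_top_iff, ← hv.span_eq_top hd hV, hv.vecSpan_eq, Submodule.span_le]
        rintro _ ⟨t, ht, rfl⟩
        exact hc t ht
      obtain ⟨S', g1, g2, g3, g4⟩ := h2.exists_insert hv hd hN ht h3 (by omega)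
      refine ⟨S', h1.trans g1, g3, g4.trans (le_of_eq (by congr 1)), Or.inl ?_⟩
      have hlt : vecSpan S < vecSpan S' :=
        lt_of_le_of_ne (vecSpan_mono g1) fun heq => htS (by
          rw [heq]; exact (hv.mono g3.subset).vec_mem g2)
      have := Submodule.finrank_lt_finrank_of_lt hlt
      omega
  have hfinish : ∀ S, S₁ ⊆ S → IsGood T S v φ → S.encard ≤ (60 : ℕ) →
      ∀ (d a : ℕ) (e : Fin d → V) (f : Fin d → Dual K V), d = finrank K (vecSpan S) → 1 < a →
      a ∣ Nat.card K - 1 → IsFrame e f →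
      (∀ i j (c : K), i ≠ j → c ^ a = 1 → ∃ g ∈ Subgroup.closure S, IsEdge e f i j c g) →
      (a ≠ 3 ∨ 4 ≤ d) → HasMonomialType (Subgroup.closure T) := by
    intro S hS₁S hS hSc d a e f hdim ha hadvd hF hG had
    have hd2 : 2 ≤ d := by
      rw [hdim, ← (hv.mono hS.subset).commutatorSpace_eq]; exact hS.two_le_finrank hv
    obtain ⟨e₀, f₀, h₀, hvert⟩ := exists_vertex_mem_all_frames hd2 ha hadvd hF hG had
    -- The frame of an enlarged good set is also a frame for `⟨S⟩`, so it passes through the vertex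
    -- found for `S`.
    have hloc : HasLocalFrames T e₀ f₀ := by
      intro r₁ hr₁ r₂ hr₂ r₃ hr₃
      obtain ⟨S', g1, g2, g3, g4⟩ := hS.exists_union hv hd hN [r₁, r₂, r₃]
        (by simp [hr₁, hr₂, hr₃]) hSc (by simp)
      obtain ⟨d', a', e', f', -, -, -, hF', -, -⟩ := g3.exists_isFrameFor hv
        (hmono S' (hS₁S.trans g1) g3 (hcast g4 (by simp)))
      obtain ⟨m, x, hx, q1, q2⟩ := hvert d' e' f'
        ⟨hF'.isFrame, fun t ht => hF'.isEdge t (Subgroup.closure_mono g1 ht)⟩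
      refine ⟨d', e', f', m, hF'.isFrame, ⟨x, hx, q1, q2⟩, fun t ht => ?_⟩
      have htS' : t ∈ S' := g2 t (by simpa using ht)
      exact hF'.isEdge t (Subgroup.subset_closure htS') _ _ (hv t (g3.subset htS'))
    obtain ⟨n, b, hb⟩ := hloc.exists_basis hv hd hV h₀
    exact hasMonomialType_closure_of_edges hv hd hn b hb
  obtain ⟨S, hS₁S, hS, hSc, hSdim⟩ := hdim 4 le_rfl
  obtain ⟨d, a, e, f, hde, ha, hadvd, hF, hG, htopS⟩ := hS.exists_isFrameFor hv
    (hmono S hS₁S hS (hcast hSc (by norm_num)))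
  by_cases had : a ≠ 3 ∨ 4 ≤ d
  · exact hfinish S hS₁S hS (hSc.trans (by norm_num)) d a e f hde ha hadvd hF.isFrame hG had
  rw [not_or, not_not] at had
  obtain ⟨rfl, hd4⟩ := had
  have htop : vecSpan S = ⊤ := hSdim.resolve_left (by omega)
  obtain ⟨b, hb⟩ := htopS htop
  -- Here `a = 3`, `d < 4` and `S` spans `V`. If `⟨S⟩` contains `T` it is the whole group; otherwise
  -- an element outside it is adjoined.
  by_cases hTS : ∀ t ∈ T, t ∈ Subgroup.closure S
  · have hcl : Subgroup.closure T = Subgroup.closure S :=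
      le_antisymm ((Subgroup.closure_le _).2 hTS) (Subgroup.closure_mono hS.subset)
    rw [hcl]
    refine ⟨inferInstance, d, ?_, 3, ha, hadvd, b, hb⟩
    rw [hde, htop, finrank_top]; exact hn
  push Not at hTS
  obtain ⟨t, ht, htS⟩ := hTS
  obtain ⟨S', g1, g2, g3, g4⟩ := hS.exists_insert hv hd hN ht hSc (by norm_num)
  obtain ⟨d', a', e', f', hde', ha', hadvd', hF', hG', htopS'⟩ := g3.exists_isFrameFor hv
    (hmono S' (hS₁S.trans g1) g3 (hcast g4 (by norm_num)))
  have htop' : vecSpan S' = ⊤ := eq_top_iff.2 (htop ▸ vecSpan_mono g1)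
  refine hfinish S' (hS₁S.trans g1) g3 (g4.trans (by norm_num)) d' a' e' f' hde' ha' hadvd'
    hF'.isFrame hG' (Or.inl ?_)
  -- If the enlarged set again had `a = 3`, both groups would be `M_d(3)` for bases of `V`. Counting
  -- would make them equal, although `t` lies in only one of them.
  rintro rfl
  obtain ⟨b', hb'⟩ := htopS' htop'
  have hdd : d' = d := by rw [hde, hde', htop, htop']
  subst hdd
  have hfin : Finite V := Module.finite_of_finite K
  have : Finite (V ≃ₗ[K] V) := Finite.of_injective (fun g => (g : V → V)) DFunLike.coe_injective
  have hsub : {g | IsMonomialElement b 3 g} ⊆ {g | IsMonomialElement b' 3 g} := fun g hg =>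
    (hb' g).1 (Subgroup.closure_mono g1 ((hb g).2 hg))
  have heq := Set.eq_of_subset_of_ncard_le hsub (ncard_isMonomialElement_le b' b) (Set.toFinite _)
  apply htS
  have h5 : t ∈ {g | IsMonomialElement b' 3 g} := (hb' t).1 (Subgroup.subset_closure g2)
  rw [← heq] at h5
  exact (hb t).2 h5

end TransvectionGroups

/-! ### From the whole group to its subsets -/

namespace TransvectionGroups

variable {K V : Type*} [Field K] [AddCommGroup V] [Module K V]
  {S T : Set (V ≃ₗ[K] V)} {v : (V ≃ₗ[K] V) → V} {φ : (V ≃ₗ[K] V) → Dual K V}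

theorem HasMonomialType.exists_isEdge [FiniteDimensional K V] [CharP K 2]
    (h : HasMonomialType (Subgroup.closure T)) (hv : IsPresentation T v φ) :
    ∃ (n : ℕ) (b : Basis (Fin n) K V), ∀ t ∈ T, ∃ i j c, IsEdge b b.coord i j c t := by
  obtain ⟨-, n, -, a, -, -, b, hb⟩ := h
  refine ⟨n, b, fun t ht => (hv t ht).exists_isEdge (isFrame_basis b) (fun i => ?_) fun x hx => ?_⟩
  · obtain ⟨-, σ, c, -, hc⟩ := (hb t).1 (Subgroup.subset_closure ht)
    exact ⟨σ i, c i, hc i⟩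
  · have : x = 0 := b.ext_elem fun i => by rw [map_zero]; exact hx i
    rw [this, map_zero]

/-- Edges of a basis span spaces of vectors and of covectors of the same dimension. -/
theorem finrank_vecSpan_eq_of_edges [FiniteDimensional K V] [Finite K] [CharP K 2] {n : ℕ}
    (hv : IsPresentation T v φ) (b : Basis (Fin n) K V)
    (hb : ∀ t ∈ T, ∃ i j c, IsEdge b b.coord i j c t) :
    finrank K (vecSpan T) = finrank K (covecSpan T) := by
  have : Finite V := Module.finite_of_finite K
  have : Finite (Dual K V) := Module.finite_of_finite K
  let A := (vecSpan T).dualAnnihilator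
  let C := (covecSpan T).dualCoannihilator
  -- `F` and `G` invert coordinates entrywise, with `0⁻¹ = 0`. They are not linear, so the
  -- annihilators are compared by cardinality, which determines dimension over a finite field.
  let F : Dual K V → V := fun ψ => b.equivFun.symm fun i => (ψ (b i))⁻¹
  let G : V → Dual K V := fun x => b.constr K fun i => (b.coord i x)⁻¹
  have hF : ∀ ψ i, b.coord i (F ψ) = (ψ (b i))⁻¹ := fun ψ i => by
    have := congrFun (b.equivFun.apply_symm_apply fun i => (ψ (b i))⁻¹) i
    exact this
  have hG : ∀ x i, G x (b i) = (b.coord i x)⁻¹ := fun x i => b.constr_basis K _ i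
  have hFinj : Function.Injective F := by
    intro ψ ψ' h
    refine b.ext fun i => inv_injective ?_
    rw [← hF, ← hF, h]
  have hGinj : Function.Injective G := by
    intro x y h
    refine b.ext_elem fun i => inv_injective ?_
    rw [← b.coord_apply, ← b.coord_apply, ← hG, ← hG, h]
  have key : ∀ {p q c : K}, c ≠ 0 → (p + c * q = 0 ↔ p⁻¹ + c⁻¹ * q⁻¹ = 0) := by
    intro p q c hc
    rw [CharTwo.add_eq_zero, CharTwo.add_eq_zero, ← mul_inv, inv_inj]
  have hmem : ∀ ψ, ψ ∈ A ↔ F ψ ∈ C := by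
    intro ψ
    simp only [A, C]
    rw [Submodule.mem_dualAnnihilator, Submodule.mem_dualCoannihilator, hv.forall_vecSpan_iff,
      hv.forall_covecSpan_iff]
    refine forall₂_congr fun t ht => ?_
    obtain ⟨i, j, c, h⟩ := hb t ht
    obtain ⟨α, hα, h1, h2⟩ := (hv t ht).exists_smul h.apply
    have e1 : ψ (v t) = 0 ↔ ψ (b i) + c * ψ (b j) = 0 := by
      have : ψ (b i) + c * ψ (b j) = α * ψ (v t) := by
        rw [← smul_eq_mul, ← smul_eq_mul, ← map_smul ψ, ← map_smul ψ, ← map_add, h1]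
      rw [this]; simp [hα]
    have e2 : φ t (F ψ) = 0 ↔ (ψ (b i))⁻¹ + c⁻¹ * (ψ (b j))⁻¹ = 0 := by
      have : (ψ (b i))⁻¹ + c⁻¹ * (ψ (b j))⁻¹ = α⁻¹ * φ t (F ψ) := by
        rw [← hF, ← hF, ← smul_eq_mul, ← smul_eq_mul, ← LinearMap.smul_apply,
          ← LinearMap.smul_apply, ← h2, LinearMap.add_apply]
      rw [this]; simp [hα]
    rw [e1, e2, key h.gain_ne]
  have hFG : ∀ x, F (G x) = x := fun x => b.ext_elem fun i => by
    rw [← b.coord_apply, hF, hG, inv_inv, b.coord_apply]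
  have c1 : Nat.card A ≤ Nat.card C := Nat.card_le_card_of_injective
    (fun ψ : A => (⟨F ψ, (hmem _).1 ψ.2⟩ : C))
    fun ψ ψ' h => Subtype.ext (hFinj (congrArg Subtype.val h))
  have c2 : Nat.card C ≤ Nat.card A := Nat.card_le_card_of_injective
    (fun x : C => (⟨G x, (hmem _).2 (by rw [hFG]; exact x.2)⟩ : A))
    fun x y h => Subtype.ext (hGinj (congrArg Subtype.val h))
  have hAC : finrank K A = finrank K C := by
    have h1 := le_antisymm c1 c2
    rw [Module.natCard_eq_pow_finrank (K := K) (V := A),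
      Module.natCard_eq_pow_finrank (K := K) (V := C)] at h1
    exact Nat.pow_right_injective Finite.one_lt_card h1
  have a3 := Subspace.finrank_add_finrank_dualCoannihilator_eq (covecSpan T)
  have a4 := Subspace.finrank_add_finrank_dualAnnihilator_eq (vecSpan T)
  change _ + finrank K C = _ at a3
  change _ + finrank K A = _ at a4
  omega

/-- With equal dimensions, one vanishing kernel makes the space and the annihilator of the other
space complementary, and this kills the other kernel. -/
theorem isNondegenerate_of_finrank_eq [FiniteDimensional K V]
    (h : finrank K (vecSpan S) = finrank K (covecSpan S)) (hw : IsWeaklyNondegenerate S) :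
    IsNondegenerate S := by
  have a3 := Subspace.finrank_add_finrank_dualCoannihilator_eq (covecSpan S)
  have a4 := Subspace.finrank_add_finrank_dualAnnihilator_eq (vecSpan S)
  rcases hw with hw | hw
  · refine ⟨hw, fun ψ hψ hψ' => ?_⟩
    have h1 : vecSpan S ⊓ (covecSpan S).dualCoannihilator = ⊥ := zeroLeftKernel_iff.1 hw
    have a1 := Submodule.finrank_sup_add_finrank_inf_eq (vecSpan S)
      (covecSpan S).dualCoannihilator
    rw [h1, finrank_bot] at a1
    have htop : vecSpan S ⊔ (covecSpan S).dualCoannihilator = ⊤ :=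
      Submodule.eq_top_of_finrank_eq (by omega)
    have hle : vecSpan S ⊔ (covecSpan S).dualCoannihilator ≤ LinearMap.ker ψ :=
      sup_le (fun x hx => hψ' x hx) fun x hx => (Submodule.mem_dualCoannihilator x).1 hx ψ hψ
    rw [htop, top_le_iff] at hle
    exact LinearMap.ker_eq_top.1 hle
  · refine ⟨fun x hx hx' => ?_, hw⟩
    have h2 : covecSpan S ⊓ (vecSpan S).dualAnnihilator = ⊥ := by
      rw [Submodule.eq_bot_iff]
      rintro ψ ⟨hψ, hψ'⟩
      exact hw ψ hψ fun x hx => (Submodule.mem_dualAnnihilator ψ).1 hψ' x hx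
    have a2 := Submodule.finrank_sup_add_finrank_inf_eq (covecSpan S) (vecSpan S).dualAnnihilator
    rw [h2, finrank_bot] at a2
    have htop : covecSpan S ⊔ (vecSpan S).dualAnnihilator = ⊤ :=
      Submodule.eq_top_of_finrank_eq (by rw [Subspace.dual_finrank_eq]; omega)
    rw [← Module.forall_dual_apply_eq_zero_iff K]
    intro ψ
    have hψ : ψ ∈ covecSpan S ⊔ (vecSpan S).dualAnnihilator := htop ▸ Submodule.mem_top
    obtain ⟨a, ha, c, hc, rfl⟩ := Submodule.mem_sup.1 hψ
    rw [LinearMap.add_apply, hx' a ha, (Submodule.mem_dualAnnihilator c).1 hc x hx, add_zero]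

/-- On the commutator space a generator still has the form `1 + v ⊗ φ` with `φ v = 0`, so its
determinant there is `1`. -/
theorem IsPresentation.det_restrict [FiniteDimensional K V] (hv : IsPresentation S v φ)
    {h : commutatorSpace (Subgroup.closure S) ≃ₗ[K] commutatorSpace (Subgroup.closure S)}
    (hh : h ∈ restrict (Subgroup.closure S) (commutatorSpace (Subgroup.closure S))) :
    LinearMap.det (h : commutatorSpace (Subgroup.closure S) →ₗ[K]
      commutatorSpace (Subgroup.closure S)) = 1 := by
  obtain ⟨g, hg, hgh⟩ := hh
  suffices hex : ∃ h' : commutatorSpace (Subgroup.closure S) ≃ₗ[K]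
      commutatorSpace (Subgroup.closure S), (∀ w, (h' w : V) = g w) ∧ LinearEquiv.det h' = 1 by
    obtain ⟨h', h1, h2⟩ := hex
    have : h = h' := by ext w; rw [hgh, h1]
    rw [this, ← LinearEquiv.coe_det, h2, Units.val_one]
  clear hgh h
  have hmem : ∀ {x}, x ∈ commutatorSpace (Subgroup.closure S) ↔ x ∈ vecSpan S := fun {x} => by
    rw [hv.commutatorSpace_eq]
  induction hg using Subgroup.closure_induction with
  | mem t ht =>
    obtain ⟨h', -, h1⟩ := exists_mem_restrict (Subgroup.subset_closure ht)
    refine ⟨h', h1, ?_⟩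
    ext
    rw [LinearEquiv.coe_det, Units.val_one]
    have hmap : (h' : commutatorSpace (Subgroup.closure S) →ₗ[K]
        commutatorSpace (Subgroup.closure S)) =
        LinearMap.transvection (φ t ∘ₗ (commutatorSpace (Subgroup.closure S)).subtype)
          ⟨v t, hmem.2 (hv.vec_mem ht)⟩ := by
      ext w
      simp [LinearMap.transvection.apply, h1, (hv t ht).apply]
    rw [hmap, LinearMap.transvection.det]
    simp [(hv t ht).apply_self]
  | one => exact ⟨1, fun w => rfl, map_one _⟩
  | mul a b _ _ ha hb =>
    obtain ⟨h₁, p1, q1⟩ := ha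
    obtain ⟨h₂, p2, q2⟩ := hb
    exact ⟨h₁ * h₂, fun w => by rw [LinearEquiv.mul_apply, LinearEquiv.mul_apply, p1, p2],
      by rw [map_mul, q1, q2, one_mul]⟩
  | inv a _ ha =>
    obtain ⟨h₁, p1, q1⟩ := ha
    refine ⟨h₁⁻¹, fun w => ?_, by rw [map_inv, q1, inv_one]⟩
    have h2 := p1 (h₁⁻¹ w)
    have h3 : h₁ (h₁⁻¹ w) = w := h₁.apply_symm_apply w
    rw [h3] at h2
    rw [h2]
    exact (a.symm_apply_apply _).symm

/-! ### Irreducible subgroups generated by edges -/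

section Irreducible

variable {n : ℕ}

/-- If a group generated by edges of a basis acts irreducibly on its commutator space, then its
generators are edges of a part of the basis whose lines it permutes transitively. -/
theorem exists_subframe_of_irreducible [CharP K 2] (hv : IsPresentation S v φ)
    (b : Basis (Fin n) K V) (hb : ∀ t ∈ S, ∃ i j c, IsEdge b b.coord i j c t)
    (hirr : IsIrreducibleGroup (restrict (Subgroup.closure S)
      (commutatorSpace (Subgroup.closure S)))) :
    ∃ (I : Set (Fin n)) (o o' : I), o ≠ o' ∧
      (∀ t ∈ S, ∃ (i j : I) (c : K), IsEdge (fun i : I => b i) (fun i : I => b.coord i) i j c t) ∧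
      ∀ i : I, ∃ g ∈ Subgroup.closure S, ∃ c : K, c ≠ 0 ∧ g (b o) = c • b i := by
  have hF := isFrame_basis b
  have hmem : ∀ {x}, x ∈ commutatorSpace (Subgroup.closure S) ↔ x ∈ vecSpan S := fun {x} => by
    rw [hv.commutatorSpace_eq]
  obtain ⟨t₀, ht₀⟩ : S.Nonempty := by
    by_contra hne
    rw [Set.not_nonempty_iff_eq_empty] at hne
    have := hirr.1
    obtain ⟨x, hx⟩ := exists_ne (0 : commutatorSpace (Subgroup.closure S))
    have h0 : vecSpan S = ⊥ := by
      rw [hv.vecSpan_eq, hne, Set.image_empty, Submodule.span_empty]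
    have h1 := hmem.1 x.2
    rw [h0, Submodule.mem_bot] at h1
    exact hx (Subtype.ext h1)
  obtain ⟨o, o', c₀, h₀⟩ := hb t₀ ht₀
  let I : Set (Fin n) := {i | ∃ g ∈ Subgroup.closure S, ∃ c : K, c ≠ 0 ∧ g (b o) = c • b i}
  have hoI : o ∈ I := ⟨1, one_mem _, 1, one_ne_zero, by simp⟩
  have hstep : ∀ {t i j c}, t ∈ S → IsEdge b b.coord i j c t → i ∈ I → j ∈ I := by
    rintro t i j c ht h ⟨g, hg, x, hx, hgx⟩
    exact ⟨t * g, mul_mem (Subgroup.subset_closure ht) hg, x * c, mul_ne_zero hx h.gain_ne, by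
      rw [LinearEquiv.mul_apply, hgx, map_smul, h.apply_left hF, smul_smul]⟩
  have ho'I : o' ∈ I := hstep ht₀ h₀ hoI
  have hvt : ∀ {t i j c}, t ∈ S → IsEdge b b.coord i j c t → ∃ α : K, α ≠ 0 ∧
      v t = α • (b i + c • b j) ∧ φ t = α⁻¹ • (b.coord i + c⁻¹ • b.coord j) := by
    intro t i j c ht h
    exact (h.along hF).exists_smul (hv t ht).apply
  -- `U` is the span of the basis vectors in the orbit `I`. It is invariant and contains `v t₀`, so
  -- irreducibility puts all of `vecSpan S` inside it and leaves no edge outside `I`.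
  let U : Submodule K V := ⨅ k : {k // k ∉ I}, LinearMap.ker (b.coord k)
  have hU : ∀ x, x ∈ U ↔ ∀ k, k ∉ I → b.coord k x = 0 := fun x => by
    simp only [U, Submodule.mem_iInf, LinearMap.mem_ker, Subtype.forall]
  have hvU : ∀ {t i j c}, t ∈ S → IsEdge b b.coord i j c t → i ∈ I → v t ∈ U := by
    intro t i j c ht h hi
    obtain ⟨α, hα, h1, -⟩ := hvt ht h
    rw [h1, hU]
    intro k hk
    have hki : k ≠ i := fun h => hk (h ▸ hi)
    have hkj : k ≠ j := fun h' => hk (h' ▸ hstep ht h hi)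
    rw [map_smul, map_add, map_smul, hF.ne k i hki, hF.ne k j hkj]
    simp
  have hφU : ∀ {t i j c}, t ∈ S → IsEdge b b.coord i j c t → i ∉ I → ∀ x ∈ U, φ t x = 0 := by
    intro t i j c ht h hi x hx
    obtain ⟨α, hα, -, h2⟩ := hvt ht h
    have hj : j ∉ I := fun hj => hi (hstep ht h.symm hj)
    rw [hU] at hx
    rw [h2, LinearMap.smul_apply, LinearMap.add_apply, LinearMap.smul_apply, hx i hi, hx j hj]
    simp
  have hinv : ∀ g ∈ Subgroup.closure S, ∀ x ∈ U, g x ∈ U := by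
    intro g hg
    refine closure_induction_of_edges hF hb (P := fun g => ∀ x ∈ U, g x ∈ U) (fun x hx => hx) ?_ hg
    intro t ht g _ ih x hx
    have hgx := ih x hx
    obtain ⟨i, j, c, h⟩ := hb t ht
    rw [LinearEquiv.mul_apply, (hv t ht).apply]
    by_cases hi : i ∈ I
    · exact U.add_mem hgx (U.smul_mem _ (hvU ht h hi))
    · rw [hφU ht h hi _ hgx, zero_smul, add_zero]; exact hgx
  have hall : ∀ x ∈ vecSpan S, x ∈ U := by
    rcases hirr.2 (U.comap (commutatorSpace (Subgroup.closure S)).subtype) (by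
      rintro h ⟨g, hg, hgh⟩ w hw
      rw [Submodule.mem_comap, Submodule.subtype_apply] at hw ⊢
      rw [hgh]; exact hinv g hg _ hw) with h1 | h1
    · exfalso
      have h2 : (⟨v t₀, hmem.2 (hv.vec_mem ht₀)⟩ : commutatorSpace (Subgroup.closure S)) ∈
          U.comap (commutatorSpace (Subgroup.closure S)).subtype := hvU ht₀ h₀ hoI
      rw [h1, Submodule.mem_bot] at h2
      exact (hv t₀ ht₀).vec_ne (congrArg Subtype.val h2)
    · intro x hx
      have h2 : (⟨x, hmem.2 hx⟩ : commutatorSpace (Subgroup.closure S)) ∈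
          U.comap (commutatorSpace (Subgroup.closure S)).subtype := h1 ▸ Submodule.mem_top
      exact h2
  refine ⟨I, ⟨o, hoI⟩, ⟨o', ho'I⟩, fun h => h₀.index_ne (congrArg Subtype.val h), ?_, fun i => i.2⟩
  intro t ht
  obtain ⟨i, j, c, h⟩ := hb t ht
  have hi : i ∈ I := by
    by_contra hi
    have h1 := (hU _).1 (hall _ (hv.vec_mem ht)) i hi
    obtain ⟨α, hα, h2, -⟩ := hvt ht h
    rw [h2, map_smul, map_add, map_smul, hF.self, hF.ne i j h.index_ne] at h1
    simp [hα] at h1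
  exact ⟨⟨i, hi⟩, ⟨j, hstep ht h hi⟩, c, fun h' => h.index_ne (congrArg Subtype.val h'), h.gain_ne,
    h.apply⟩

variable {ι : Type*} {e : ι → V} {f : ι → Dual K V} {H : Subgroup Kˣ}

theorem ContainsEdge.vec_mem_commutatorSpace [CharP K 2] {G : Subgroup (V ≃ₗ[K] V)} {i j : ι} {c : K}
    (hF : IsFrame e f) (h : ContainsEdge G e f i j c) : e i + c • e j ∈ commutatorSpace G := by
  obtain ⟨g, hg, hge⟩ := h
  have h1 := commutatorSpace_sub_mem hg (e i)
  rw [hge.apply, add_sub_cancel_left] at h1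
  simpa [hF.self, hF.ne j i hge.index_ne.symm] using h1

theorem vecSpan_le_span_of_edges (hv : IsPresentation S v φ)
    (hS : ∀ t ∈ S, ∃ i j c, IsEdge e f i j c t) :
    vecSpan S ≤ Submodule.span K (Set.range e) := by
  rw [hv.vecSpan_eq, Submodule.span_le]
  rintro _ ⟨t, ht, rfl⟩
  obtain ⟨i, j, c, h⟩ := hS t ht
  obtain ⟨α, hα, h1, -⟩ := (hv t ht).exists_smul h.apply
  have h2 : v t = α⁻¹ • (e i + c • e j) := by rw [h1, smul_smul, inv_mul_cancel₀ hα, one_smul]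
  rw [h2]
  exact Submodule.smul_mem _ _ (Submodule.add_mem _ (Submodule.subset_span ⟨i, rfl⟩)
    (Submodule.smul_mem _ _ (Submodule.subset_span ⟨j, rfl⟩)))

/-- For `1 ≠ h ∈ H`, the vectors `e i + h e j` and `e i + e j` both lie in the commutator space, and
hence so does `e j`. The frame therefore spans that space. -/
theorem hasMonomialType_restrict [FiniteDimensional K V] [Finite K] [CharP K 2]
    (hv : IsPresentation S v φ) (hF : IsFrame e f) (hH : H ≠ ⊥) (hI : Nontrivial ι)
    (hdim : 2 ≤ finrank K (commutatorSpace (Subgroup.closure S)))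
    (hmon : ∀ g ∈ Subgroup.closure S, ∀ i, ∃ j, ∃ h ∈ H, g (e i) = (h : K) • e j)
    (hG : ∀ i j, i ≠ j → ∀ h ∈ H, ContainsEdge (Subgroup.closure S) e f i j (h : K))
    (hS : ∀ t ∈ S, ∃ i j, ∃ h ∈ H, IsEdge e f i j (h : K) t) :
    HasMonomialType (restrict (Subgroup.closure S) (commutatorSpace (Subgroup.closure S))) := by
  set W := commutatorSpace (Subgroup.closure S) with hW
  obtain ⟨h, hh, hh1⟩ : ∃ h ∈ H, h ≠ 1 := by
    by_contra! hc
    exact hH ((Subgroup.eq_bot_iff_forall H).2 hc)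
  have heW : ∀ j, e j ∈ W := by
    intro j
    obtain ⟨i, hij⟩ := exists_ne j
    have h1 := (hG i j hij h hh).vec_mem_commutatorSpace hF
    have h2 := (hG i j hij 1 (one_mem _)).vec_mem_commutatorSpace hF
    have h3 := W.sub_mem h1 h2
    have h4 : e i + (h : K) • e j - (e i + ((1 : Kˣ) : K) • e j) =
        ((h : K) - 1) • e j := by
      rw [Units.val_one, sub_smul, add_sub_add_left_eq_sub]
    rw [h4] at h3
    have h5 : (h : K) - 1 ≠ 0 := sub_ne_zero.2 fun h0 => hh1 (Units.ext h0)
    exact (Submodule.smul_mem_iff _ h5).1 h3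
  let eW : ι → W := fun i => ⟨e i, heW i⟩
  let fW : ι → Dual K W := fun i => f i ∘ₗ W.subtype
  have hFW : IsFrame eW fW := ⟨fun i => hF.self i, fun i j hij => hF.ne i j hij⟩
  refine hasMonomialType_of_frame (e := eW) (f := fW) (H := H) hFW ?_ hdim hH ?_
    (fun g hg => hv.det_restrict hg) ?_
  · have h1 : W ≤ Submodule.span K (Set.range e) := by
      rw [hW, hv.commutatorSpace_eq]
      exact vecSpan_le_span_of_edges hv fun t ht => by
        obtain ⟨i, j, h, -, h1⟩ := hS t ht
        exact ⟨i, j, h, h1⟩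
    rintro w -
    have h2 : (w : V) ∈ (Submodule.span K (Set.range eW)).map W.subtype := by
      rw [Submodule.map_span, ← Set.range_comp]
      exact h1 w.2
    obtain ⟨w', hw', hww⟩ := h2
    have : w' = w := Subtype.ext hww
    exact this ▸ hw'
  · intro i j hij h hh
    obtain ⟨g, hg, hge⟩ := hG i j hij h hh
    obtain ⟨g', hg', hgg⟩ := exists_mem_restrict hg
    exact ⟨g', hg', hij, hge.gain_ne, fun x => Subtype.ext ((hgg x).trans (hge.apply x))⟩
  · rintro g ⟨g', hg', hgg⟩ i
    obtain ⟨j, h, hh, h1⟩ := hmon g' hg' i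
    exact ⟨j, h, hh, Subtype.ext ((hgg (eW i)).trans h1)⟩

/-- With all gains `1`, the commutator space consists of the zero-sum combinations of the frame, and
the group permutes the frame as the full symmetric group. -/
theorem hasOddSymmetricType_restrict [Fintype ι] [FiniteDimensional K V] [CharP K 2]
    (hv : IsPresentation S v φ) (hF : IsFrame e f) (hI : Nontrivial ι)
    (hdim : 2 ≤ finrank K (commutatorSpace (Subgroup.closure S)))
    (hirr : IsIrreducibleGroup (restrict (Subgroup.closure S)
      (commutatorSpace (Subgroup.closure S))))
    (hmon : ∀ g ∈ Subgroup.closure S, ∀ i, ∃ j, g (e i) = e j)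
    (hG : ∀ i j, i ≠ j → ContainsEdge (Subgroup.closure S) e f i j 1)
    (hS : ∀ t ∈ S, ∃ i j, IsEdge e f i j 1 t) :
    HasOddSymmetricType (restrict (Subgroup.closure S)
      (commutatorSpace (Subgroup.closure S))) := by
  classical
  set W := commutatorSpace (Subgroup.closure S) with hW
  set m := Fintype.card ι with hm
  let σ : ι ≃ Fin m := Fintype.equivFin ι
  have hsum : ∀ w : W, ∑ i, f i w = 0 := by
    intro w
    have hw : (w : V) ∈ vecSpan S := by rw [← hv.commutatorSpace_eq]; exact w.2
    have h1 := (hv.forall_vecSpan_iff (∑ i, f i)).2 (fun t ht => by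
      obtain ⟨i, j, h⟩ := hS t ht
      obtain ⟨α, hα, h1, -⟩ := (h.along hF).exists_smul (hv t ht).apply
      have h2 : ∀ k, (∑ i, f i) (e k) = 1 := fun k => by
        rw [LinearMap.sum_apply, Finset.sum_eq_single k]
        · exact hF.self k
        · exact fun l _ hl => hF.ne l k hl
        · simp
      rw [h1, map_smul, map_add, map_smul, h2, h2, one_smul, CharTwo.add_self_eq_zero, smul_zero])
      w hw
    rwa [LinearMap.sum_apply] at h1
  have hexp : ∀ w : W, (w : V) = ∑ i, f i w • e i := by
    intro w
    have hw : (w : V) ∈ Submodule.span K (Set.range e) := by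
      refine vecSpan_le_span_of_edges (f := f) hv (fun t ht => ?_) (by
        rw [← hv.commutatorSpace_eq]; exact w.2)
      obtain ⟨i, j, h⟩ := hS t ht
      exact ⟨i, j, 1, h⟩
    obtain ⟨a, ha⟩ := (Submodule.mem_span_range_iff_exists_fun K).1 hw
    have h1 : ∀ i, f i w = a i := fun i => by
      rw [← ha, map_sum, Finset.sum_eq_single i]
      · simp [hF.self]
      · intro j _ hj
        simp [hF.ne i j hj.symm]
      · simp
    rw [← ha]
    exact Finset.sum_congr rfl fun i _ => by rw [ha, h1]
  let E₀ : W →ₗ[K] (Fin m → K) := LinearMap.pi fun k => f (σ.symm k) ∘ₗ W.subtype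
  have hE₀ : ∀ w k, E₀ w k = f (σ.symm k) w := fun w k => rfl
  have hE₀mem : ∀ w, E₀ w ∈ sumZero K m := fun w => by
    rw [mem_sumZero, ← Equiv.sum_comp σ, ← hsum w]
    exact Finset.sum_congr rfl fun i _ => by rw [hE₀, Equiv.symm_apply_apply]
  let E₁ : W →ₗ[K] sumZero K m := E₀.codRestrict _ hE₀mem
  have hE₁ : ∀ w i, (E₁ w : Fin m → K) (σ i) = f i w := fun w i => by
    change f (σ.symm (σ i)) w = _
    rw [Equiv.symm_apply_apply]
  have hinj : Function.Injective E₁ := by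
    intro w w' h
    ext
    rw [hexp w, hexp w']
    exact Finset.sum_congr rfl fun i _ => by rw [← hE₁, ← hE₁, h]
  obtain ⟨o, o', hoo⟩ := hI
  have hvecW : ∀ i, e i + e o ∈ W := fun i => by
    by_cases hi : i = o
    · rw [hi, ← two_smul K, CharTwo.two_eq_zero, zero_smul]; exact W.zero_mem
    · have := (hG i o hi).vec_mem_commutatorSpace hF
      rwa [one_smul] at this
  have hcomb : ∀ y : ι → K, ∑ i, y i = 0 → ∑ i, y i • e i ∈ W := by
    intro y hy
    -- A zero-sum combination is unchanged if `e o` is added to every frame vector, and the `e i + e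
    -- o` lie in `W`.
    have : ∑ i, y i • e i = ∑ i, y i • (e i + e o) := by
      simp only [smul_add, Finset.sum_add_distrib]
      rw [← Finset.sum_smul, hy, zero_smul, add_zero]
    rw [this]
    exact W.sum_mem fun i _ => W.smul_mem _ (hvecW i)
  have hfcomb : ∀ (y : ι → K) i, f i (∑ j, y j • e j) = y i := fun y i => by
    rw [map_sum, Finset.sum_eq_single i]
    · simp [hF.self]
    · intro j _ hj
      simp [hF.ne i j hj.symm]
    · simp
  have hsurj : Function.Surjective E₁ := by
    rintro ⟨y, hy⟩
    rw [mem_sumZero, ← Equiv.sum_comp σ] at hy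
    refine ⟨⟨_, hcomb (fun i => y (σ i)) hy⟩, ?_⟩
    ext k
    obtain ⟨i, rfl⟩ := σ.surjective k
    rw [hE₁]
    exact hfcomb _ i
  let E : W ≃ₗ[K] sumZero K m := LinearEquiv.ofBijective E₁ ⟨hinj, hsurj⟩
  have hE : ∀ w i, (E w : Fin m → K) (σ i) = f i w := hE₁
  have hact : ∀ (g : V ≃ₗ[K] V) (τ : Equiv.Perm ι), (∀ i, g (e i) = e (τ i)) → ∀ w : W, ∀ i,
      f (τ i) (g w) = f i w := by
    intro g τ hgτ w i
    rw [hexp w, map_sum]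
    simp only [map_smul, hgτ]
    have h1 : ∑ j, f j (w : V) • e (τ j) = ∑ j, f (τ.symm j) (w : V) • e j := by
      rw [← Equiv.sum_comp τ fun j => f (τ.symm j) (w : V) • e j]
      simp
    rw [h1, hfcomb, hfcomb, Equiv.symm_apply_apply]
  have hperm : ∀ τ : Equiv.Perm ι, ∃ g ∈ Subgroup.closure S, ∀ i, g (e i) = e (τ i) := by
    intro τ
    induction τ using Equiv.Perm.swap_induction_on with
    | one => exact ⟨1, one_mem _, fun i => rfl⟩
    | swap_mul τ i j hij ih =>
      obtain ⟨p, hp, hpb⟩ := ih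
      obtain ⟨t, ht, hte⟩ := hG i j hij
      refine ⟨t * p, mul_mem ht hp, fun k => ?_⟩
      rw [LinearEquiv.mul_apply, hpb, Equiv.Perm.mul_apply]
      by_cases h1 : τ k = i
      · rw [h1, Equiv.swap_apply_left, hte.apply_left hF, one_smul]
      by_cases h2 : τ k = j
      · rw [h2, Equiv.swap_apply_right, hte.apply_right hF, inv_one, one_smul]
      · rw [Equiv.swap_apply_of_ne_of_ne h1 h2, hte.apply_of_ne hF h1 h2]
  have hgroup : ∀ g : W ≃ₗ[K] W, g ∈ restrict (Subgroup.closure S) W ↔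
      ∃ ρ : Equiv.Perm (Fin m), ∀ (x : W) (i : Fin m),
        (E (g x) : Fin m → K) (ρ i) = (E x : Fin m → K) i := by
    intro g
    constructor
    · rintro ⟨g', hg', hgg⟩
      choose τ hτ using hmon g' hg'
      have hτinj : Function.Injective τ := by
        intro i j hij
        have h1 : e i = e j := g'.injective (by rw [hτ, hτ, hij])
        exact hF.linearIndependent.injective h1
      let τ' : Equiv.Perm ι := Equiv.ofBijective τ (Finite.injective_iff_bijective.1 hτinj)
      refine ⟨(σ.symm.trans τ').trans σ, fun x k => ?_⟩
      obtain ⟨i, rfl⟩ := σ.surjective k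
      have h1 := hact g' τ' hτ x i
      simp only [Equiv.trans_apply, Equiv.symm_apply_apply]
      rw [hE, hE, hgg, h1]
    · rintro ⟨ρ, hρ⟩
      let τ : Equiv.Perm ι := (σ.trans ρ).trans σ.symm
      obtain ⟨g', hg', hgτ⟩ := hperm τ
      obtain ⟨h, hh, hhg⟩ := exists_mem_restrict hg'
      have : g = h := by
        ext1 x
        apply E.injective
        ext k
        obtain ⟨k', rfl⟩ := ρ.surjective k
        obtain ⟨i, rfl⟩ := σ.surjective k'
        have h1 : ρ (σ i) = σ (τ i) := by simp [τ]
        rw [hρ, h1, hE, hE, hhg, hact g' τ hgτ]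
      rw [this]; exact hh
  have hodd : Odd m := by
    rw [← Nat.not_even_iff_odd]
    intro heven
    have hm0 : (m : K) = 0 := by
      obtain ⟨k, hk⟩ := heven
      rw [hk, Nat.cast_add]; exact CharTwo.add_self_eq_zero _
    -- For even `m` the all-ones vector has zero sum and spans an invariant line, which is proper as
    -- `dim W ≥ 2`.
    let x : W := ⟨∑ i, (1 : K) • e i, hcomb (fun _ => 1) (by simp [← hm, hm0])⟩
    have hEx : ∀ k, (E x : Fin m → K) k = 1 := fun k => by
      obtain ⟨i, rfl⟩ := σ.surjective k
      rw [hE]; exact hfcomb (fun _ => 1) i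
    have hfix : ∀ g ∈ restrict (Subgroup.closure S) W, g x = x := by
      intro g hg
      obtain ⟨ρ, hρ⟩ := (hgroup g).1 hg
      apply E.injective
      ext k
      obtain ⟨k', rfl⟩ := ρ.surjective k
      rw [hρ, hEx, hEx]
    have hx0 : x ≠ 0 := fun h0 => by
      have := hEx (σ o)
      rw [h0, map_zero] at this
      exact zero_ne_one this
    rcases hirr.2 (Submodule.span K {x}) (by
      intro g hg w hw
      obtain ⟨c, rfl⟩ := Submodule.mem_span_singleton.1 hw
      rw [map_smul, hfix g hg]; exact hw) with h1 | h1
    · exact hx0 (Submodule.span_singleton_eq_bot.1 h1)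
    · have h2 := finrank_span_singleton (K := K) hx0
      rw [h1, finrank_top] at h2
      omega
  have hm2 : 1 < m := Fintype.one_lt_card_iff.2 ⟨o, o', hoo⟩
  refine ⟨inferInstance, m, ?_, hodd, E, hgroup⟩
  obtain ⟨k, hk⟩ := hodd
  omega

end Irreducible

/-- The gain group of the subset decides its type. It may be trivial even when that of `T` is not,
which is how odd symmetric type arises. -/
theorem HasMonomialType.forall_subset [FiniteDimensional K V] [Finite K]
    (h : HasMonomialType (Subgroup.closure T)) (hT : ∀ t ∈ T, IsTransvection t) (hS : S ⊆ T) :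
    (IsWeaklyNondegenerate S → IsNondegenerate S) ∧
    (2 ≤ finrank K (commutatorSpace (Subgroup.closure S)) →
      IsIrreducibleGroup (restrict (Subgroup.closure S) (commutatorSpace (Subgroup.closure S))) →
      HasMonomialType (restrict (Subgroup.closure S) (commutatorSpace (Subgroup.closure S))) ∨
        HasOddSymmetricType
          (restrict (Subgroup.closure S) (commutatorSpace (Subgroup.closure S)))) := by
  classical
  have : CharP K 2 := h.1
  obtain ⟨v, φ, hv⟩ := exists_isPresentation hT
  obtain ⟨n, b, hb⟩ := h.exists_isEdge hv
  have hvS := hv.mono hS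
  have hbS : ∀ t ∈ S, ∃ i j c, IsEdge b b.coord i j c t := fun t ht => hb t (hS ht)
  refine ⟨isNondegenerate_of_finrank_eq (finrank_vecSpan_eq_of_edges hvS b hbS), ?_⟩
  intro hdim hirr
  obtain ⟨I, o, o', hoo, hI, htrans⟩ := exists_subframe_of_irreducible hvS b hbS hirr
  have hF : IsFrame (fun i : I => b i) (fun i : I => b.coord i) :=
    ⟨fun i => (isFrame_basis b).self i,
      fun i j hij => (isFrame_basis b).ne i j fun h => hij (Subtype.ext h)⟩
  obtain ⟨e, f, H, hF', -, hmon, hG, hedge⟩ := exists_gain_subgroup hF hI o htrans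
  by_cases hH : H = ⊥
  · subst hH
    refine Or.inr (hasOddSymmetricType_restrict hvS hF' ⟨o, o', hoo⟩ hdim hirr ?_ ?_ ?_)
    · intro g hg i
      obtain ⟨j, h, hh, h1⟩ := hmon g hg i
      rw [Subgroup.mem_bot.1 hh, Units.val_one, one_smul] at h1
      exact ⟨j, h1⟩
    · intro i j hij
      have := hG i j hij 1 (one_mem _)
      rwa [Units.val_one] at this
    · intro t ht
      obtain ⟨i, j, h, hh, h1⟩ := hedge t ht
      rw [Subgroup.mem_bot.1 hh, Units.val_one] at h1
      exact ⟨i, j, h1⟩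
  · exact Or.inl (hasMonomialType_restrict hvS hF' hH ⟨o, o', hoo⟩ hdim hmon hG hedge)

end TransvectionGroups

open TransvectionGroups in
theorem mainTheorem8 {K V : Type*} [Field K] [Finite K] [AddCommGroup V] [Module K V]
    [FiniteDimensional K V] (hn : 2 ≤ Module.finrank K V)
    (T : Set (V ≃ₗ[K] V)) (hT : ∀ t ∈ T, IsTransvection t) (hdense : IsDense T)
    (hsymp : ¬ PreservesSymplecticForm (Subgroup.closure T)) :
    HasMonomialType (Subgroup.closure T) ↔
      ∀ T₀ : Set (V ≃ₗ[K] V), T₀ ⊆ T → T₀.encard ≤ 1000 →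
        (IsWeaklyNondegenerate T₀ → IsNondegenerate T₀) ∧
        (2 ≤ Module.finrank K (commutatorSpace (Subgroup.closure T₀)) →
          IsIrreducibleGroup
            (restrict (Subgroup.closure T₀) (commutatorSpace (Subgroup.closure T₀))) →
          HasMonomialType
              (restrict (Subgroup.closure T₀) (commutatorSpace (Subgroup.closure T₀))) ∨
            HasOddSymmetricType
              (restrict (Subgroup.closure T₀) (commutatorSpace (Subgroup.closure T₀)))) :=
  ⟨fun h _ hT₀ _ => h.forall_subset hT hT₀,
    fun h => hasMonomialType_of_forall_small hn hT hdense hsymp h⟩
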